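/- Let $\alpha\in[1,2)$ and $R>0$. For $s\ge 0$ write $\mathcal D^{s}=(-\Delta)^{s/2}$, i.e. $\mathcal D^s$ is the Fourier multiplier with symbol $|\xi|^s$ ($\xi$ the angular frequency). Let $\Delta t>0$, $N\in\mathbb N$, and let $u^0,\dots,u^N\in L^2(\mathbb R)$ be real-valued and satisfy the time-discrete Crank--Nicolson scheme for the fractional KdV equation $u_t+(u^2/2)_x-(-\Delta)^{\alpha/2}u_x=0$: with $u^{n+1/2}:=\tfrac12(u^n+u^{n+1})$, for $0\le n<N$ one has $u^{n+1/2}\in H^{1+\alpha}(\mathbb R)$ and $$\langle u^{n+1},v\rangle+\Delta t\Big\langle\Big(\tfrac{(u^{n+1/2})^2}{2}\Big)_x,v\Big\rangle+\Delta t\,\langle\mathcal D^\alpha u^{n+1/2},v_x\rangle=\langle u^n,v\rangle\qquad\text{for all } v\in H^{1+\alpha}(\mathbb R),$$ where $\langle\cdot,\cdot\rangle$ is the $L^2(\mathbb R)$ inner product. Then for $0\le m\le N$ the midpoints $(u^{n+1/2})_{0\le n<m}$ belong to $\ell^2([0,m\Delta t];H^{\alpha/2}([-R,R]))$, with a bound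 independent of $\Delta t$, $m$, $N$ other than through $m\Delta t$: each $u^{n+1/2}$ restricts to an element of $H^{\alpha/2}([-R,R])$ and $$\Delta t\sum_{n=0}^{m-1}\|u^{n+1/2}\|_{H^{\alpha/2}([-R,R])}^2\le C\,(1+m\Delta t),$$ where $C$ depends only on $\alpha$, $R$ and $\|u^0\|_{L^2(\mathbb R)}$, and $$\|f\|_{H^{s}([-R,R])}^2=\int_{-R}^R|f|^2\,dx+\int_{-R}^R\int_{-R}^R\frac{|f(x)-f(y)|^2}{|x-y|^{1+2s}}\,dx\,dy .$$ Moreover, for every smooth cut-off function $\phi\in C^\infty(\mathbb R)$ with $1\le\phi\le 2+2R$, $\phi_x=1$ for $|x|<R$, $\phi_x=0$ for $|x|\ge R+1$, $0\le\phi_x\le1$ and $\sqrt{\phi_x}\in C_c^\infty(\mathbb R)$, $$\Delta t\sum_{n=0}^{m-1}\int_{\mathbb R}\phi_x\,|\mathcal D^{\alpha/2}u^{n+1/2}|^2\,dx\le C_\phi\,(1+m\Delta t),\qquad 0\le m\le N,$$ where $C_\phi$ depends only on $\alpha$, $R$, $\phi$ and $\|u^0\|_{L^2(\mathbb R)}$.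 -/

import Mathlib

open MeasureTheory
open scoped FourierTransform ContDiff ENNReal

namespace FractionalKdV

noncomputable section

/-- The space `L²(ℝ)` of real-valued functions. -/
abbrev L2 : Type := Lp ℝ 2 (volume : Measure ℝ)

/-- A real-valued `L²` function, regarded as a complex-valued one. -/
def toComplex (f : L2) : Lp ℂ 2 (volume : Measure ℝ) :=
  Complex.ofRealCLM.compLp f

/-- `f` belongs to the Sobolev space `H^s(ℝ)`. -/
def MemHs (s : ℝ) (f : L2) : Prop :=
  TemperedDistribution.MemSobolev s 2 (Lp.toTemperedDistribution (toComplex f))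

/-- The function `|2πξ|^s (𝓕 f)(ξ)`. In Mathlib's normalization of the Fourier transform
`𝓕 f (ξ) = ∫ e^{-2πixξ} f(x) dx`, the symbol of `(-Δ)^{s/2}` is `|2πξ|^s`. -/
def fracSymbol (s : ℝ) (f : L2) (ξ : ℝ) : ℂ :=
  ((|2 * Real.pi * ξ| ^ s : ℝ) : ℂ) * (𝓕 (toComplex f) : Lp ℂ 2 (volume : Measure ℝ)) ξ

open Classical in
/-- The fractional derivative `𝓓^s f = (-Δ)^{s/2} f`, defined by
`𝓕 (𝓓^s f)(ξ) = |2πξ|^s (𝓕 f)(ξ)` whenever the right-hand side is square integrable, in particular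
for all `f ∈ H^s(ℝ)` with `s ≥ 0` (and by `0` otherwise). As the symbol is even, `𝓓^s f` takes real
values almost everywhere. -/
def fracD (s : ℝ) (f : L2) : Lp ℂ 2 (volume : Measure ℝ) :=
  if h : MemLp (fracSymbol s f) 2 volume then 𝓕⁻ (h.toLp (fracSymbol s f)) else 0

/-- `g` is the weak derivative of `f` on `ℝ`. -/
def HasWeakDeriv (f g : ℝ → ℝ) : Prop :=
  LocallyIntegrable f volume ∧ LocallyIntegrable g volume ∧
    ∀ ψ : ℝ → ℝ, ContDiff ℝ ∞ ψ → HasCompactSupport ψ →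
      ∫ x, f x * deriv ψ x = -∫ x, g x * ψ x

open Classical in
/-- The weak derivative of `f` on `ℝ` (unique up to a null set) if it exists, and `0` otherwise. -/
def weakDeriv (f : ℝ → ℝ) : ℝ → ℝ :=
  if h : ∃ g, HasWeakDeriv f g then h.choose else 0

/-- The midpoint `(f + g) / 2`. -/
def midpt (f g : L2) : L2 := (1 / 2 : ℝ) • (f + g)

/-- One Crank–Nicolson step of length `τ` for `u_t + (u²/2)_x - 𝓓^α u_x = 0`, leading from `u₀` to
`u₁`: the midpoint `w = (u₀ + u₁) / 2` lies in `H^{1+α}(ℝ)` and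
`⟨u₁, v⟩ + τ ⟨(w²/2)_x, v⟩ + τ ⟨𝓓^α w, v_x⟩ = ⟨u₀, v⟩` for all `v ∈ H^{1+α}(ℝ)`. -/
def IsCNStep (α τ : ℝ) (u₀ u₁ : L2) : Prop :=
  MemHs (1 + α) (midpt u₀ u₁) ∧
    ∀ v : L2, MemHs (1 + α) v →
      (∫ x, u₁ x * v x)
        + τ * (∫ x, weakDeriv (fun y => (midpt u₀ u₁) y ^ 2 / 2) x * v x)
        + τ * (∫ x, (fracD α (midpt u₀ u₁) x).re * weakDeriv v x)
      = ∫ x, u₀ x * v x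

/-- `u 0, …, u N` is a solution of the Crank–Nicolson scheme with time step `τ`. -/
def IsCNSolution (α τ : ℝ) (N : ℕ) (u : ℕ → L2) : Prop :=
  ∀ n < N, IsCNStep α τ (u n) (u (n + 1))

/-- The smooth cut-off functions `φ` associated with `R`. -/
structure IsCutoff (R : ℝ) (φ : ℝ → ℝ) : Prop where
  smooth : ContDiff ℝ ∞ φ
  one_le : ∀ x, 1 ≤ φ x
  le : ∀ x, φ x ≤ 2 + 2 * R
  deriv_eq_one : ∀ x, |x| < R → deriv φ x = 1
  deriv_eq_zero : ∀ x, R + 1 ≤ |x| → deriv φ x = 0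
  deriv_nonneg : ∀ x, 0 ≤ deriv φ x
  deriv_le_one : ∀ x, deriv φ x ≤ 1
  sqrt_smooth : ContDiff ℝ ∞ (fun x => Real.sqrt (deriv φ x))
  sqrt_compact : HasCompactSupport (fun x => Real.sqrt (deriv φ x))

/-- The squared norm of the fractional Sobolev space `H^s(S)`, `0 < s < 1`:
`∫_S |f|² + ∫_S ∫_S |f(x) - f(y)|² / |x - y|^{1+2s}`. -/
def hsNormSqOn (s : ℝ) (S : Set ℝ) (f : ℝ → ℝ) : ℝ≥0∞ :=
  (∫⁻ x in S, ‖f x‖ₑ ^ 2)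
    + ∫⁻ x in S, ∫⁻ y in S, ‖f x - f y‖ₑ ^ 2 / ENNReal.ofReal (|x - y| ^ (1 + 2 * s))

/-- `f` belongs to the fractional Sobolev space `H^s(S)`, `0 < s < 1`. -/
def MemHsOn (s : ℝ) (S : Set ℝ) (f : ℝ → ℝ) : Prop :=
  AEStronglyMeasurable f (volume.restrict S) ∧ hsNormSqOn s S f < ⊤

end

end FractionalKdV

open FractionalKdV

/-! Write `α = 2p` with `1/2 ≤ p < 1`. Tested with its own midpoint `w`, the scheme conserves the L²
norm: `w² w_x` is a total derivative, and the dispersive pairing has a purely imaginary density in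
frequency (`norm_eq_of_cnStep`).

Smoothing comes from testing with `f w`, where `f` is close to the increasing weight `φ`. The mass
terms telescope in time and convection gives `-(1/3) ∫ f_x w³`. The dispersive term, symmetrized in
frequency, carries the symbol `ξ|ξ|^{2p} - η|η|^{2p}`, which equals `(1+2p)(ξ-η)|ξ|^p|η|^p` up to
`O(|ξ-η|^{1+2p})` (`symbol_remainder`). The leading part is `(1+2p)/2 ∫ f_x |𝓓^p w|²`. The remainder
only differentiates `f`, so it costs no more than `‖w‖²` (`abs_dispersion_sub_smoothing_le`).

The cubic term is the one that could destroy the estimate. With `χ = √φ_x`, Cauchy–Schwarz gives `∫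
χ²|w|³ ≤ ‖w‖₂ ‖χw‖₄²`. The embedding of `H^p` in `L⁴` at a small length scale, and the
L²-boundedness of the commutator of `𝓓^p` with `χ`, turn the right-hand side into a small multiple
of the smoothing term plus a constant (`integral_sq_mul_cube_le`), so it can be absorbed.

Since `φ` does not decay, `f` is a truncation of `φ` at distance `L`. Its derivative is within
`O(1/L)` of `φ_x`, and its remainder constant is uniform in `L` (`exists_compact_cutoff`). After
summation over the time steps, `L → ∞` with the discrete solution fixed. Finally `w = χw` on `(-R,
R)`, and the Gagliardo seminorm of `χw` is controlled by `𝓓^p(χw)`, hence by the commutator bound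
again (`exists_hsNormSqOn_le`). -/

section FourierL1L2

/-! ### Fourier inversion, Plancherel and convolution for concrete functions. -/

/-- The inverse Fourier transform of an integrable function is continuous. -/
theorem continuous_fourierInv_of_integrable {F : ℝ → ℂ} (hF : Integrable F) :
    Continuous (𝓕⁻ F) := by
  have h : Continuous (𝓕 F) :=
    VectorFourier.fourierIntegral_continuous Real.continuous_fourierChar
      (by simp only [innerₗ_apply_apply]; exact continuous_inner) hF
  have : 𝓕⁻ F = fun x => 𝓕 F (-x) := by
    ext x; exact Real.fourierInv_eq_fourier_neg F x
  rw [this]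
  exact h.comp continuous_neg

theorem norm_fourierInv_le {F : ℝ → ℂ} (x : ℝ) : ‖𝓕⁻ F x‖ ≤ ∫ ξ, ‖F ξ‖ := by
  rw [Real.fourierInv_eq_fourier_neg]
  exact VectorFourier.norm_fourierIntegral_le_integral_norm _ _ _ _ _

theorem integral_fourierInv_mul_eq_flip {F G : ℝ → ℂ} (hF : Integrable F) (hG : Integrable G) :
    ∫ x, 𝓕⁻ F x * G x = ∫ x, F x * 𝓕⁻ G x := by
  have h := VectorFourier.integral_fourierIntegral_smul_eq_flip (μ := volume) (ν := volume)
    (L := innerₗ ℝ) (f := F) (g := fun x => G (-x))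
    Real.continuous_fourierChar (by simp only [innerₗ_apply_apply]; exact continuous_inner) hF hG.comp_neg
  have e1 : ∫ x, 𝓕⁻ F x * G x = ∫ x, 𝓕 F x * G (-x) := by
    rw [← integral_neg_eq_self]
    simp only [Real.fourierInv_eq_fourier_neg, neg_neg]
  have e2 : ∀ x, 𝓕⁻ G x = 𝓕 (fun y => G (-y)) x := by
    intro x
    rw [Real.fourierInv_eq_fourier_comp_neg]
  rw [e1]
  simp only [e2]
  simp only [smul_eq_mul, flip_innerₗ] at h
  exact h

/-- On `L¹ ∩ L²` the inverse Fourier transform of `L²` is the inverse Fourier integral. -/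
theorem coeFn_fourierInv_toLp {F : ℝ → ℂ} (hF : Integrable F) (hF2 : MemLp F 2 volume) :
    ((𝓕⁻ (hF2.toLp F) : Lp ℂ 2 (volume : Measure ℝ)) : ℝ → ℂ) =ᵐ[volume] 𝓕⁻ F := by
  -- It suffices to test with smooth compactly supported `g`. Duality defines the distributional
  -- transform and Fubini moves the Fourier integral, so both sides become `∫ F 𝓕⁻G`.
  refine ae_eq_of_integral_contDiff_smul_eq ((Lp.memLp _).locallyIntegrable (by norm_num))
    (continuous_fourierInv_of_integrable hF).locallyIntegrable ?_
  intro g hg hgc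
  have hg₁ : HasCompactSupport (Complex.ofRealCLM ∘ g) := hgc.comp_left rfl
  have hg₂ : ContDiff ℝ ∞ (Complex.ofRealCLM ∘ g) := by fun_prop
  set G : SchwartzMap ℝ ℂ := hg₁.toSchwartzMap hg₂ with hG
  have hGa : ∀ x, G x = (g x : ℂ) := fun x => rfl
  have h1 := congrArg (fun T => T G) (Lp.fourierInv_toTemperedDistribution_eq (hF2.toLp F))
  simp only [TemperedDistribution.fourierInv_apply, Lp.toTemperedDistribution_apply] at h1
  have h2 : ∫ x, (𝓕⁻ G) x • (hF2.toLp F) x = ∫ x, 𝓕⁻ (G : ℝ → ℂ) x * F x := by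
    refine integral_congr_ae ?_
    filter_upwards [hF2.coeFn_toLp] with x hx
    rw [hx, SchwartzMap.fourierInv_coe, smul_eq_mul]
  rw [h2, integral_fourierInv_mul_eq_flip G.integrable hF] at h1
  simp only [smul_eq_mul, hGa] at h1
  simp only [Complex.real_smul]
  exact h1.symm

theorem memLp_fourierInv {F : ℝ → ℂ} (hF : Integrable F) (hF2 : MemLp F 2 volume) :
    MemLp (𝓕⁻ F) 2 volume :=
  (memLp_congr_ae (coeFn_fourierInv_toLp hF hF2)).1 (Lp.memLp _)

/-- Plancherel's identity on `L¹ ∩ L²`. -/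
theorem integral_fourierInv_mul_conj {F G : ℝ → ℂ} (hF : Integrable F) (hF2 : MemLp F 2 volume)
    (hG : Integrable G) (hG2 : MemLp G 2 volume) :
    ∫ x, 𝓕⁻ F x * starRingEnd ℂ (𝓕⁻ G x) = ∫ ξ, F ξ * starRingEnd ℂ (G ξ) := by
  have h := Lp.inner_fourier_eq (𝓕⁻ (hG2.toLp G)) (𝓕⁻ (hF2.toLp F))
  rw [FourierTransform.fourier_fourierInv_eq, FourierTransform.fourier_fourierInv_eq,
    L2.inner_def, L2.inner_def] at h
  have h1 : ∫ x, 𝓕⁻ F x * starRingEnd ℂ (𝓕⁻ G x)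
      = ∫ x, inner ℂ ((𝓕⁻ (hG2.toLp G) : Lp ℂ 2 (volume : Measure ℝ)) x)
        ((𝓕⁻ (hF2.toLp F) : Lp ℂ 2 (volume : Measure ℝ)) x) := by
    refine integral_congr_ae ?_
    filter_upwards [coeFn_fourierInv_toLp hF hF2, coeFn_fourierInv_toLp hG hG2] with x hx hy
    rw [hx, hy, RCLike.inner_apply]
  rw [h1, ← h]
  refine integral_congr_ae ?_
  filter_upwards [hF2.coeFn_toLp, hG2.coeFn_toLp] with x hx hy
  rw [hx, hy, RCLike.inner_apply]

theorem integral_norm_sq_fourierInv {F : ℝ → ℂ} (hF : Integrable F) (hF2 : MemLp F 2 volume) :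
    ∫ x, ‖𝓕⁻ F x‖ ^ 2 = ∫ ξ, ‖F ξ‖ ^ 2 := by
  have h := integral_fourierInv_mul_conj hF hF2 hF hF2
  simp only [Complex.mul_conj, Complex.normSq_eq_norm_sq] at h
  rw [integral_complex_ofReal, integral_complex_ofReal] at h
  exact_mod_cast h

theorem hasDerivAt_fourierInv {F : ℝ → ℂ} (hF : Integrable F)
    (hF' : Integrable fun ξ : ℝ => (2 * Real.pi * Complex.I * ξ) * F ξ) (x : ℝ) :
    HasDerivAt (𝓕⁻ F) (𝓕⁻ (fun ξ : ℝ => (2 * Real.pi * Complex.I * ξ) * F ξ) x) x := by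
  have hx : Integrable fun ξ : ℝ => ξ • F ξ := by
    have := hF'.const_mul (2 * Real.pi * Complex.I)⁻¹
    refine this.congr (Filter.Eventually.of_forall fun ξ => ?_)
    have : (2 * Real.pi * Complex.I : ℂ) ≠ 0 := Complex.two_pi_I_ne_zero
    simp only [Complex.real_smul]
    field_simp
  have h := (Real.hasDerivAt_fourier hF hx (-x)).scomp x (hasDerivAt_neg x)
  have e : 𝓕⁻ F = 𝓕 F ∘ fun y => -y := by
    ext y; exact Real.fourierInv_eq_fourier_neg F y
  rw [e]
  refine h.congr_deriv ?_
  rw [Real.fourierInv_eq_fourier_neg, neg_one_smul, Real.fourier_eq, Real.fourier_eq,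
    ← integral_neg]
  refine integral_congr_ae (Filter.Eventually.of_forall fun ξ => ?_)
  simp only [Circle.smul_def, smul_eq_mul]
  ring

/-- The convolution `(A ∗ F)(ξ) = ∫ A(ξ - η) F(η) dη`. -/
noncomputable def cv (A F : ℝ → ℂ) (ξ : ℝ) : ℂ := ∫ η, A (ξ - η) * F η

theorem cv_eq_convolution (A F : ℝ → ℂ) :
    cv A F = MeasureTheory.convolution F A (ContinuousLinearMap.mul ℂ ℂ) volume := by
  ext ξ
  simp only [cv, MeasureTheory.convolution, ContinuousLinearMap.mul_apply']
  exact integral_congr_ae (Filter.Eventually.of_forall fun η => mul_comm _ _)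

theorem integrable_cv {A F : ℝ → ℂ} (hA : Integrable A) (hF : Integrable F) :
    Integrable (cv A F) := by
  rw [cv_eq_convolution]
  exact hF.integrable_convolution _ hA

/-- The convolution theorem. -/
theorem fourierInv_cv {A F : ℝ → ℂ} (hA : Integrable A) (hF : Integrable F) (x : ℝ) :
    𝓕⁻ (cv A F) x = 𝓕⁻ A x * 𝓕⁻ F x := by
  rw [cv_eq_convolution]
  simp only [Real.fourierInv_eq_fourier_neg]
  rw [Real.fourier_mul_convolution_eq hF hA, mul_comm]

end FourierL1L2

/-! ### L² bounds for operators and forms with a convolution-type kernel. -/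

section ConvolutionBounds

/-- The weighted Cauchy–Schwarz inequality. -/
theorem sq_lintegral_mul_le {μ : Measure ℝ} {a f : ℝ → ℝ≥0∞} (ha : Measurable a)
    (hf : Measurable f) :
    (∫⁻ x, a x * f x ∂μ) ^ 2 ≤ (∫⁻ x, a x ∂μ) * ∫⁻ x, a x * f x ^ 2 ∂μ := by
  -- Hölder for the splitting `a f = a^{1/2} · (a^{1/2} f)`.
  have h := ENNReal.lintegral_mul_le_Lp_mul_Lq μ Real.HolderConjugate.two_two
    (f := fun x => a x ^ (1 / 2 : ℝ)) (g := fun x => a x ^ (1 / 2 : ℝ) * f x)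
    (by fun_prop) (by fun_prop)
  have e1 : ∀ x, a x ^ (1 / 2 : ℝ) * (a x ^ (1 / 2 : ℝ) * f x) = a x * f x := by
    intro x
    rw [← mul_assoc, ← ENNReal.rpow_add_of_nonneg _ _ (by norm_num) (by norm_num)]
    norm_num
  have e2 : ∀ x, (a x ^ (1 / 2 : ℝ)) ^ (2 : ℝ) = a x := by
    intro x
    rw [← ENNReal.rpow_mul]; norm_num
  have e3 : ∀ x, (a x ^ (1 / 2 : ℝ) * f x) ^ (2 : ℝ) = a x * f x ^ 2 := by
    intro x
    rw [ENNReal.mul_rpow_of_nonneg _ _ (by norm_num), e2]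
    norm_num
  simp only [Pi.mul_apply, e1, e2, e3] at h
  calc (∫⁻ x, a x * f x ∂μ) ^ 2
      ≤ ((∫⁻ x, a x ∂μ) ^ (1 / 2 : ℝ) * (∫⁻ x, a x * f x ^ 2 ∂μ) ^ (1 / 2 : ℝ)) ^ 2 := by
        gcongr
    _ = _ := by
        rw [mul_pow, ← ENNReal.rpow_natCast, ← ENNReal.rpow_natCast, ← ENNReal.rpow_mul,
          ← ENNReal.rpow_mul]
        norm_num

/-- Young's inequality `L¹ ∗ L² ⊆ L²`. -/
theorem lintegral_sq_conv_le {a f : ℝ → ℝ≥0∞} (ha : Measurable a) (hf : Measurable f) :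
    ∫⁻ ξ, (∫⁻ η, a (ξ - η) * f η) ^ 2 ≤ (∫⁻ ζ, a ζ) ^ 2 * ∫⁻ η, f η ^ 2 := by
  calc ∫⁻ ξ, (∫⁻ η, a (ξ - η) * f η) ^ 2
      ≤ ∫⁻ ξ, (∫⁻ ζ, a ζ) * ∫⁻ η, a (ξ - η) * f η ^ 2 := by
        refine lintegral_mono fun ξ => ?_
        refine (sq_lintegral_mul_le (by fun_prop) hf).trans_eq ?_
        rw [lintegral_sub_left_eq_self a ξ]
    _ = (∫⁻ ζ, a ζ) * ∫⁻ ξ, ∫⁻ η, a (ξ - η) * f η ^ 2 := by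
        rw [lintegral_const_mul]
        exact Measurable.lintegral_prod_right' (f := fun p : ℝ × ℝ => a (p.1 - p.2) * f p.2 ^ 2)
          (by fun_prop)
    _ = (∫⁻ ζ, a ζ) * ∫⁻ η, ∫⁻ ξ, a (ξ - η) * f η ^ 2 := by
        rw [lintegral_lintegral_swap]
        exact Measurable.aemeasurable (by fun_prop)
    _ = _ := by
        have : ∀ η, ∫⁻ ξ, a (ξ - η) * f η ^ 2 = (∫⁻ ζ, a ζ) * f η ^ 2 := by
          intro η
          rw [lintegral_mul_const _ (by fun_prop), lintegral_sub_right_eq_self a η]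
        simp only [this]
        rw [lintegral_const_mul _ (by fun_prop)]
        ring

theorem ENNReal_mul_le_add_sq (x y : ℝ≥0∞) : x * y ≤ x ^ 2 + y ^ 2 := by
  rcases le_total x y with h | h
  · calc x * y ≤ y * y := by gcongr
      _ = y ^ 2 := by ring
      _ ≤ _ := le_add_self
  · calc x * y ≤ x * x := by gcongr
      _ = x ^ 2 := by ring
      _ ≤ _ := le_self_add

/-- Schur's test in its crudest form: `xy ≤ x² + y²` separates the two functions, and in each half
the kernel integrates out by translation invariance. -/
theorem lintegral_bilin_conv_le {a f g : ℝ → ℝ≥0∞} (ha : Measurable a) (hf : Measurable f)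
    (hg : Measurable g) :
    ∫⁻ ξ, ∫⁻ η, a (ξ - η) * (f ξ * g η)
      ≤ (∫⁻ ζ, a ζ) * ((∫⁻ ξ, f ξ ^ 2) + ∫⁻ η, g η ^ 2) := by
  have h1 : ∫⁻ ξ, ∫⁻ η, a (ξ - η) * f ξ ^ 2 = (∫⁻ ζ, a ζ) * ∫⁻ ξ, f ξ ^ 2 := by
    have : ∀ ξ, ∫⁻ η, a (ξ - η) * f ξ ^ 2 = (∫⁻ ζ, a ζ) * f ξ ^ 2 := by
      intro ξ
      rw [lintegral_mul_const _ (by fun_prop), lintegral_sub_left_eq_self a ξ]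
    simp only [this]
    rw [lintegral_const_mul _ (by fun_prop)]
  have h2 : ∫⁻ ξ, ∫⁻ η, a (ξ - η) * g η ^ 2 = (∫⁻ ζ, a ζ) * ∫⁻ η, g η ^ 2 := by
    rw [lintegral_lintegral_swap (Measurable.aemeasurable (by fun_prop))]
    have : ∀ η, ∫⁻ ξ, a (ξ - η) * g η ^ 2 = (∫⁻ ζ, a ζ) * g η ^ 2 := by
      intro η
      rw [lintegral_mul_const _ (by fun_prop), lintegral_sub_right_eq_self a η]
    simp only [this]
    rw [lintegral_const_mul _ (by fun_prop)]
  calc ∫⁻ ξ, ∫⁻ η, a (ξ - η) * (f ξ * g η)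
      ≤ ∫⁻ ξ, ∫⁻ η, (a (ξ - η) * f ξ ^ 2 + a (ξ - η) * g η ^ 2) := by
        refine lintegral_mono fun ξ => lintegral_mono fun η => ?_
        rw [← mul_add]
        gcongr
        exact ENNReal_mul_le_add_sq _ _
    _ = ∫⁻ ξ, ((∫⁻ η, a (ξ - η) * f ξ ^ 2) + ∫⁻ η, a (ξ - η) * g η ^ 2) := by
        refine lintegral_congr fun ξ => ?_
        rw [lintegral_add_left (by fun_prop)]
    _ = _ := by
        rw [lintegral_add_left, h1, h2, mul_add]
        exact Measurable.lintegral_prod_right' (f := fun p : ℝ × ℝ => a (p.1 - p.2) * f p.1 ^ 2)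
          (by fun_prop)

theorem lintegral_enorm_sq_eq {F : ℝ → ℂ} (hF2 : MemLp F 2 volume) :
    ∫⁻ ξ, ‖F ξ‖ₑ ^ 2 = ENNReal.ofReal (∫ ξ, ‖F ξ‖ ^ 2) := by
  rw [ofReal_integral_eq_lintegral_ofReal ((memLp_two_iff_integrable_sq_norm hF2.1).1 hF2)
    (Filter.Eventually.of_forall fun _ => by positivity)]
  refine lintegral_congr fun ξ => ?_
  rw [ENNReal.ofReal_pow (norm_nonneg _), ofReal_norm]

theorem memLp_two_of_lintegral {F : ℝ → ℂ} (hF : AEStronglyMeasurable F volume)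
    (h : ∫⁻ ξ, ‖F ξ‖ₑ ^ 2 < ⊤) : MemLp F 2 volume := by
  refine ⟨hF, ?_⟩
  rw [eLpNorm_lt_top_iff_lintegral_rpow_enorm_lt_top (by norm_num) (by norm_num)]
  simpa using h

/-- A function dominated by a convolution with an `L¹` kernel is in `L²`. -/
theorem memLp_of_le_conv {a : ℝ → ℝ} (ham : Measurable a) (ha : Integrable a) (ha0 : ∀ x, 0 ≤ a x)
    {F T : ℝ → ℂ} (hFm : Measurable F) (hF2 : MemLp F 2 volume)
    (hT : AEStronglyMeasurable T volume)
    (h : ∀ ξ, ‖T ξ‖ₑ ≤ ∫⁻ η, ENNReal.ofReal (a (ξ - η)) * ‖F η‖ₑ) :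
    MemLp T 2 volume ∧ ∫ ξ, ‖T ξ‖ ^ 2 ≤ (∫ ζ, a ζ) ^ 2 * ∫ η, ‖F η‖ ^ 2 := by
  have key : ∫⁻ ξ, ‖T ξ‖ₑ ^ 2 ≤ ENNReal.ofReal ((∫ ζ, a ζ) ^ 2 * ∫ η, ‖F η‖ ^ 2) := by
    calc ∫⁻ ξ, ‖T ξ‖ₑ ^ 2 ≤ ∫⁻ ξ, (∫⁻ η, ENNReal.ofReal (a (ξ - η)) * ‖F η‖ₑ) ^ 2 := by
          refine lintegral_mono fun ξ => ?_
          gcongr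
          exact h ξ
      _ ≤ (∫⁻ ζ, ENNReal.ofReal (a ζ)) ^ 2 * ∫⁻ η, ‖F η‖ₑ ^ 2 :=
          lintegral_sq_conv_le (a := fun x => ENNReal.ofReal (a x)) (by fun_prop) (by fun_prop)
      _ = _ := by
          rw [lintegral_enorm_sq_eq hF2, ← ofReal_integral_eq_lintegral_ofReal ha
            (Filter.Eventually.of_forall ha0), ← ENNReal.ofReal_pow (integral_nonneg ha0),
            ← ENNReal.ofReal_mul (by positivity)]
  have hT2 : MemLp T 2 volume := memLp_two_of_lintegral hT (key.trans_lt ENNReal.ofReal_lt_top)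
  refine ⟨hT2, ?_⟩
  rw [lintegral_enorm_sq_eq hT2] at key
  refine (ENNReal.ofReal_le_ofReal_iff ?_).1 key
  have : 0 ≤ ∫ η, ‖F η‖ ^ 2 := integral_nonneg fun _ => by positivity
  positivity

theorem measurable_cv {A F : ℝ → ℂ} (hA : Measurable A) (hF : Measurable F) :
    Measurable (cv A F) := by
  have : StronglyMeasurable fun p : ℝ × ℝ => A (p.1 - p.2) * F p.2 :=
    Measurable.stronglyMeasurable (by fun_prop)
  exact this.integral_prod_right'.measurable

theorem enorm_cv_le (A F : ℝ → ℂ) (ξ : ℝ) :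
    ‖cv A F ξ‖ₑ ≤ ∫⁻ η, ENNReal.ofReal ‖A (ξ - η)‖ * ‖F η‖ₑ := by
  refine (enorm_integral_le_lintegral_enorm _).trans_eq ?_
  refine lintegral_congr fun η => ?_
  rw [enorm_mul, ofReal_norm]

theorem memLp_cv {A F : ℝ → ℂ} (hAm : Measurable A) (hA : Integrable A) (hFm : Measurable F)
    (hF2 : MemLp F 2 volume) :
    MemLp (cv A F) 2 volume ∧ ∫ ξ, ‖cv A F ξ‖ ^ 2 ≤ (∫ ζ, ‖A ζ‖) ^ 2 * ∫ η, ‖F η‖ ^ 2 :=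
  memLp_of_le_conv (by fun_prop) hA.norm (fun _ => norm_nonneg _) hFm hF2
    (measurable_cv hAm hFm).aestronglyMeasurable (enorm_cv_le A F)

/-- A bilinear form with a convolution kernel in `L¹` is bounded on `L²`. -/
theorem integrable_of_le_bilin {a : ℝ → ℝ} (ham : Measurable a) (ha : Integrable a)
    (ha0 : ∀ x, 0 ≤ a x) {F G : ℝ → ℂ} (hFm : Measurable F) (hF2 : MemLp F 2 volume)
    (hGm : Measurable G) (hG2 : MemLp G 2 volume) {P : ℝ × ℝ → ℂ} (hP : Measurable P)
    (h : ∀ ξ η, ‖P (ξ, η)‖ ≤ a (ξ - η) * (‖F ξ‖ * ‖G η‖)) :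
    Integrable P (volume.prod volume) ∧
      ‖∫ p, P p ∂(volume.prod volume)‖
        ≤ (∫ ζ, a ζ) * ((∫ ξ, ‖F ξ‖ ^ 2) + ∫ η, ‖G η‖ ^ 2) := by
  have hF0 : 0 ≤ ∫ η, ‖F η‖ ^ 2 := integral_nonneg fun _ => by positivity
  have hG0 : 0 ≤ ∫ η, ‖G η‖ ^ 2 := integral_nonneg fun _ => by positivity
  have hI0 : 0 ≤ ∫ ζ, a ζ := integral_nonneg ha0
  have key : ∫⁻ p, ‖P p‖ₑ ∂(volume.prod volume)
      ≤ ENNReal.ofReal ((∫ ζ, a ζ) * ((∫ ξ, ‖F ξ‖ ^ 2) + ∫ η, ‖G η‖ ^ 2)) := by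
    rw [lintegral_prod _ (by fun_prop)]
    calc ∫⁻ ξ, ∫⁻ η, ‖P (ξ, η)‖ₑ
        ≤ ∫⁻ ξ, ∫⁻ η, ENNReal.ofReal (a (ξ - η)) * (‖F ξ‖ₑ * ‖G η‖ₑ) := by
          refine lintegral_mono fun ξ => lintegral_mono fun η => ?_
          rw [← ofReal_norm, ← ofReal_norm, ← ofReal_norm, ← ENNReal.ofReal_mul (norm_nonneg _),
            ← ENNReal.ofReal_mul (ha0 _)]
          exact ENNReal.ofReal_le_ofReal (h ξ η)
      _ ≤ (∫⁻ ζ, ENNReal.ofReal (a ζ)) * ((∫⁻ ξ, ‖F ξ‖ₑ ^ 2) + ∫⁻ η, ‖G η‖ₑ ^ 2) :=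
          lintegral_bilin_conv_le (a := fun x => ENNReal.ofReal (a x)) (by fun_prop)
            (by fun_prop) (by fun_prop)
      _ = _ := by
          rw [lintegral_enorm_sq_eq hF2, lintegral_enorm_sq_eq hG2,
            ← ofReal_integral_eq_lintegral_ofReal ha (Filter.Eventually.of_forall ha0),
            ← ENNReal.ofReal_add hF0 hG0, ← ENNReal.ofReal_mul hI0]
  refine ⟨⟨hP.aestronglyMeasurable, key.trans_lt ENNReal.ofReal_lt_top⟩, ?_⟩
  have h2 := (enorm_integral_le_lintegral_enorm (μ := volume.prod volume) P).trans key
  rw [← ofReal_norm] at h2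
  exact (ENNReal.ofReal_le_ofReal_iff (by positivity)).1 h2

end ConvolutionBounds

/-! ### Pointwise inequalities for the symbols `|ξ|^p` and `ξ|ξ|^{2p}`. -/

section SymbolInequalities

/-- Subadditivity of `t ↦ t^p` for `p ≤ 1`. This is the symbol estimate behind the commutator of
`𝓓^p` with a smooth function. -/
theorem abs_rpow_sub_abs_rpow_le {p : ℝ} (hp : 0 < p) (hp1 : p ≤ 1) (a b : ℝ) :
    |(|a| ^ p - |b| ^ p)| ≤ |a - b| ^ p := by
  have key : ∀ a b : ℝ, |a| ^ p - |b| ^ p ≤ |a - b| ^ p := by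
    intro a b
    have h1 : |a| ≤ |a - b| + |b| := by
      have := abs_add_le (a - b) b
      simpa using this
    have h2 : |a| ^ p ≤ (|a - b| + |b|) ^ p := Real.rpow_le_rpow (abs_nonneg _) h1 hp.le
    have h3 := Real.rpow_add_le_add_rpow (abs_nonneg (a - b)) (abs_nonneg b) hp.le hp1
    linarith
  rw [abs_le]
  refine ⟨?_, key a b⟩
  have := key b a
  rw [abs_sub_comm] at this
  linarith

/-- The symmetric Taylor remainder of `t ↦ t^{1+2p}` at `1`. -/
theorem symbol_remainder_unit {p : ℝ} (hp : 1 / 2 ≤ p) (hp1 : p < 1) {t : ℝ} (ht : 1 / 2 ≤ t)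
    (ht1 : t ≤ 1) :
    |1 - t ^ (1 + 2 * p) - (1 + 2 * p) * (1 - t) * t ^ p| ≤ 6 * (1 - t) ^ 3 := by
  set h : ℝ → ℝ := fun t => 1 - t ^ (1 + 2 * p) - (1 + 2 * p) * (1 - t) * t ^ p with hh
  -- In this factorization the last bracket is second order at `x = 1`: Bernoulli's inequality with
  -- exponent `1 + p` bounds it below by `0`, and with exponent `p` above by `(1 - x)²`. Integrating
  -- from `t` to `1` produces the cube.
  have hd : ∀ x : ℝ, 0 < x → HasDerivAt h
      (-((1 + 2 * p) * x ^ (p - 1) * (x ^ (1 + p) - (x - p * (1 - x))))) x := by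
    intro x hx
    have h1 := Real.hasDerivAt_rpow_const (x := x) (p := 1 + 2 * p) (Or.inl hx.ne')
    have h2 := Real.hasDerivAt_rpow_const (x := x) (p := p) (Or.inl hx.ne')
    have h3 := (((hasDerivAt_const x (1 : ℝ)).sub (hasDerivAt_id x)).const_mul (1 + 2 * p)).mul h2
    have h4 := (((hasDerivAt_const x (1 : ℝ)).sub h1)).sub h3
    refine h4.congr_deriv ?_
    have e1 : x ^ (1 + 2 * p - 1) = x ^ (p - 1) * x ^ (1 + p) := by
      rw [← Real.rpow_add hx]; ring_nf
    have e2 : x ^ p = x ^ (p - 1) * x := by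
      nth_rewrite 3 [← Real.rpow_one x]
      rw [← Real.rpow_add hx]; ring_nf
    simp only [id, Pi.sub_apply]
    rw [e1, e2]
    ring
  -- bounds on the derivative
  have hk : ∀ x : ℝ, 1 / 2 ≤ x → x ≤ 1 →
      0 ≤ x ^ (1 + p) - (x - p * (1 - x)) ∧ x ^ (1 + p) - (x - p * (1 - x)) ≤ (1 - x) ^ 2 := by
    intro x hx hx1
    have hx0 : 0 < x := by linarith
    constructor
    · have := one_add_mul_self_le_rpow_one_add (s := x - 1) (by linarith) (p := 1 + p) (by linarith)
      have e : 1 + (x - 1) = x := by ring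
      rw [e] at this
      nlinarith
    · -- `x ^ p ≤ 1 + p (x - 1)`
      have := rpow_one_add_le_one_add_mul_self (s := x - 1) (by linarith) (p := p)
        (by linarith) (by linarith)
      have e : 1 + (x - 1) = x := by ring
      rw [e] at this
      rw [Real.rpow_add hx0, Real.rpow_one]
      nlinarith [mul_le_mul_of_nonneg_left this hx0.le, sq_nonneg (1 - x)]
  have hq : ∀ x : ℝ, 1 / 2 ≤ x → x ≤ 1 → x ^ (p - 1) ≤ 2 := by
    intro x hx hx1
    have hx0 : 0 < x := by linarith
    calc x ^ (p - 1) ≤ (1 / 2 : ℝ) ^ (p - 1) :=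
          Real.rpow_le_rpow_of_nonpos (by norm_num) hx (by linarith)
      _ ≤ (1 / 2 : ℝ) ^ (-1 : ℝ) :=
          Real.rpow_le_rpow_of_exponent_ge (by norm_num) (by norm_num) (by linarith)
      _ = 2 := by rw [Real.rpow_neg_one]; norm_num
  have hcont : ContinuousOn h (Set.Icc t 1) := fun x hx =>
    (hd x (by linarith [hx.1])).continuousAt.continuousWithinAt
  have h1 : h 1 = 0 := by simp [hh]
  -- `h` is antitone, so nonnegative
  have hlow : 0 ≤ h t := by
    rw [← h1]
    have anti : AntitoneOn h (Set.Icc t 1) := by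
      refine antitoneOn_of_deriv_nonpos (convex_Icc _ _) hcont ?_ ?_
      · rw [interior_Icc]
        exact fun x hx => (hd x (by linarith [hx.1])).differentiableAt.differentiableWithinAt
      · rw [interior_Icc]
        intro x hx
        have hx0 : 0 < x := by linarith [hx.1]
        rw [(hd x hx0).deriv]
        have := (hk x (by linarith [hx.1]) hx.2.le).1
        have h2 : 0 ≤ x ^ (p - 1) := (Real.rpow_pos_of_pos hx0 _).le
        have : 0 ≤ (1 + 2 * p) * x ^ (p - 1) * (x ^ (1 + p) - (x - p * (1 - x))) := by positivity
        linarith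
    exact anti ⟨le_refl _, ht1⟩ ⟨ht1, le_refl _⟩ ht1
  have hup : h t - 6 * (1 - t) ^ 3 ≤ h 1 - 6 * (1 - 1) ^ 3 := by
    have mono : MonotoneOn (fun x => h x - 6 * (1 - x) ^ 3) (Set.Icc t 1) := by
      have hd2 : ∀ x : ℝ, 0 < x → HasDerivAt (fun x => h x - 6 * (1 - x) ^ 3)
          (-((1 + 2 * p) * x ^ (p - 1) * (x ^ (1 + p) - (x - p * (1 - x))))
            + 18 * (1 - x) ^ 2) x := by
        intro x hx
        have h3 := ((((hasDerivAt_const x (1 : ℝ)).sub (hasDerivAt_id x)).pow 3)).const_mul 6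
        refine ((hd x hx).sub h3).congr_deriv ?_
        simp only [id, Pi.sub_apply]
        push_cast
        ring
      refine monotoneOn_of_deriv_nonneg (convex_Icc _ _) ?_ ?_ ?_
      · exact fun x hx => (hd2 x (by linarith [hx.1])).continuousAt.continuousWithinAt
      · rw [interior_Icc]
        exact fun x hx => (hd2 x (by linarith [hx.1])).differentiableAt.differentiableWithinAt
      · rw [interior_Icc]
        intro x hx
        have hx0 : 0 < x := by linarith [hx.1]
        rw [(hd2 x hx0).deriv]
        obtain ⟨k0, k1⟩ := hk x (by linarith [hx.1]) hx.2.le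
        have q0 : 0 ≤ x ^ (p - 1) := (Real.rpow_pos_of_pos hx0 _).le
        have q1 := hq x (by linarith [hx.1]) hx.2.le
        have : (1 + 2 * p) * x ^ (p - 1) * (x ^ (1 + p) - (x - p * (1 - x)))
            ≤ (3 * 2) * (1 - x) ^ 2 := by
          gcongr
          linarith
        nlinarith [sq_nonneg (1 - x)]
    exact mono ⟨le_refl _, ht1⟩ ⟨ht1, le_refl _⟩ ht1
  rw [abs_le]
  have : 0 ≤ (1 - t) ^ 3 := by
    have : 0 ≤ 1 - t := by linarith
    positivity
  constructor
  · change _ ≤ h t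
    linarith
  · change h t ≤ _
    rw [h1] at hup
    linarith

/-- The third order symmetric Taylor remainder of the symbol `ξ|ξ|^{2p}`. -/
theorem symbol_remainder {p : ℝ} (hp : 1 / 2 ≤ p) (hp1 : p < 1) (a b : ℝ) :
    |a * |a| ^ (2 * p) - b * |b| ^ (2 * p) - (1 + 2 * p) * (a - b) * (|a| ^ p * |b| ^ p)|
      ≤ 64 * |a - b| ^ (1 + 2 * p) := by
  -- the case `|b| ≤ a`, by homogeneity
  have pos : ∀ a b : ℝ, 0 < a → |b| ≤ a →
      |a * |a| ^ (2 * p) - b * |b| ^ (2 * p) - (1 + 2 * p) * (a - b) * (|a| ^ p * |b| ^ p)|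
        ≤ 64 * |a - b| ^ (1 + 2 * p) := by
    intro a b ha hb
    obtain ⟨t, rfl⟩ : ∃ t, b = a * t := ⟨b / a, by field_simp⟩
    have ht : |t| ≤ 1 := by
      rw [abs_mul, abs_of_pos ha] at hb
      exact le_of_mul_le_mul_left (by linarith) ha
    obtain ⟨ht1, ht2⟩ := abs_le.1 ht
    have e1 : a * |a| ^ (2 * p) - a * t * |a * t| ^ (2 * p)
        - (1 + 2 * p) * (a - a * t) * (|a| ^ p * |a * t| ^ p)
        = a ^ (1 + 2 * p) * (1 - t * |t| ^ (2 * p) - (1 + 2 * p) * (1 - t) * |t| ^ p) := by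
      rw [abs_mul, abs_of_pos ha, Real.mul_rpow ha.le (abs_nonneg _),
        Real.mul_rpow ha.le (abs_nonneg _), Real.rpow_add ha, Real.rpow_one]
      have : a ^ (2 * p) = a ^ p * a ^ p := by rw [← Real.rpow_add ha]; ring_nf
      rw [this]; ring
    have e2 : |a - a * t| ^ (1 + 2 * p) = a ^ (1 + 2 * p) * (1 - t) ^ (1 + 2 * p) := by
      rw [← Real.mul_rpow ha.le (by linarith), ← mul_one_sub, abs_mul, abs_of_pos ha,
        abs_of_nonneg (by linarith : (0 : ℝ) ≤ 1 - t)]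
    rw [e1, e2, abs_mul, abs_of_pos (Real.rpow_pos_of_pos ha _), mul_left_comm]
    refine mul_le_mul_of_nonneg_left ?_ (Real.rpow_pos_of_pos ha _).le
    -- Near `t = 1` the Taylor bound applies and `1 + 2p ≤ 3` weakens the cube to the required
    -- power. For `t ≤ 1/2` no cancellation is needed: the terms add up to at most `1 + 1 + 6 = 8`,
    -- while `(1 - t)^{1+2p} ≥ 1/8`; hence the constant 64.
    rcases le_total (1 / 2) t with h | h
    · have ht0 : 0 < t := by linarith
      rw [abs_of_pos ht0]
      have e3 : t * t ^ (2 * p) = t ^ (1 + 2 * p) := by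
        rw [Real.rpow_add ht0, Real.rpow_one]
      rw [e3]
      refine (symbol_remainder_unit hp hp1 h ht2).trans ?_
      rcases eq_or_lt_of_le ht2 with rfl | h1
      · have : (1 : ℝ) + 2 * p ≠ 0 := by linarith
        simp [this]
      have h5 : (1 - t) ^ 3 ≤ (1 - t) ^ (1 + 2 * p) := by
        rw [← Real.rpow_natCast]
        exact Real.rpow_le_rpow_of_exponent_ge (by linarith) (by linarith) (by push_cast; linarith)
      have : 0 ≤ (1 - t) ^ (1 + 2 * p) := Real.rpow_nonneg (by linarith) _
      linarith
    · have q1 : |t| ^ (2 * p) ≤ 1 := Real.rpow_le_one (abs_nonneg _) ht (by linarith)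
      have q2 : |t| ^ p ≤ 1 := Real.rpow_le_one (abs_nonneg _) ht (by linarith)
      have q3 : 0 ≤ |t| ^ (2 * p) := Real.rpow_nonneg (abs_nonneg _) _
      have q4 : 0 ≤ |t| ^ p := Real.rpow_nonneg (abs_nonneg _) _
      have l1 : |t * |t| ^ (2 * p)| ≤ 1 := by
        rw [abs_mul, abs_of_nonneg q3]
        nlinarith [abs_nonneg t]
      have l2 : |(1 + 2 * p) * (1 - t) * |t| ^ p| ≤ 6 := by
        rw [abs_mul, abs_mul, abs_of_nonneg q4, abs_of_nonneg (by linarith : 0 ≤ 1 + 2 * p),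
          abs_of_nonneg (by linarith : 0 ≤ 1 - t)]
        calc (1 + 2 * p) * (1 - t) * |t| ^ p ≤ 3 * 2 * 1 := by
              gcongr <;> linarith
          _ = 6 := by norm_num
      have l3 : (1 / 8 : ℝ) ≤ (1 - t) ^ (1 + 2 * p) := by
        calc (1 / 8 : ℝ) = (1 / 2 : ℝ) ^ (3 : ℝ) := by
              norm_num
          _ ≤ (1 / 2 : ℝ) ^ (1 + 2 * p) :=
              Real.rpow_le_rpow_of_exponent_ge (by norm_num) (by norm_num) (by linarith)
          _ ≤ _ := Real.rpow_le_rpow (by norm_num) (by linarith) (by linarith)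
      have := abs_le.1 l1
      have := abs_le.1 l2
      rw [abs_le]
      constructor <;> linarith
  have big : ∀ a b : ℝ, |b| ≤ |a| →
      |a * |a| ^ (2 * p) - b * |b| ^ (2 * p) - (1 + 2 * p) * (a - b) * (|a| ^ p * |b| ^ p)|
        ≤ 64 * |a - b| ^ (1 + 2 * p) := by
    intro a b hab
    rcases lt_trichotomy a 0 with h | h | h
    · have := pos (-a) (-b) (by linarith) (by rwa [abs_neg, ← abs_of_neg h])
      rw [abs_neg, abs_neg] at this
      have e1 : -a - -b = -(a - b) := by ring
      rw [e1, abs_neg] at this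
      rw [← abs_neg]
      convert this using 2
      ring
    · subst h
      have : b = 0 := by simpa using hab
      subst this
      have : (1 : ℝ) + 2 * p ≠ 0 := by linarith
      simp [this]
    · exact pos a b h (by rwa [← abs_of_pos h])
  rcases le_total |b| |a| with h | h
  · exact big a b h
  · have := big b a h
    rw [abs_sub_comm b a] at this
    rw [← abs_neg]
    convert this using 2
    ring

end SymbolInequalities

/-! ### Sobolev regularity expressed through the Fourier transform. -/

section SobolevProfile

/-- The weight `(1 + ξ²)^{s/2}`. -/
noncomputable def bracket (s ξ : ℝ) : ℝ := (1 + ‖ξ‖ ^ 2) ^ (s / 2)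

theorem bracket_pos (s ξ : ℝ) : 0 < bracket s ξ := by unfold bracket; positivity

theorem bracket_mono {s t : ℝ} (h : s ≤ t) (ξ : ℝ) : bracket s ξ ≤ bracket t ξ :=
  Real.rpow_le_rpow_of_exponent_le (by nlinarith [norm_nonneg ξ]) (by linarith)

theorem bracket_add (s t ξ : ℝ) : bracket (s + t) ξ = bracket s ξ * bracket t ξ := by
  unfold bracket
  rw [← Real.rpow_add (by positivity), add_div]

theorem continuous_bracket (s : ℝ) : Continuous (bracket s) := by
  unfold bracket
  exact Continuous.rpow_const (by fun_prop) (fun x => Or.inl (by positivity))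

theorem measurable_bracket (s : ℝ) : Measurable (bracket s) := (continuous_bracket s).measurable

theorem abs_rpow_le_bracket {t : ℝ} (ht : 0 ≤ t) (ξ : ℝ) : |ξ| ^ t ≤ bracket t ξ := by
  have : |ξ| ^ t = (|ξ| ^ 2) ^ (t / 2) := by
    rw [← Real.rpow_natCast, ← Real.rpow_mul (abs_nonneg _)]
    congr 1; push_cast; ring
  rw [this]
  unfold bracket
  refine Real.rpow_le_rpow (by positivity) ?_ (by linarith)
  rw [Real.norm_eq_abs]; linarith

theorem abs_two_pi_rpow_le_bracket {t s : ℝ} (ht : 0 ≤ t) (hts : t ≤ s) (ξ : ℝ) :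
    |2 * Real.pi * ξ| ^ t ≤ (2 * Real.pi) ^ t * bracket s ξ := by
  rw [abs_mul, abs_of_pos Real.two_pi_pos, Real.mul_rpow Real.two_pi_pos.le (abs_nonneg _)]
  have := (abs_rpow_le_bracket ht ξ).trans (bracket_mono hts ξ)
  gcongr

/-- Peetre's inequality. -/
theorem bracket_le_mul {s : ℝ} (hs : 0 ≤ s) (ξ η : ℝ) :
    bracket s ξ ≤ 2 ^ (s / 2) * bracket s (ξ - η) * bracket s η := by
  unfold bracket
  rw [← Real.mul_rpow (by norm_num) (by positivity), ← Real.mul_rpow (by positivity) (by positivity)]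
  refine Real.rpow_le_rpow (by positivity) ?_ (by linarith)
  simp only [Real.norm_eq_abs, sq_abs]
  nlinarith [sq_nonneg (ξ - 2 * η), sq_nonneg ((ξ - η) * η), sq_nonneg (ξ - η)]

/-- Its square is `1/(1+ξ²)`. Pairing with this function by Cauchy–Schwarz trades one order of
regularity for integrability in frequency. -/
theorem memLp_bracket_neg_one : MemLp (fun ξ => ((bracket (-1) ξ : ℝ) : ℂ)) 2 volume := by
  have hm : AEStronglyMeasurable (fun ξ => ((bracket (-1) ξ : ℝ) : ℂ)) volume :=
    (Complex.continuous_ofReal.comp (continuous_bracket (-1))).aestronglyMeasurable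
  rw [memLp_two_iff_integrable_sq_norm hm]
  refine integrable_inv_one_add_sq.congr (Filter.Eventually.of_forall fun ξ => ?_)
  simp only [Complex.norm_real, Real.norm_eq_abs, abs_of_pos (bracket_pos _ _)]
  have e : bracket (-1) ξ ^ 2 = bracket (-1 + -1) ξ := by rw [bracket_add, sq]
  rw [e]
  unfold bracket
  norm_num [Real.rpow_neg_one]

/-- `F` is the Fourier transform of the real-valued function `W ∈ H^s(ℝ)`. -/
structure SobolevProfile (s : ℝ) (F : ℝ → ℂ) (W : ℝ → ℝ) : Prop where
  meas : Measurable F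
  memLp : MemLp (fun ξ => (bracket s ξ : ℂ) * F ξ) 2 volume
  inv : ∀ x, (W x : ℂ) = 𝓕⁻ F x

theorem memLp_mul_of_le_bracket {s : ℝ} {F : ℝ → ℂ} (hFm : Measurable F)
    (hF : MemLp (fun ξ => (bracket s ξ : ℂ) * F ξ) 2 volume) {m : ℝ → ℂ} (hm : Measurable m)
    {C : ℝ} (h : ∀ ξ, ‖m ξ‖ ≤ C * bracket s ξ) : MemLp (fun ξ => m ξ * F ξ) 2 volume := by
  refine MemLp.of_le_mul (c := C) hF (hm.mul hFm).aestronglyMeasurable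
    (Filter.Eventually.of_forall fun ξ => ?_)
  rw [norm_mul, norm_mul, Complex.norm_real, Real.norm_eq_abs, abs_of_pos (bracket_pos _ _),
    ← mul_assoc]
  gcongr
  exact h ξ

/-- A multiplier of order `s - 1` sends the profile into L¹, so the Fourier integrals below converge
absolutely. With `s = 1 + 2p ≥ 2` this covers both `∂ₓ` and `𝓓^{2p}`. -/
theorem integrable_mul_of_le_bracket {s : ℝ} {F : ℝ → ℂ} (hFm : Measurable F)
    (hF : MemLp (fun ξ => (bracket s ξ : ℂ) * F ξ) 2 volume) {m : ℝ → ℂ} (hm : Measurable m)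
    {C : ℝ} (h : ∀ ξ, ‖m ξ‖ ≤ C * bracket (s - 1) ξ) : Integrable (fun ξ => m ξ * F ξ) := by
  have h1 : Integrable fun ξ => (bracket (-1) ξ : ℂ) * ((bracket s ξ : ℂ) * F ξ) :=
    memLp_bracket_neg_one.integrable_mul hF
  refine (h1.norm.const_mul C).mono' (hm.mul hFm).aestronglyMeasurable
    (Filter.Eventually.of_forall fun ξ => ?_)
  rw [norm_mul, norm_mul, norm_mul, Complex.norm_real, Complex.norm_real, Real.norm_eq_abs,
    Real.norm_eq_abs, abs_of_pos (bracket_pos _ _), abs_of_pos (bracket_pos _ _)]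
  have e : bracket (s - 1) ξ = bracket (-1) ξ * bracket s ξ := by
    rw [← bracket_add]; congr 1; ring
  calc ‖m ξ‖ * ‖F ξ‖ ≤ (C * bracket (s - 1) ξ) * ‖F ξ‖ := by gcongr; exact h ξ
    _ = _ := by rw [e]; ring

/-- The Fourier multiplier `|2πξ|^t F(ξ)`. -/
noncomputable def absMul (t : ℝ) (F : ℝ → ℂ) (ξ : ℝ) : ℂ :=
  ((|2 * Real.pi * ξ| ^ t : ℝ) : ℂ) * F ξ

/-- The Fourier multiplier `2πiξ F(ξ)`. -/
noncomputable def derivMul (F : ℝ → ℂ) (ξ : ℝ) : ℂ := (2 * Real.pi * Complex.I * ξ) * F ξ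

theorem measurable_absMul (t : ℝ) {F : ℝ → ℂ} (hF : Measurable F) : Measurable (absMul t F) := by
  unfold absMul; fun_prop

theorem measurable_derivMul {F : ℝ → ℂ} (hF : Measurable F) : Measurable (derivMul F) := by
  unfold derivMul; fun_prop

theorem norm_absMul (t : ℝ) (F : ℝ → ℂ) (ξ : ℝ) :
    ‖absMul t F ξ‖ = |2 * Real.pi * ξ| ^ t * ‖F ξ‖ := by
  rw [absMul, norm_mul, Complex.norm_real, Real.norm_eq_abs,
    abs_of_nonneg (Real.rpow_nonneg (abs_nonneg _) _)]

theorem norm_two_pi_I_mul (ξ : ℝ) : ‖(2 * Real.pi * Complex.I * ξ : ℂ)‖ = |2 * Real.pi * ξ| := by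
  have : (2 * Real.pi * Complex.I * ξ : ℂ) = ((2 * Real.pi * ξ : ℝ) : ℂ) * Complex.I := by
    push_cast; ring
  rw [this, norm_mul, Complex.norm_I, mul_one, Complex.norm_real, Real.norm_eq_abs]

theorem norm_derivMul (F : ℝ → ℂ) (ξ : ℝ) : ‖derivMul F ξ‖ = |2 * Real.pi * ξ| * ‖F ξ‖ := by
  rw [derivMul, norm_mul, norm_two_pi_I_mul]

namespace SobolevProfile

variable {s : ℝ} {F : ℝ → ℂ} {W : ℝ → ℝ}

theorem memLp_absMul (h : SobolevProfile s F W) {t : ℝ} (ht : 0 ≤ t) (hts : t ≤ s) :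
    MemLp (absMul t F) 2 volume :=
  memLp_mul_of_le_bracket h.meas h.memLp (m := fun ξ => ((|2 * Real.pi * ξ| ^ t : ℝ) : ℂ))
    (by fun_prop) (C := (2 * Real.pi) ^ t) fun ξ => by
      rw [Complex.norm_real, Real.norm_eq_abs, abs_of_nonneg (Real.rpow_nonneg (abs_nonneg _) _)]
      exact abs_two_pi_rpow_le_bracket ht hts ξ

theorem integrable_absMul (h : SobolevProfile s F W) {t : ℝ} (ht : 0 ≤ t) (hts : t ≤ s - 1) :
    Integrable (absMul t F) :=
  integrable_mul_of_le_bracket h.meas h.memLp (m := fun ξ => ((|2 * Real.pi * ξ| ^ t : ℝ) : ℂ))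
    (by fun_prop) (C := (2 * Real.pi) ^ t) fun ξ => by
      rw [Complex.norm_real, Real.norm_eq_abs, abs_of_nonneg (Real.rpow_nonneg (abs_nonneg _) _)]
      exact abs_two_pi_rpow_le_bracket ht hts ξ

theorem absMul_zero (F : ℝ → ℂ) : absMul 0 F = F := by
  ext ξ; simp [absMul]

theorem memLp_two (h : SobolevProfile s F W) (hs : 0 ≤ s) : MemLp F 2 volume := by
  simpa [absMul_zero] using h.memLp_absMul le_rfl hs

theorem integrable (h : SobolevProfile s F W) (hs : 1 ≤ s) : Integrable F := by
  simpa [absMul_zero] using h.integrable_absMul le_rfl (by linarith)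

theorem memLp_derivMul (h : SobolevProfile s F W) (hs : 1 ≤ s) :
    MemLp (derivMul F) 2 volume :=
  memLp_mul_of_le_bracket h.meas h.memLp (m := fun ξ => (2 * Real.pi * Complex.I * ξ))
    (by fun_prop) (C := (2 * Real.pi) ^ (1 : ℝ)) fun ξ => by
      rw [norm_two_pi_I_mul]
      simpa using abs_two_pi_rpow_le_bracket zero_le_one hs ξ

theorem integrable_derivMul (h : SobolevProfile s F W) (hs : 2 ≤ s) :
    Integrable (derivMul F) :=
  integrable_mul_of_le_bracket h.meas h.memLp (m := fun ξ => (2 * Real.pi * Complex.I * ξ))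
    (by fun_prop) (C := (2 * Real.pi) ^ (1 : ℝ)) fun ξ => by
      rw [norm_two_pi_I_mul]
      simpa using abs_two_pi_rpow_le_bracket zero_le_one (by linarith : 1 ≤ s - 1) ξ

theorem fun_eq_re (h : SobolevProfile s F W) : W = fun x => (𝓕⁻ F x).re := by
  ext x; rw [← h.inv x, Complex.ofReal_re]

theorem continuous (h : SobolevProfile s F W) (hs : 1 ≤ s) : Continuous W := by
  rw [h.fun_eq_re]
  exact Complex.continuous_re.comp (continuous_fourierInv_of_integrable (h.integrable hs))

theorem norm_fun_eq (h : SobolevProfile s F W) (x : ℝ) : ‖W x‖ = ‖𝓕⁻ F x‖ := by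
  rw [← h.inv x, Complex.norm_real]

theorem bounded (h : SobolevProfile s F W) (x : ℝ) : ‖W x‖ ≤ ∫ ξ, ‖F ξ‖ := by
  rw [h.norm_fun_eq]; exact norm_fourierInv_le x

theorem memLp_fun (h : SobolevProfile s F W) (hs : 1 ≤ s) : MemLp W 2 volume := by
  rw [h.fun_eq_re]
  exact (memLp_fourierInv (h.integrable hs) (h.memLp_two (by linarith))).re

theorem integral_sq (h : SobolevProfile s F W) (hs : 1 ≤ s) :
    ∫ x, W x ^ 2 = ∫ ξ, ‖F ξ‖ ^ 2 := by
  rw [← integral_norm_sq_fourierInv (h.integrable hs) (h.memLp_two (by linarith))]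
  refine integral_congr_ae (Filter.Eventually.of_forall fun x => ?_)
  simp only [← h.norm_fun_eq, Real.norm_eq_abs, sq_abs]

theorem hasDerivAt_re (h : SobolevProfile s F W) (hs : 2 ≤ s) (x : ℝ) :
    HasDerivAt W (𝓕⁻ (derivMul F) x).re x := by
  rw [h.fun_eq_re]
  exact Complex.reCLM.hasFDerivAt.comp_hasDerivAt x
    (hasDerivAt_fourierInv (h.integrable (by linarith)) (h.integrable_derivMul hs) x)

theorem hasDerivAt (h : SobolevProfile s F W) (hs : 2 ≤ s) (x : ℝ) :
    HasDerivAt W (deriv W x) x :=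
  (h.hasDerivAt_re hs x).differentiableAt.hasDerivAt

theorem deriv_eq (h : SobolevProfile s F W) (hs : 2 ≤ s) (x : ℝ) :
    ((deriv W x : ℝ) : ℂ) = 𝓕⁻ (derivMul F) x := by
  have h1 : HasDerivAt (fun y => (W y : ℂ)) ((deriv W x : ℝ) : ℂ) x := (h.hasDerivAt hs x).ofReal_comp
  have h2 : HasDerivAt (fun y => (W y : ℂ)) (𝓕⁻ (derivMul F) x) x := by
    have e : (fun y => (W y : ℂ)) = 𝓕⁻ F := by ext y; exact h.inv y
    rw [e]
    exact hasDerivAt_fourierInv (h.integrable (by linarith)) (h.integrable_derivMul hs) x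
  exact h1.unique h2

theorem continuous_deriv (h : SobolevProfile s F W) (hs : 2 ≤ s) : Continuous (deriv W) := by
  have e : deriv W = fun x => (𝓕⁻ (derivMul F) x).re := by
    ext x; rw [← h.deriv_eq hs, Complex.ofReal_re]
  rw [e]
  exact Complex.continuous_re.comp (continuous_fourierInv_of_integrable (h.integrable_derivMul hs))

theorem memLp_deriv (h : SobolevProfile s F W) (hs : 2 ≤ s) : MemLp (deriv W) 2 volume := by
  have e : deriv W = fun x => (𝓕⁻ (derivMul F) x).re := by
    ext x; rw [← h.deriv_eq hs, Complex.ofReal_re]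
  rw [e]
  exact (memLp_fourierInv (h.integrable_derivMul hs) (h.memLp_derivMul (by linarith))).re

/-- Multiplication by a real-valued function with integrable and rapidly decaying Fourier
transform. -/
theorem mul (h : SobolevProfile s F W) (hs : 1 ≤ s) (A : SchwartzMap ℝ ℂ) {φ : ℝ → ℝ}
    (hφ : ∀ x, (φ x : ℂ) = 𝓕⁻ (A : ℝ → ℂ) x) :
    SobolevProfile s (cv A F) (fun x => φ x * W x) := by
  have hAm : Measurable A := A.continuous.measurable
  refine ⟨measurable_cv hAm h.meas, ?_, fun x => ?_⟩
  · have hg : (fun ξ : ℝ => bracket s ξ).HasTemperateGrowth :=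
      Function.hasTemperateGrowth_one_add_norm_sq_rpow ℝ (s / 2)
    have hg' : (fun ξ : ℝ => (bracket s ξ : ℂ)).HasTemperateGrowth := by fun_prop
    -- Peetre's inequality distributes the weight over both factors, so the weighted convolution is
    -- dominated by one with this kernel, integrable because `A` is Schwartz.
    have ha : Integrable fun ζ => 2 ^ (s / 2) * (bracket s ζ * ‖A ζ‖) := by
      have := (SchwartzMap.smulLeftCLM ℂ (fun ξ : ℝ => (bracket s ξ : ℂ)) A).integrable (μ := volume)
      rw [SchwartzMap.smulLeftCLM_apply hg'] at this
      refine Integrable.const_mul (this.norm.congr (Filter.Eventually.of_forall fun ζ => ?_)) _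
      simp only [smul_eq_mul, norm_mul, Complex.norm_real, Real.norm_eq_abs,
        abs_of_pos (bracket_pos _ _)]
    have hb := measurable_bracket s
    refine (memLp_of_le_conv (by fun_prop) ha (fun ζ => ?_)
      (by have := h.meas; fun_prop : Measurable fun ξ => (bracket s ξ : ℂ) * F ξ) h.memLp
      (Measurable.aestronglyMeasurable ?_) fun ξ => ?_).1
    · have := (bracket_pos s ζ).le; positivity
    · have := measurable_cv hAm h.meas; fun_prop
    · rw [enorm_mul]
      calc ‖(bracket s ξ : ℂ)‖ₑ * ‖cv A F ξ‖ₑ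
          ≤ ‖(bracket s ξ : ℂ)‖ₑ * ∫⁻ η, ENNReal.ofReal ‖A (ξ - η)‖ * ‖F η‖ₑ := by
            gcongr; exact enorm_cv_le _ _ _
        _ = ∫⁻ η, ‖(bracket s ξ : ℂ)‖ₑ * (ENNReal.ofReal ‖A (ξ - η)‖ * ‖F η‖ₑ) := by
            rw [lintegral_const_mul]
            have := h.meas
            fun_prop
        _ ≤ _ := by
            refine lintegral_mono fun η => ?_
            simp only [← ofReal_norm]
            rw [← ENNReal.ofReal_mul (norm_nonneg _), ← ENNReal.ofReal_mul (norm_nonneg _),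
              ← ENNReal.ofReal_mul (by have := (bracket_pos s (ξ - η)).le; positivity)]
            refine ENNReal.ofReal_le_ofReal ?_
            rw [norm_mul, Complex.norm_real, Complex.norm_real, Real.norm_eq_abs, Real.norm_eq_abs,
              abs_of_pos (bracket_pos _ _), abs_of_pos (bracket_pos _ _)]
            calc bracket s ξ * (‖A (ξ - η)‖ * ‖F η‖)
                ≤ (2 ^ (s / 2) * bracket s (ξ - η) * bracket s η) * (‖A (ξ - η)‖ * ‖F η‖) := by
                  gcongr; exact bracket_le_mul (by linarith) _ _
              _ = _ := by ring
  · rw [fourierInv_cv A.integrable (h.integrable hs)]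
    push_cast
    rw [hφ, h.inv]

end SobolevProfile

/-- The transform of an L² function is a function, so the weighted distribution acts by integration
against a pointwise product. An L² representative of it must agree with that product almost
everywhere. -/
theorem memHs_iff (s : ℝ) (f : L2) :
    MemHs s f ↔ MemLp (fun ξ => (bracket s ξ : ℂ)
      * (𝓕 (toComplex f) : Lp ℂ 2 (volume : Measure ℝ)) ξ) 2 volume := by
  have hg : (fun ξ : ℝ => bracket s ξ).HasTemperateGrowth :=
    Function.hasTemperateGrowth_one_add_norm_sq_rpow ℝ (s / 2)
  have hg' : (fun ξ : ℝ => (bracket s ξ : ℂ)).HasTemperateGrowth := by fun_prop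
  rw [MemHs, TemperedDistribution.memSobolev_iff_exists_smulLeftCLM_fourier,
    Lp.fourier_toTemperedDistribution_eq]
  set h : Lp ℂ 2 (volume : Measure ℝ) := 𝓕 (toComplex f)
  change (∃ f' : Lp ℂ 2 (volume : Measure ℝ), TemperedDistribution.smulLeftCLM ℂ
    (fun x : ℝ => (bracket s x : ℂ)) (h : TemperedDistribution ℝ ℂ) = f') ↔ _
  have key : ∀ g : SchwartzMap ℝ ℂ, TemperedDistribution.smulLeftCLM ℂ
      (fun x : ℝ => (bracket s x : ℂ)) (h : TemperedDistribution ℝ ℂ) g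
      = ∫ x, g x * ((bracket s x : ℂ) * h x) := by
    intro g
    rw [TemperedDistribution.smulLeftCLM_apply_apply, Lp.toTemperedDistribution_apply]
    refine integral_congr_ae (Filter.Eventually.of_forall fun x => ?_)
    beta_reduce
    rw [SchwartzMap.smulLeftCLM_apply_apply hg']
    simp only [smul_eq_mul]
    ring
  constructor
  · rintro ⟨f', hf'⟩
    refine (memLp_congr_ae ?_).1 (Lp.memLp f')
    refine ae_eq_of_integral_contDiff_smul_eq ((Lp.memLp f').locallyIntegrable (by norm_num))
      ?_ ?_
    · have := ((Lp.memLp h).locallyIntegrable (by norm_num) :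
        LocallyIntegrable (h : ℝ → ℂ) volume)
      rw [← locallyIntegrableOn_univ] at this ⊢
      exact this.continuousOn_mul ((Complex.continuous_ofReal.comp
        (continuous_bracket s)).continuousOn) isClosed_univ.isLocallyClosed
    · intro g hg hgc
      have hg₁ : HasCompactSupport (Complex.ofRealCLM ∘ g) := hgc.comp_left rfl
      have hg₂ : ContDiff ℝ ∞ (Complex.ofRealCLM ∘ g) := by fun_prop
      have h1 := key (hg₁.toSchwartzMap hg₂)
      rw [hf', Lp.toTemperedDistribution_apply] at h1
      exact h1
  · intro hm
    refine ⟨hm.toLp _, ?_⟩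
    ext g
    rw [key, Lp.toTemperedDistribution_apply]
    refine integral_congr_ae ?_
    filter_upwards [hm.coeFn_toLp] with x hx
    rw [hx, smul_eq_mul]

theorem coeFn_toComplex (f : L2) :
    (toComplex f : ℝ → ℂ) =ᵐ[volume] fun x => ((f x : ℝ) : ℂ) :=
  Complex.ofRealCLM.coeFn_compLp f

/-- An `H^s` function, `s ≥ 1`, has a continuous representative. -/
theorem exists_sobolevProfile {s : ℝ} (hs : 1 ≤ s) {f : L2} (hf : MemHs s f) :
    ∃ W : ℝ → ℝ, SobolevProfile s (𝓕 (toComplex f) : Lp ℂ 2 (volume : Measure ℝ)) W ∧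
      (f : ℝ → ℝ) =ᵐ[volume] W := by
  set h : Lp ℂ 2 (volume : Measure ℝ) := 𝓕 (toComplex f) with hh
  have hm : Measurable (h : ℝ → ℂ) := (Lp.stronglyMeasurable h).measurable
  have hmem := (memHs_iff s f).1 hf
  have hint : Integrable (h : ℝ → ℂ) := by
    have := integrable_mul_of_le_bracket hm hmem (m := fun _ => 1) (by fun_prop) (C := 1)
      (fun ξ => by
        rw [norm_one, one_mul]
        simpa [bracket] using bracket_mono (by linarith : 0 ≤ s - 1) ξ)
    simpa using this
  have hae : (toComplex f : ℝ → ℂ) =ᵐ[volume] 𝓕⁻ (h : ℝ → ℂ) := by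
    have h1 := coeFn_fourierInv_toLp hint (Lp.memLp h)
    rw [Lp.toLp_coeFn, hh, FourierTransform.fourierInv_fourier_eq] at h1
    exact h1
  have hc := continuous_fourierInv_of_integrable hint
  -- The inverse Fourier integral is real almost everywhere because `f` is; by continuity it is real
  -- everywhere.
  have hre : (fun x => (((𝓕⁻ (h : ℝ → ℂ) x).re : ℝ) : ℂ)) = 𝓕⁻ (h : ℝ → ℂ) := by
    refine (Continuous.ae_eq_iff_eq volume (by fun_prop) hc).1 ?_
    filter_upwards [hae, coeFn_toComplex f] with x h1 h2
    rw [← h1, h2, Complex.ofReal_re]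
  refine ⟨fun x => (𝓕⁻ (h : ℝ → ℂ) x).re, ⟨hm, hmem, fun x => congrFun hre x⟩, ?_⟩
  filter_upwards [hae, coeFn_toComplex f] with x h1 h2
  rw [← h1, h2, Complex.ofReal_re]

namespace SobolevProfile

variable {s : ℝ} {F : ℝ → ℂ} {W : ℝ → ℝ}

/-- The converse passage to L² classes: it makes the continuous functions `W` and `f W` admissible
test functions in the scheme. -/
theorem memHs_toLp (h : SobolevProfile s F W) (hs : 1 ≤ s) :
    MemHs s ((h.memLp_fun hs).toLp W) := by
  have hF := h.integrable hs
  have hF2 := h.memLp_two (by linarith)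
  have e : toComplex ((h.memLp_fun hs).toLp W) = 𝓕⁻ (hF2.toLp F) := by
    apply Lp.ext
    filter_upwards [coeFn_toComplex ((h.memLp_fun hs).toLp W), (h.memLp_fun hs).coeFn_toLp,
      coeFn_fourierInv_toLp hF hF2] with x h1 h2 h3
    rw [h1, h2, h3, h.inv]
  rw [memHs_iff, e, FourierTransform.fourier_fourierInv_eq]
  refine (memLp_congr_ae ?_).1 h.memLp
  filter_upwards [hF2.coeFn_toLp] with ξ hξ
  rw [hξ]

end SobolevProfile

/-- For `t ≤ s - 1` the symbol lies in L¹ ∩ L², so the junk value in the definition of `fracD` is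
not taken and the L² inverse transform is an honest integral. -/
theorem fracD_ae_eq {s t : ℝ} (ht : 0 ≤ t) (hts : t ≤ s - 1) {f : L2} {W : ℝ → ℝ}
    (h : SobolevProfile s (𝓕 (toComplex f) : Lp ℂ 2 (volume : Measure ℝ)) W) :
    (fracD t f : ℝ → ℂ) =ᵐ[volume]
      𝓕⁻ (absMul t (𝓕 (toComplex f) : Lp ℂ 2 (volume : Measure ℝ))) := by
  have hm : MemLp (fracSymbol t f) 2 volume := h.memLp_absMul ht (by linarith)
  rw [fracD, dif_pos hm]
  exact coeFn_fourierInv_toLp (h.integrable_absMul ht hts) hm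

end SobolevProfile

/-! ### Weak derivatives of functions with a C¹ representative. -/

section WeakDerivative

/-- Uniqueness of weak derivatives makes the arbitrary choice in `weakDeriv` harmless under
integrals. -/
theorem weakDeriv_ae_eq {f g : ℝ → ℝ} (h : HasWeakDeriv f g) : weakDeriv f =ᵐ[volume] g := by
  have he : ∃ g, HasWeakDeriv f g := ⟨g, h⟩
  rw [weakDeriv, dif_pos he]
  obtain ⟨-, h1, h2⟩ := he.choose_spec
  refine ae_eq_of_integral_contDiff_smul_eq h1 h.2.1 fun ψ hψ hψc => ?_
  have h3 := h2 ψ hψ hψc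
  rw [h.2.2 ψ hψ hψc, neg_inj] at h3
  simp only [smul_eq_mul, mul_comm (ψ _)]
  exact h3.symm

theorem hasWeakDeriv_of_hasDerivAt {f V V' : ℝ → ℝ} (hf : f =ᵐ[volume] V)
    (hV : ∀ x, HasDerivAt V (V' x) x) (hc : Continuous V') : HasWeakDeriv f V' := by
  have hVc : Continuous V := continuous_iff_continuousAt.2 fun x => (hV x).continuousAt
  refine ⟨hVc.locallyIntegrable.congr hf.symm, hc.locallyIntegrable, fun ψ hψ hψc => ?_⟩
  have hψd : ∀ x, HasDerivAt ψ (deriv ψ x) x := fun x =>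
    (hψ.differentiable (by simp) x).hasDerivAt
  have hψ'c : Continuous (deriv ψ) := hψ.continuous_deriv (by simp)
  have e : ∫ x, f x * deriv ψ x = ∫ x, V x * deriv ψ x := by
    refine integral_congr_ae ?_
    filter_upwards [hf] with x hx
    rw [hx]
  rw [e]
  exact integral_mul_deriv_eq_deriv_mul_of_integrable (fun x _ => hV x) (fun x _ => hψd x)
    ((hVc.mul hψ'c).integrable_of_hasCompactSupport hψc.deriv.mul_left)
    ((hc.mul hψ.continuous).integrable_of_hasCompactSupport hψc.mul_left)
    ((hVc.mul hψ.continuous).integrable_of_hasCompactSupport hψc.mul_left)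

end WeakDerivative

/-! ### The local smoothing identity for the dispersive term. -/

section KatoSmoothing

/-- `A` is the Fourier transform of the real-valued Schwartz function `φ`. -/
structure SchwartzProfile (A : SchwartzMap ℝ ℂ) (φ : ℝ → ℝ) : Prop where
  inv : ∀ x, (φ x : ℂ) = 𝓕⁻ (A : ℝ → ℂ) x
  conj : ∀ ζ, A (-ζ) = starRingEnd ℂ (A ζ)

/-- Conjugate symmetry expresses that `φ` is real. The explicit formula for `A` is kept because the
truncation argument compares transforms of several functions. -/
theorem exists_schwartzProfile {φ : ℝ → ℝ} (hφ : ContDiff ℝ ∞ φ) (hc : HasCompactSupport φ) :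
    ∃ A : SchwartzMap ℝ ℂ, SchwartzProfile A φ ∧ ∀ ζ, A ζ = 𝓕 (fun x => (φ x : ℂ)) ζ := by
  have hg₁ : HasCompactSupport (Complex.ofRealCLM ∘ φ) := hc.comp_left rfl
  have hg₂ : ContDiff ℝ ∞ (Complex.ofRealCLM ∘ φ) := by fun_prop
  have e : ∀ ζ, (𝓕 (hg₁.toSchwartzMap hg₂)) ζ = 𝓕 (fun x => (φ x : ℂ)) ζ := by
    intro ζ
    rw [SchwartzMap.fourier_coe]
    rfl
  refine ⟨𝓕 (hg₁.toSchwartzMap hg₂), ⟨fun x => ?_, fun ζ => ?_⟩, e⟩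
  · rw [← SchwartzMap.fourierInv_coe, FourierTransform.fourierInv_fourier_eq]
    rfl
  · rw [e, e, Real.fourier_eq, Real.fourier_eq, ← integral_conj]
    refine integral_congr_ae (Filter.Eventually.of_forall fun x => ?_)
    simp only [Circle.smul_def, smul_eq_mul, map_mul, Complex.conj_ofReal, inner_neg_right,
      neg_neg]
    rw [← Circle.coe_inv_eq_conj, ← AddChar.map_neg_eq_inv, neg_neg]

namespace SchwartzProfile

variable {A : SchwartzMap ℝ ℂ} {φ : ℝ → ℝ}

/-- The factor `|ζ|^t` need not be smooth at the origin, so it is first dominated by the smooth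
weight of temperate growth, which preserves Schwartz functions. -/
theorem integrable_weight (A : SchwartzMap ℝ ℂ) {t : ℝ} (ht : 0 ≤ t) :
    Integrable fun ζ => |2 * Real.pi * ζ| ^ t * ‖A ζ‖ := by
  have hg : (fun ξ : ℝ => bracket t ξ).HasTemperateGrowth :=
    Function.hasTemperateGrowth_one_add_norm_sq_rpow ℝ (t / 2)
  have hg' : (fun ξ : ℝ => (bracket t ξ : ℂ)).HasTemperateGrowth := by fun_prop
  have := (SchwartzMap.smulLeftCLM ℂ (fun ξ : ℝ => (bracket t ξ : ℂ)) A).integrable (μ := volume)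
  rw [SchwartzMap.smulLeftCLM_apply hg'] at this
  have hA : Measurable A := A.continuous.measurable
  refine (this.norm.const_mul ((2 * Real.pi) ^ t)).mono'
    (Measurable.aestronglyMeasurable (by fun_prop)) (Filter.Eventually.of_forall fun ζ => ?_)
  simp only [smul_eq_mul, norm_mul, Complex.norm_real, Real.norm_eq_abs, abs_norm,
    abs_of_pos (bracket_pos _ _)]
  rw [abs_of_nonneg (Real.rpow_nonneg (abs_nonneg _) _), ← mul_assoc]
  gcongr
  exact abs_two_pi_rpow_le_bracket ht le_rfl ζ

theorem integrable_derivMul (A : SchwartzMap ℝ ℂ) : Integrable (derivMul A) := by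
  have hA : Measurable A := A.continuous.measurable
  refine (integrable_weight A zero_le_one).mono' (measurable_derivMul hA).aestronglyMeasurable
    (Filter.Eventually.of_forall fun ζ => ?_)
  rw [norm_derivMul, Real.rpow_one]

theorem sub_conj (h : SchwartzProfile A φ) (ξ η : ℝ) :
    A (η - ξ) = starRingEnd ℂ (A (ξ - η)) := by
  rw [← h.conj]; congr 1; ring

theorem hasDerivAt (h : SchwartzProfile A φ) (x : ℝ) :
    HasDerivAt (fun y => (φ y : ℂ)) (𝓕⁻ (derivMul A) x) x := by
  have e : (fun y => (φ y : ℂ)) = 𝓕⁻ (A : ℝ → ℂ) := by ext y; exact h.inv y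
  rw [e]
  exact hasDerivAt_fourierInv A.integrable (integrable_derivMul A) x

theorem deriv_eq (h : SchwartzProfile A φ) (hd : Differentiable ℝ φ) (x : ℝ) :
    ((deriv φ x : ℝ) : ℂ) = 𝓕⁻ (derivMul A) x :=
  (hd x).hasDerivAt.ofReal_comp.unique (h.hasDerivAt x)

end SchwartzProfile

namespace SobolevProfile

variable {p : ℝ} {F : ℝ → ℂ} {W φ : ℝ → ℝ} {A : SchwartzMap ℝ ℂ}

/-- The form `∬ |2πξ|^{2p} F(ξ) conj(2πiξ A(ξ - η) F(η))`. -/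
noncomputable def dispersionKernel (p : ℝ) (A F : ℝ → ℂ) (z : ℝ × ℝ) : ℂ :=
  absMul (2 * p) F z.1 *
    starRingEnd ℂ ((2 * Real.pi * Complex.I * z.1) * (A (z.1 - z.2) * F z.2))

/-- The form `∬ 2πi(ξ - η) A(ξ - η) |2πη|^p F(η) conj(|2πξ|^p F(ξ))`. -/
noncomputable def smoothingKernel (p : ℝ) (A F : ℝ → ℂ) (z : ℝ × ℝ) : ℂ :=
  derivMul A (z.1 - z.2) * absMul p F z.2 * starRingEnd ℂ (absMul p F z.1)

theorem measurable_dispersionKernel (p : ℝ) {A F : ℝ → ℂ} (hA : Measurable A)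
    (hF : Measurable F) : Measurable (dispersionKernel p A F) := by
  have := measurable_absMul (2 * p) hF
  have hc : Measurable (starRingEnd ℂ) := Complex.continuous_conj.measurable
  unfold dispersionKernel; fun_prop

theorem measurable_smoothingKernel (p : ℝ) {A F : ℝ → ℂ} (hA : Measurable A)
    (hF : Measurable F) : Measurable (smoothingKernel p A F) := by
  have := measurable_absMul p hF
  have := measurable_derivMul hA
  have hc : Measurable (starRingEnd ℂ) := Complex.continuous_conj.measurable
  unfold smoothingKernel; fun_prop

/-- The factor `2πξ` of the differentiated function is shifted onto the other one: `|ξ|^{1+2p} F` is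
square integrable by exactly the assumed regularity. Absolute convergence is what later permits
exchanging `ξ` and `η`. -/
theorem integrable_dispersionKernel (hp : 1 / 2 ≤ p) (h : SobolevProfile (1 + 2 * p) F W)
    (A : SchwartzMap ℝ ℂ) : Integrable (dispersionKernel p A F) (volume.prod volume) := by
  have hA : Measurable A := A.continuous.measurable
  refine (integrable_of_le_bilin (a := fun ζ => ‖A ζ‖) (by fun_prop) A.integrable.norm
    (fun _ => norm_nonneg _) (measurable_absMul (1 + 2 * p) h.meas)
    (h.memLp_absMul (by linarith) le_rfl) h.meas (h.memLp_two (by linarith))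
    (measurable_dispersionKernel p hA h.meas) fun ξ η => le_of_eq ?_).1
  simp only [dispersionKernel, norm_mul, RCLike.norm_conj, norm_absMul]
  have e : |2 * Real.pi * ξ| ^ (1 + 2 * p) = |2 * Real.pi * ξ| * |2 * Real.pi * ξ| ^ (2 * p) := by
    rw [Real.rpow_one_add' (abs_nonneg _) (by linarith)]
  have e2 := norm_two_pi_I_mul ξ
  rw [norm_mul, norm_mul, norm_mul] at e2
  rw [e2, e]
  ring

/-- Plancherel, with the transform of the product written as a convolution and the integral over
both frequencies taken jointly. -/
theorem integral_dispersion (hp : 1 / 2 ≤ p) (h : SobolevProfile (1 + 2 * p) F W)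
    (hA : SchwartzProfile A φ) :
    ∫ x, (𝓕⁻ (absMul (2 * p) F) x).re * deriv (fun y => φ y * W y) x
      = (∫ z, dispersionKernel p A F z ∂(volume.prod volume)).re := by
  have hv := h.mul (by linarith) A hA.inv
  have i1 := h.integrable_absMul (t := 2 * p) (by linarith) (by linarith)
  have i2 := h.memLp_absMul (t := 2 * p) (by linarith) (by linarith)
  have i3 := hv.integrable_derivMul (by linarith)
  have i4 := hv.memLp_derivMul (by linarith)
  have e1 : ∀ x, (𝓕⁻ (absMul (2 * p) F) x).re * deriv (fun y => φ y * W y) x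
      = Complex.reCLM (𝓕⁻ (absMul (2 * p) F) x
        * starRingEnd ℂ (𝓕⁻ (derivMul (cv A F)) x)) := by
    intro x
    rw [← hv.deriv_eq (by linarith), Complex.conj_ofReal]
    simp
  simp only [e1]
  rw [ContinuousLinearMap.integral_comp_comm, integral_fourierInv_mul_conj i1 i2 i3 i4,
    integral_prod _ (integrable_dispersionKernel hp h A)]
  · simp only [Complex.reCLM_apply]
    congr 1
    refine integral_congr_ae (Filter.Eventually.of_forall fun ξ => ?_)
    simp only [dispersionKernel]
    rw [integral_const_mul, integral_conj, integral_const_mul]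
    rfl
  · have := (memLp_fourierInv i3 i4)
    have hc : MemLp (fun x => starRingEnd ℂ (𝓕⁻ (derivMul (cv A F)) x)) 2 volume :=
      this.star
    exact (memLp_fourierInv i1 i2).integrable_mul hc

theorem integrable_smoothingKernel (hp : 1 / 2 ≤ p) (h : SobolevProfile (1 + 2 * p) F W)
    (A : SchwartzMap ℝ ℂ) : Integrable (smoothingKernel p A F) (volume.prod volume) := by
  have hA : Measurable A := A.continuous.measurable
  have hAd := measurable_derivMul hA
  refine (integrable_of_le_bilin (a := fun ζ => ‖derivMul A ζ‖) (by fun_prop)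
    (SchwartzProfile.integrable_derivMul A).norm
    (fun _ => norm_nonneg _) (measurable_absMul p h.meas)
    (h.memLp_absMul (by linarith) (by linarith)) (measurable_absMul p h.meas)
    (h.memLp_absMul (by linarith) (by linarith))
    (measurable_smoothingKernel p hA h.meas) fun ξ η => le_of_eq ?_).1
  simp only [smoothingKernel, norm_mul, RCLike.norm_conj]
  ring

theorem integral_smoothing (hp : 1 / 2 ≤ p) (h : SobolevProfile (1 + 2 * p) F W)
    (hA : SchwartzProfile A φ) (hφ : Differentiable ℝ φ) :
    ∫ x, deriv φ x * ‖𝓕⁻ (absMul p F) x‖ ^ 2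
      = (∫ z, smoothingKernel p A F z ∂(volume.prod volume)).re := by
  have hAm : Measurable A := A.continuous.measurable
  have i1 := h.integrable_absMul (t := p) (by linarith) (by linarith)
  have i2 := h.memLp_absMul (t := p) (by linarith) (by linarith)
  have j1 := SchwartzProfile.integrable_derivMul A
  have i3 := integrable_cv j1 i1
  have i4 := (memLp_cv (measurable_derivMul hAm) j1 (measurable_absMul p h.meas) i2).1
  have e1 : ∀ x, deriv φ x * ‖𝓕⁻ (absMul p F) x‖ ^ 2
      = Complex.reCLM (𝓕⁻ (cv (derivMul A) (absMul p F)) x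
        * starRingEnd ℂ (𝓕⁻ (absMul p F) x)) := by
    intro x
    rw [fourierInv_cv j1 i1, ← hA.deriv_eq hφ, mul_assoc, Complex.mul_conj,
      Complex.normSq_eq_norm_sq, Complex.reCLM_apply, ← Complex.ofReal_mul, Complex.ofReal_re]
  simp only [e1]
  rw [ContinuousLinearMap.integral_comp_comm, integral_fourierInv_mul_conj i3 i4 i1 i2,
    integral_prod _ (integrable_smoothingKernel hp h A)]
  · simp only [Complex.reCLM_apply]
    congr 1
    refine integral_congr_ae (Filter.Eventually.of_forall fun ξ => ?_)
    simp only [smoothingKernel]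
    rw [integral_mul_const]
    rfl
  · have hc : MemLp (fun x => starRingEnd ℂ (𝓕⁻ (absMul p F) x)) 2 volume :=
      (memLp_fourierInv i1 i2).star
    exact (memLp_fourierInv i3 i4).integrable_mul hc

/-- The local smoothing identity: up to a bounded error, the dispersive term is the localized
`L²` norm of the fractional derivative of order `p`. -/
theorem abs_dispersion_sub_smoothing_le (hp : 1 / 2 ≤ p) (hp1 : p < 1)
    (h : SobolevProfile (1 + 2 * p) F W) (hA : SchwartzProfile A φ) (hφ : Differentiable ℝ φ) :
    |(∫ x, (𝓕⁻ (absMul (2 * p) F) x).re * deriv (fun y => φ y * W y) x)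
        - (1 + 2 * p) / 2 * ∫ x, deriv φ x * ‖𝓕⁻ (absMul p F) x‖ ^ 2|
      ≤ 64 * (∫ ζ, |2 * Real.pi * ζ| ^ (1 + 2 * p) * ‖A ζ‖) * ∫ ξ, ‖F ξ‖ ^ 2 := by
  have hAm : Measurable A := A.continuous.measurable
  rw [integral_dispersion hp h hA, integral_smoothing hp h hA hφ]
  set P := dispersionKernel p A F with hP
  set Q := smoothingKernel p A F with hQ
  have iP : Integrable P (volume.prod volume) := integrable_dispersionKernel hp h A
  have iQ : Integrable Q (volume.prod volume) := integrable_smoothingKernel hp h A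
  have mP : Measurable P := measurable_dispersionKernel p hAm h.meas
  have mQ : Measurable Q := measurable_smoothingKernel p hAm h.meas
  have hc : Measurable (starRingEnd ℂ) := Complex.continuous_conj.measurable
  -- Exchanging the frequencies and conjugating does not change the real part of `∫ P`, so `Re ∫ E =
  -- 2 Re ∫ P - (1 + 2p) Re ∫ Q`, twice the quantity to be bounded.
  set E : ℝ × ℝ → ℂ := fun z =>
    P z + starRingEnd ℂ (P z.swap) - (1 + 2 * p : ℝ) * starRingEnd ℂ (Q z) with hE
  have iS : Integrable (fun z : ℝ × ℝ => starRingEnd ℂ (P z.swap)) (volume.prod volume) :=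
    Complex.conjCLE.toContinuousLinearMap.integrable_comp iP.swap
  have iQ' : Integrable (fun z : ℝ × ℝ => starRingEnd ℂ (Q z)) (volume.prod volume) :=
    Complex.conjCLE.toContinuousLinearMap.integrable_comp iQ
  have eE : ∫ z, E z ∂(volume.prod volume)
      = (∫ z, P z ∂(volume.prod volume)) + starRingEnd ℂ (∫ z, P z ∂(volume.prod volume))
        - (1 + 2 * p : ℝ) * starRingEnd ℂ (∫ z, Q z ∂(volume.prod volume)) := by
    rw [hE, integral_sub (f := fun z : ℝ × ℝ => P z + starRingEnd ℂ (P z.swap)) (iP.add iS)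
      (iQ'.const_mul _), integral_add iP iS, integral_const_mul,
      integral_conj, integral_conj, integral_prod_swap]
  have key := (integrable_of_le_bilin
    (a := fun ζ => 64 * (|2 * Real.pi * ζ| ^ (1 + 2 * p) * ‖A ζ‖)) (by fun_prop)
    ((SchwartzProfile.integrable_weight A (by linarith)).const_mul 64)
    (fun ζ => by positivity) h.meas (h.memLp_two (by linarith)) h.meas
    (h.memLp_two (by linarith)) (P := E) (by fun_prop) (fun ξ η => ?_)).2
  · rw [integral_const_mul] at key
    have hre : |(∫ z, E z ∂(volume.prod volume)).re| ≤ ‖∫ z, E z ∂(volume.prod volume)‖ :=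
      Complex.abs_re_le_norm _
    have e3 : (∫ z, P z ∂(volume.prod volume)).re
        - (1 + 2 * p) / 2 * (∫ z, Q z ∂(volume.prod volume)).re
        = (∫ z, E z ∂(volume.prod volume)).re / 2 := by
      rw [eE, Complex.sub_re, Complex.add_re, Complex.conj_re, Complex.re_ofReal_mul,
        Complex.conj_re]
      ring
    rw [e3, abs_div, abs_two]
    linarith
  -- Since `A(η - ξ)` is the conjugate of `A(ξ - η)`, all three terms share the factor `F(ξ)
  -- conj(A(ξ-η)) conj(F(η))`, and only the symbol remainder is left in front of it.
  · have e4 : E (ξ, η) = -Complex.I * ((2 * Real.pi * ξ * |2 * Real.pi * ξ| ^ (2 * p)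
        - 2 * Real.pi * η * |2 * Real.pi * η| ^ (2 * p)
        - (1 + 2 * p) * (2 * Real.pi * ξ - 2 * Real.pi * η)
          * (|2 * Real.pi * ξ| ^ p * |2 * Real.pi * η| ^ p) : ℝ) : ℂ)
        * (F ξ * starRingEnd ℂ (A (ξ - η)) * starRingEnd ℂ (F η)) := by
      simp only [hE, hP, hQ, dispersionKernel, smoothingKernel, absMul, derivMul, Prod.swap,
        map_mul, map_neg, Complex.conj_ofReal, Complex.conj_I, Complex.conj_conj, hA.sub_conj ξ η,
        map_ofNat]
      push_cast
      ring
    rw [e4]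
    simp only [norm_mul, norm_neg, Complex.norm_I, Complex.norm_real, RCLike.norm_conj, one_mul,
      Real.norm_eq_abs]
    have := symbol_remainder hp hp1 (2 * Real.pi * ξ) (2 * Real.pi * η)
    rw [← mul_sub] at this ⊢
    calc _ ≤ 64 * |2 * Real.pi * (ξ - η)| ^ (1 + 2 * p) * (‖F ξ‖ * ‖A (ξ - η)‖ * ‖F η‖) := by
          gcongr
      _ = _ := by ring

end SobolevProfile

end KatoSmoothing

/-! ### The commutator with a cut-off and absorption of the cubic term. -/

section Localization

theorem integrable_sub_mul (B : SchwartzMap ℝ ℂ) {F : ℝ → ℂ} (hF : Integrable F) (ξ : ℝ) :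
    Integrable fun η => B (ξ - η) * F η := by
  refine hF.bdd_mul (c := SchwartzMap.seminorm ℝ 0 0 B)
    (Continuous.aestronglyMeasurable (B.continuous.comp (by fun_prop)))
    (Filter.Eventually.of_forall fun η => ?_)
  exact B.norm_le_seminorm ℝ _

namespace SobolevProfile

variable {p : ℝ} {F : ℝ → ℂ} {W χ : ℝ → ℝ} {B : SchwartzMap ℝ ℂ}

/-- The commutator of `𝓓^p` with the multiplication by `χ` is bounded on `L²`. -/
theorem integral_absMul_cv_le (hp : 1 / 2 ≤ p) (hp1 : p ≤ 1) (h : SobolevProfile (1 + 2 * p) F W)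
    (hB : SchwartzProfile B χ) :
    ∫ ξ, ‖absMul p (cv B F) ξ‖ ^ 2 ≤ 2 * (∫ x, χ x ^ 2 * ‖𝓕⁻ (absMul p F) x‖ ^ 2)
      + 2 * (∫ ζ, |2 * Real.pi * ζ| ^ p * ‖B ζ‖) ^ 2 * ∫ ξ, ‖F ξ‖ ^ 2 := by
  have hBm : Measurable B := B.continuous.measurable
  have hv := h.mul (by linarith) B hB.inv
  have i1 := h.integrable_absMul (t := p) (by linarith) (by linarith)
  have i2 := h.memLp_absMul (t := p) (by linarith) (by linarith)
  have i3 := integrable_cv B.integrable i1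
  have i4 := (memLp_cv hBm B.integrable (measurable_absMul p h.meas) i2).1
  -- The commutator on the Fourier side. Its kernel `(|2πξ|^p - |2πη|^p) B(ξ-η)` is bounded by
  -- `|2π(ξ-η)|^p |B(ξ-η)|`, so Young's inequality applies.
  set T : ℝ → ℂ := fun ξ => absMul p (cv B F) ξ - cv B (absMul p F) ξ with hT
  have mT : Measurable T :=
    (measurable_absMul p hv.meas).sub (measurable_cv hBm (measurable_absMul p h.meas))
  have eT : ∀ ξ, T ξ = ∫ η, ((|2 * Real.pi * ξ| ^ p - |2 * Real.pi * η| ^ p : ℝ) : ℂ)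
      * (B (ξ - η) * F η) := by
    intro ξ
    simp only [hT]
    rw [absMul, cv, cv, ← integral_const_mul, ← integral_sub
      ((integrable_sub_mul B (h.integrable (by linarith)) ξ).const_mul _)
      (integrable_sub_mul B i1 ξ)]
    refine integral_congr_ae (Filter.Eventually.of_forall fun η => ?_)
    simp only [absMul]
    push_cast
    ring
  obtain ⟨lT, bT⟩ := memLp_of_le_conv (a := fun ζ => |2 * Real.pi * ζ| ^ p * ‖B ζ‖)
    (by fun_prop) (SchwartzProfile.integrable_weight B (by linarith)) (fun ζ => by positivity)
    h.meas (h.memLp_two (by linarith)) mT.aestronglyMeasurable (fun ξ => by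
      rw [eT]
      refine (enorm_integral_le_lintegral_enorm _).trans (lintegral_mono fun η => ?_)
      rw [← mul_assoc, enorm_mul]
      gcongr
      rw [← ofReal_norm, norm_mul, Complex.norm_real, Real.norm_eq_abs]
      refine ENNReal.ofReal_le_ofReal ?_
      have := abs_rpow_sub_abs_rpow_le (by linarith) hp1 (2 * Real.pi * ξ) (2 * Real.pi * η)
      rw [← mul_sub] at this
      gcongr)
  have e2 : ∫ x, χ x ^ 2 * ‖𝓕⁻ (absMul p F) x‖ ^ 2 = ∫ ξ, ‖cv B (absMul p F) ξ‖ ^ 2 := by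
    rw [← integral_norm_sq_fourierInv i3 i4]
    refine integral_congr_ae (Filter.Eventually.of_forall fun x => ?_)
    simp only []
    rw [fourierInv_cv B.integrable i1, ← hB.inv, norm_mul, Complex.norm_real, mul_pow,
      Real.norm_eq_abs, sq_abs]
  rw [e2]
  have sT := (memLp_two_iff_integrable_sq_norm lT.1).1 lT
  have sC := (memLp_two_iff_integrable_sq_norm i4.1).1 i4
  have lA := hv.memLp_absMul (t := p) (by linarith) (by linarith)
  have sA := (memLp_two_iff_integrable_sq_norm lA.1).1 lA
  calc ∫ ξ, ‖absMul p (cv B F) ξ‖ ^ 2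
      ≤ ∫ ξ, (2 * ‖cv B (absMul p F) ξ‖ ^ 2 + 2 * ‖T ξ‖ ^ 2) := by
        refine integral_mono sA ((sC.const_mul 2).add (sT.const_mul 2)) fun ξ => ?_
        have e : absMul p (cv B F) ξ = cv B (absMul p F) ξ + T ξ := by simp only [hT]; ring
        have hn : ‖absMul p (cv B F) ξ‖ ≤ ‖cv B (absMul p F) ξ‖ + ‖T ξ‖ := by
          rw [e]; exact norm_add_le _ _
        have h0 := norm_nonneg (absMul p (cv B F) ξ)
        beta_reduce
        nlinarith [sq_nonneg (‖cv B (absMul p F) ξ‖ - ‖T ξ‖)]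
    _ = 2 * (∫ ξ, ‖cv B (absMul p F) ξ‖ ^ 2) + 2 * ∫ ξ, ‖T ξ‖ ^ 2 := by
        rw [integral_add (sC.const_mul 2) (sT.const_mul 2), integral_const_mul,
          integral_const_mul]
    _ ≤ _ := by
        rw [mul_assoc 2 (_ ^ 2)]
        gcongr

end SobolevProfile

/-- The weight `1 + (2πlξ)^{2p}`, whose inverse is square integrable. -/
noncomputable def cubicWeight (p l ξ : ℝ) : ℝ := 1 + |2 * Real.pi * (l * ξ)| ^ (2 * p)

theorem one_le_cubicWeight (p l ξ : ℝ) : 1 ≤ cubicWeight p l ξ := by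
  have : 0 ≤ |2 * Real.pi * (l * ξ)| ^ (2 * p) := by positivity
  unfold cubicWeight; linarith

/-- Because `2p ≥ 1`, the weight dominates the case `p = 1/2`: `1 + x² ≤ 2(1 + x^{2p})²`. The
comparison integral `2 ∫ dξ/(1 + (2πlξ)²)` is exactly `1/l`. -/
theorem lintegral_inv_cubicWeight_sq_le {p l : ℝ} (hp : 1 / 2 ≤ p) (hl : 0 < l) :
    ∫⁻ ξ, (ENNReal.ofReal (cubicWeight p l ξ))⁻¹ ^ 2 ≤ ENNReal.ofReal (1 / l) := by
  have hi : Integrable fun ξ : ℝ => 2 * (1 + (2 * Real.pi * l * ξ) ^ 2)⁻¹ := by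
    have := (integrable_inv_one_add_sq).comp_mul_left' (R := 2 * Real.pi * l) (by positivity)
    exact this.const_mul 2
  have hI : ∫ ξ : ℝ, 2 * (1 + (2 * Real.pi * l * ξ) ^ 2)⁻¹ = 1 / l := by
    rw [integral_const_mul, Measure.integral_comp_mul_left (fun x : ℝ => (1 + x ^ 2)⁻¹),
      integral_univ_inv_one_add_sq, abs_of_pos (by positivity), smul_eq_mul]
    have := Real.pi_pos
    field_simp
  rw [← hI, ofReal_integral_eq_lintegral_ofReal hi
    (Filter.Eventually.of_forall fun ξ => by positivity)]
  refine lintegral_mono fun ξ => ?_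
  have h1 := one_le_cubicWeight p l ξ
  rw [← ENNReal.ofReal_inv_of_pos (by linarith), ← ENNReal.ofReal_pow (by positivity)]
  refine ENNReal.ofReal_le_ofReal ?_
  set x := |2 * Real.pi * (l * ξ)| with hx
  have hx0 : 0 ≤ x := abs_nonneg _
  have hxe : (2 * Real.pi * l * ξ) ^ 2 = x ^ 2 := by rw [hx, sq_abs]; ring
  have hw : cubicWeight p l ξ = 1 + x ^ (2 * p) := rfl
  have hy : 0 ≤ x ^ (2 * p) := Real.rpow_nonneg hx0 _
  have key : 1 + x ^ 2 ≤ 2 * (1 + x ^ (2 * p)) ^ 2 := by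
    rcases le_total x 1 with h | h
    · nlinarith
    · have : x ≤ x ^ (2 * p) := by
        nth_rewrite 1 [← Real.rpow_one x]
        exact Real.rpow_le_rpow_of_exponent_le h (by linarith)
      nlinarith
  rw [hxe, hw, inv_pow, ← div_eq_mul_inv, inv_eq_one_div, div_le_div_iff₀ (by positivity)
    (by positivity)]
  linarith

/-- Cauchy–Schwarz in `η` with weight `w(ξ-η) w(η)`: the inverse weights integrate to at most `2 ∫
w⁻²` uniformly in `ξ`, and what remains factorizes. As `G ∗ G` is the transform of `g²`, this is an
L⁴ bound for `g`. -/
theorem lintegral_sq_cv_self_le {w : ℝ → ℝ} (hw : Measurable w) (hw1 : ∀ x, 1 ≤ w x)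
    {G : ℝ → ℂ} (hG : Measurable G) :
    ∫⁻ ξ, ‖cv G G ξ‖ₑ ^ 2 ≤ 2 * (∫⁻ ξ, (ENNReal.ofReal (w ξ))⁻¹ ^ 2)
      * (∫⁻ ξ, ENNReal.ofReal (w ξ) * ‖G ξ‖ₑ ^ 2) ^ 2 := by
  set v : ℝ → ℝ≥0∞ := fun x => ENNReal.ofReal (w x) with hv
  have hvm : Measurable v := by fun_prop
  have hv0 : ∀ x, v x ≠ 0 := fun x => by
    simp only [hv, ne_eq, ENNReal.ofReal_eq_zero, not_le]; linarith [hw1 x]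
  have hvt : ∀ x, v x ≠ ⊤ := fun x => ENNReal.ofReal_ne_top
  set I := ∫⁻ ξ, (v ξ)⁻¹ ^ 2 with hI
  have pt : ∀ ξ, ‖cv G G ξ‖ₑ ^ 2 ≤ 2 * I * ∫⁻ η, (v (ξ - η) * ‖G (ξ - η)‖ₑ ^ 2)
      * (v η * ‖G η‖ₑ ^ 2) := by
    intro ξ
    have c1 : ∀ η, ENNReal.ofReal ‖G (ξ - η)‖ * ‖G η‖ₑ
        = ((v (ξ - η))⁻¹ * (v η)⁻¹) * ((v (ξ - η) * v η) * (‖G (ξ - η)‖ₑ * ‖G η‖ₑ)) := by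
      intro η
      rw [ofReal_norm]
      symm
      calc _ = ((v (ξ - η))⁻¹ * v (ξ - η)) * ((v η)⁻¹ * v η)
            * (‖G (ξ - η)‖ₑ * ‖G η‖ₑ) := by ring
        _ = _ := by
          rw [ENNReal.inv_mul_cancel (hv0 _) (hvt _), ENNReal.inv_mul_cancel (hv0 _) (hvt _),
            one_mul, one_mul]
    have c2 : ∀ η, ((v (ξ - η))⁻¹ * (v η)⁻¹) * ((v (ξ - η) * v η) * (‖G (ξ - η)‖ₑ * ‖G η‖ₑ)) ^ 2
        = (v (ξ - η) * ‖G (ξ - η)‖ₑ ^ 2) * (v η * ‖G η‖ₑ ^ 2) := by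
      intro η
      calc _ = ((v (ξ - η))⁻¹ * v (ξ - η)) * ((v η)⁻¹ * v η)
            * ((v (ξ - η) * ‖G (ξ - η)‖ₑ ^ 2) * (v η * ‖G η‖ₑ ^ 2)) := by ring
        _ = _ := by
          rw [ENNReal.inv_mul_cancel (hv0 _) (hvt _), ENNReal.inv_mul_cancel (hv0 _) (hvt _),
            one_mul, one_mul]
    calc ‖cv G G ξ‖ₑ ^ 2 ≤ (∫⁻ η, ENNReal.ofReal ‖G (ξ - η)‖ * ‖G η‖ₑ) ^ 2 := by
          gcongr; exact enorm_cv_le _ _ _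
      _ ≤ (∫⁻ η, (v (ξ - η))⁻¹ * (v η)⁻¹) * ∫⁻ η, (v (ξ - η) * ‖G (ξ - η)‖ₑ ^ 2)
            * (v η * ‖G η‖ₑ ^ 2) := by
          simp only [c1]
          refine (sq_lintegral_mul_le (by fun_prop) (by fun_prop)).trans_eq ?_
          simp only [c2]
      _ ≤ _ := by
          gcongr
          calc ∫⁻ η, (v (ξ - η))⁻¹ * (v η)⁻¹
              ≤ ∫⁻ η, ((v (ξ - η))⁻¹ ^ 2 + (v η)⁻¹ ^ 2) :=
                lintegral_mono fun η => ENNReal_mul_le_add_sq _ _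
            _ = 2 * I := by
                rw [lintegral_add_left (by fun_prop),
                  lintegral_sub_left_eq_self (fun x => (v x)⁻¹ ^ 2) ξ, two_mul]
  calc ∫⁻ ξ, ‖cv G G ξ‖ₑ ^ 2
      ≤ ∫⁻ ξ, 2 * I * ∫⁻ η, (v (ξ - η) * ‖G (ξ - η)‖ₑ ^ 2) * (v η * ‖G η‖ₑ ^ 2) :=
        lintegral_mono pt
    _ = 2 * I * ∫⁻ ξ, ∫⁻ η, (v (ξ - η) * ‖G (ξ - η)‖ₑ ^ 2) * (v η * ‖G η‖ₑ ^ 2) := by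
        rw [lintegral_const_mul]
        exact Measurable.lintegral_prod_right' (f := fun z : ℝ × ℝ =>
          (v (z.1 - z.2) * ‖G (z.1 - z.2)‖ₑ ^ 2) * (v z.2 * ‖G z.2‖ₑ ^ 2)) (by fun_prop)
    _ = _ := by
        congr 1
        rw [lintegral_lintegral_swap (Measurable.aemeasurable (by fun_prop))]
        have : ∀ η, ∫⁻ ξ, (v (ξ - η) * ‖G (ξ - η)‖ₑ ^ 2) * (v η * ‖G η‖ₑ ^ 2)
            = (∫⁻ ξ, v ξ * ‖G ξ‖ₑ ^ 2) * (v η * ‖G η‖ₑ ^ 2) := by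
          intro η
          rw [lintegral_mul_const _ (by fun_prop),
            lintegral_sub_right_eq_self (fun x => v x * ‖G x‖ₑ ^ 2) η]
        simp only [this]
        rw [lintegral_const_mul _ (by fun_prop), sq]

namespace SobolevProfile

variable {p : ℝ} {F G : ℝ → ℂ} {W g χ : ℝ → ℝ} {B : SchwartzMap ℝ ℂ}

/-- The embedding of `H^p(ℝ)`, `p ≥ 1/2`, in `L⁴(ℝ)` with a small constant in front of the top
order term. -/
theorem integral_pow_four_le (hp : 1 / 2 ≤ p) (h : SobolevProfile (1 + 2 * p) G g) {l : ℝ}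
    (hl : 0 < l) (hl1 : l ≤ 1) :
    ∫ x, g x ^ 4 ≤ 2 / l * ((∫ ξ, ‖G ξ‖ ^ 2) + l * ∫ ξ, ‖absMul p G ξ‖ ^ 2) ^ 2 := by
  have i1 := h.integrable (by linarith)
  have i2 := h.memLp_two (by linarith)
  have i3 := integrable_cv i1 i1
  have i4 := (memLp_cv h.meas i1 h.meas i2).1
  have i5 := h.memLp_absMul (t := p) (by linarith) (by linarith)
  have s2 := (memLp_two_iff_integrable_sq_norm i2.1).1 i2
  have s5 := (memLp_two_iff_integrable_sq_norm i5.1).1 i5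
  have e1 : ∫ x, g x ^ 4 = ∫ ξ, ‖cv G G ξ‖ ^ 2 := by
    rw [← integral_norm_sq_fourierInv i3 i4]
    refine integral_congr_ae (Filter.Eventually.of_forall fun x => ?_)
    beta_reduce
    rw [fourierInv_cv i1 i1, ← h.inv, norm_mul, Complex.norm_real, Real.norm_eq_abs, ← sq,
      sq_abs, ← pow_mul]
  have hw : Measurable (cubicWeight p l) := by unfold cubicWeight; fun_prop
  have h1 := lintegral_sq_cv_self_le hw (one_le_cubicWeight p l) h.meas
  have h2 : ∫⁻ ξ, ENNReal.ofReal (cubicWeight p l ξ) * ‖G ξ‖ₑ ^ 2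
      ≤ ENNReal.ofReal ((∫ ξ, ‖G ξ‖ ^ 2) + l * ∫ ξ, ‖absMul p G ξ‖ ^ 2) := by
    rw [← integral_const_mul, ← integral_add s2 (s5.const_mul l),
      ofReal_integral_eq_lintegral_ofReal
        (f := fun ξ => ‖G ξ‖ ^ 2 + l * ‖absMul p G ξ‖ ^ 2) (s2.add (s5.const_mul l))
        (Filter.Eventually.of_forall fun ξ => by positivity)]
    refine lintegral_mono fun ξ => ?_
    have h0 := one_le_cubicWeight p l ξ
    rw [← ofReal_norm, ← ENNReal.ofReal_pow (norm_nonneg _), ← ENNReal.ofReal_mul (by linarith)]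
    refine ENNReal.ofReal_le_ofReal ?_
    rw [norm_absMul, cubicWeight, mul_left_comm, abs_mul l, abs_of_pos hl,
      Real.mul_rpow hl.le (abs_nonneg _), mul_pow]
    have e : |2 * Real.pi * ξ| ^ (2 * p) = (|2 * Real.pi * ξ| ^ p) ^ 2 := by
      rw [← Real.rpow_natCast, ← Real.rpow_mul (abs_nonneg _)]
      congr 1; push_cast; ring
    have e3 : l ^ (2 * p) ≤ l := by
      nth_rewrite 2 [← Real.rpow_one l]
      exact Real.rpow_le_rpow_of_exponent_ge hl hl1 (by linarith)
    rw [e]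
    have : l ^ (2 * p) * ((|2 * Real.pi * ξ| ^ p) ^ 2 * ‖G ξ‖ ^ 2)
        ≤ l * ((|2 * Real.pi * ξ| ^ p) ^ 2 * ‖G ξ‖ ^ 2) := by gcongr
    linarith
  have n1 : 0 ≤ ∫ ξ, ‖G ξ‖ ^ 2 := integral_nonneg fun _ => by positivity
  have n2 : 0 ≤ ∫ ξ, ‖absMul p G ξ‖ ^ 2 := integral_nonneg fun _ => by positivity
  have h3 : ∫⁻ ξ, ‖cv G G ξ‖ₑ ^ 2
      ≤ ENNReal.ofReal (2 / l * ((∫ ξ, ‖G ξ‖ ^ 2) + l * ∫ ξ, ‖absMul p G ξ‖ ^ 2) ^ 2) := by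
    refine h1.trans ?_
    rw [ENNReal.ofReal_mul (by positivity), ENNReal.ofReal_pow (by positivity),
      div_eq_mul_one_div, ENNReal.ofReal_mul (by norm_num), ENNReal.ofReal_ofNat]
    gcongr
    exact lintegral_inv_cubicWeight_sq_le hp hl
  rw [lintegral_enorm_sq_eq i4, ENNReal.ofReal_le_ofReal_iff (by positivity)] at h3
  rwa [e1]

theorem integrable_mul_cube (h : SobolevProfile (1 + 2 * p) F W) (hp : 1 / 2 ≤ p)
    {k : ℝ → ℝ} (hk : Continuous k) {c : ℝ} (hkb : ∀ x, ‖k x‖ ≤ c) :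
    Integrable fun x => k x * |W x| ^ 3 := by
  have hc := h.continuous (by linarith)
  have h2 := (memLp_two_iff_integrable_sq_norm (h.memLp_fun (by linarith)).1).1
    (h.memLp_fun (by linarith))
  have h3 := h2.bdd_mul (f := fun x => k x * |W x|) (c := c * ∫ ξ, ‖F ξ‖)
    (Continuous.aestronglyMeasurable (by fun_prop)) (Filter.Eventually.of_forall fun x => by
      rw [norm_mul, norm_abs_eq_norm]
      exact mul_le_mul (hkb x) (h.bounded x) (norm_nonneg _) ((norm_nonneg _).trans (hkb x)))
  refine h3.congr (Filter.Eventually.of_forall fun x => ?_)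
  simp only [Real.norm_eq_abs]
  ring

/-- The localized cubic term is absorbed by the smoothing term. -/
theorem integral_sq_mul_cube_le (hp : 1 / 2 ≤ p) (hp1 : p ≤ 1)
    (h : SobolevProfile (1 + 2 * p) F W) (hB : SchwartzProfile B χ) (hχ : Continuous χ)
    (hχ1 : ∀ x, |χ x| ≤ 1) {M : ℝ} (hM : 0 ≤ M) (hWM : ∫ ξ, ‖F ξ‖ ^ 2 ≤ M ^ 2) :
    ∫ x, χ x ^ 2 * |W x| ^ 3 ≤ 3 / 2 * (∫ x, χ x ^ 2 * ‖𝓕⁻ (absMul p F) x‖ ^ 2)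
      + 3 * M * (1 + M) * (M ^ 2 + 2 * (∫ ζ, |2 * Real.pi * ζ| ^ p * ‖B ζ‖) ^ 2 * M ^ 2) := by
  have hv := h.mul (by linarith) B hB.inv
  have hWc := h.continuous (by linarith)
  set K := ∫ ζ, |2 * Real.pi * ζ| ^ p * ‖B ζ‖ with hK
  set X := ∫ x, χ x ^ 2 * ‖𝓕⁻ (absMul p F) x‖ ^ 2 with hX
  have hX0 : 0 ≤ X := integral_nonneg fun _ => by positivity
  -- Small enough that the final coefficient `6M(1+M)l` of the smoothing term is at most `3/2`;
  -- after the factor `1/3` from convection, half of the smoothing term survives.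
  set l : ℝ := 1 / (4 * (1 + M) ^ 2) with hl
  have hl0 : 0 < l := by positivity
  have hl1 : l ≤ 1 := by
    rw [hl, div_le_one (by positivity)]; nlinarith
  have c4 := hv.integral_pow_four_le hp hl0 hl1
  have cd := h.integral_absMul_cv_le hp hp1 hB
  have W2 : ∫ x, W x ^ 2 ≤ M ^ 2 := by rwa [h.integral_sq (by linarith)]
  have iW := (h.memLp_fun (by linarith)).integrable_sq
  have g2 : ∫ ξ, ‖cv B F ξ‖ ^ 2 ≤ M ^ 2 := by
    rw [← hv.integral_sq (by linarith)]
    refine le_trans (integral_mono (hv.memLp_fun (by linarith)).integrable_sq iW fun x => ?_) W2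
    beta_reduce
    rw [mul_pow]
    have : χ x ^ 2 ≤ 1 := by rw [← sq_abs]; nlinarith [hχ1 x, abs_nonneg (χ x)]
    nlinarith [sq_nonneg (W x)]
  set Y := M ^ 2 + 2 * l * X + 2 * K ^ 2 * M ^ 2 with hY
  have hY0 : 0 ≤ Y := by positivity
  have g4 : ∫ x, (χ x * W x) ^ 4 ≤ (3 * (1 + M) * Y) ^ 2 := by
    refine c4.trans ?_
    -- The embedding constant is `2/l = 8(1+M)²`; rounding 8 up to 9 gives a perfect square.
    have e : (3 * (1 + M) * Y) ^ 2 = 9 / 4 * (1 / l) * Y ^ 2 := by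
      rw [hl]; field_simp; ring
    have n1 : 0 ≤ ∫ ξ, ‖cv B F ξ‖ ^ 2 := integral_nonneg fun _ => by positivity
    have n2 : 0 ≤ ∫ ξ, ‖absMul p (cv B F) ξ‖ ^ 2 := integral_nonneg fun _ => by positivity
    have n3 : (∫ ξ, ‖cv B F ξ‖ ^ 2) + l * ∫ ξ, ‖absMul p (cv B F) ξ‖ ^ 2 ≤ Y := by
      have h1 : l * ∫ ξ, ‖absMul p (cv B F) ξ‖ ^ 2 ≤ l * (2 * X + 2 * K ^ 2 * M ^ 2) := by
        refine mul_le_mul_of_nonneg_left (cd.trans ?_) hl0.le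
        gcongr
      have h2 : l * (2 * K ^ 2 * M ^ 2) ≤ 1 * (2 * K ^ 2 * M ^ 2) := by gcongr
      rw [hY]
      linarith
    rw [e, div_eq_mul_one_div 2 l]
    gcongr
    norm_num
  -- Cauchy–Schwarz
  have ig4 : Integrable fun x => (χ x * W x) ^ 4 := by
    have h1 := integrable_mul_cube h hp (k := fun x => χ x ^ 4 * |W x|)
      (by fun_prop) (c := ∫ ξ, ‖F ξ‖) (fun x => by
        rw [norm_mul, norm_abs_eq_norm, norm_pow, Real.norm_eq_abs (χ x)]
        have : |χ x| ^ 4 ≤ 1 := pow_le_one₀ (abs_nonneg _) (hχ1 x)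
        calc |χ x| ^ 4 * ‖W x‖ ≤ 1 * ‖W x‖ := by gcongr
          _ ≤ _ := by rw [one_mul]; exact h.bounded x)
    refine h1.congr (Filter.Eventually.of_forall fun x => ?_)
    beta_reduce
    have : |W x| * |W x| ^ 3 = W x ^ 4 := by
      rw [← pow_succ', ← abs_pow, abs_of_nonneg (Even.pow_nonneg (by decide) _)]
    rw [mul_assoc, this, mul_pow]
  have mg : MemLp (fun x => (χ x * W x) ^ 2) 2 volume := by
    rw [memLp_two_iff_integrable_sq (Continuous.aestronglyMeasurable (by fun_prop))]
    refine ig4.congr (Filter.Eventually.of_forall fun x => ?_)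
    beta_reduce
    rw [← pow_mul]
  have mW : MemLp (fun x => |W x|) 2 volume := (h.memLp_fun (by linarith)).norm
  have cs := integral_mul_le_Lp_mul_Lq_of_nonneg (μ := volume) Real.HolderConjugate.two_two
    (f := fun x => |W x|) (g := fun x => (χ x * W x) ^ 2)
    (Filter.Eventually.of_forall fun x => abs_nonneg _)
    (Filter.Eventually.of_forall fun x => sq_nonneg _)
    (by simpa using mW) (by simpa using mg)
  have e1 : ∫ x, χ x ^ 2 * |W x| ^ 3 = ∫ x, |W x| * (χ x * W x) ^ 2 := by
    refine integral_congr_ae (Filter.Eventually.of_forall fun x => ?_)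
    beta_reduce
    rw [mul_pow, ← sq_abs (W x)]; ring
  have e2 : ∫ x, |W x| ^ (2 : ℝ) = ∫ x, W x ^ 2 := by
    refine integral_congr_ae (Filter.Eventually.of_forall fun x => ?_)
    simp
  have e3 : ∫ x, ((χ x * W x) ^ 2) ^ (2 : ℝ) = ∫ x, (χ x * W x) ^ 4 := by
    refine integral_congr_ae (Filter.Eventually.of_forall fun x => ?_)
    simp only [Real.rpow_ofNat, ← pow_mul]
  rw [e2, e3, ← Real.sqrt_eq_rpow, ← Real.sqrt_eq_rpow] at cs
  have q1 : Real.sqrt (∫ x, W x ^ 2) ≤ M := Real.sqrt_le_iff.2 ⟨hM, W2⟩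
  have q2 : Real.sqrt (∫ x, (χ x * W x) ^ 4) ≤ 3 * (1 + M) * Y :=
    Real.sqrt_le_iff.2 ⟨by positivity, g4⟩
  rw [e1]
  calc _ ≤ _ := cs
    _ ≤ M * (3 * (1 + M) * Y) := by gcongr
    _ = 6 * M * (1 + M) * l * X + 3 * M * (1 + M) * (M ^ 2 + 2 * K ^ 2 * M ^ 2) := by
        rw [hY]; ring
    _ ≤ _ := by
        have : 6 * M * (1 + M) * l ≤ 3 / 2 := by
          rw [hl, mul_one_div, div_le_iff₀ (by positivity)]
          nlinarith
        gcongr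

end SobolevProfile

end Localization

/-! ### Truncation of the non-decaying weight. -/

section Cutoff

namespace FractionalKdV.IsCutoff

variable {R : ℝ} {φ : ℝ → ℝ}

theorem differentiable (h : IsCutoff R φ) : Differentiable ℝ φ :=
  h.smooth.differentiable (by simp)

theorem contDiff_deriv (h : IsCutoff R φ) : ContDiff ℝ ∞ (deriv φ) :=
  ((contDiff_infty_iff_deriv (𝕜 := ℝ)).1 h.smooth).2

theorem hasCompactSupport_deriv (h : IsCutoff R φ) : HasCompactSupport (deriv φ) :=
  HasCompactSupport.intro (isCompact_closedBall (0 : ℝ) (R + 1)) fun x hx => by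
    refine h.deriv_eq_zero x ?_
    simp only [Metric.mem_closedBall, dist_zero_right, Real.norm_eq_abs, not_le] at hx
    exact hx.le

/-- Constancy beyond the support of `φ_x` allows `φ(x)` to be replaced by a rescaled value in the
truncation region. The left end is treated separately, as its constant is a different one. -/
theorem eq_of_le (h : IsCutoff R φ) {x y : ℝ} (hx : R + 1 ≤ x) (hy : R + 1 ≤ y) : φ x = φ y := by
  have key : ∀ z, R + 1 ≤ z → φ z = φ (R + 1) := fun z hz =>
    constant_of_has_deriv_right_zero (a := R + 1) (b := z) h.smooth.continuous.continuousOn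
      (fun t ht => by
        have := (h.differentiable t).hasDerivAt
        rw [h.deriv_eq_zero t (ht.1.trans (le_abs_self t))] at this
        exact this.hasDerivWithinAt) z ⟨hz, le_rfl⟩
  rw [key x hx, key y hy]

theorem eq_of_le_neg (h : IsCutoff R φ) {x y : ℝ} (hx : x ≤ -(R + 1)) (hy : y ≤ -(R + 1)) :
    φ x = φ y := by
  have key : ∀ z, z ≤ -(R + 1) → φ (-(R + 1)) = φ z := fun z hz =>
    constant_of_has_deriv_right_zero (a := z) (b := -(R + 1)) h.smooth.continuous.continuousOn
      (fun t ht => by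
        have := (h.differentiable t).hasDerivAt
        rw [h.deriv_eq_zero t (by linarith [neg_abs_le t, ht.2])] at this
        exact this.hasDerivWithinAt) (-(R + 1)) ⟨hz, le_rfl⟩
  rw [← key x hx, ← key y hy]

end FractionalKdV.IsCutoff

theorem fourier_comp_div (f : ℝ → ℂ) {L : ℝ} (hL : 0 < L) (ζ : ℝ) :
    𝓕 (fun x => ((L⁻¹ : ℝ) : ℂ) * f (x / L)) ζ = 𝓕 f (L * ζ) := by
  rw [Real.fourier_real_eq_integral_exp_smul, Real.fourier_real_eq_integral_exp_smul]
  have h := Measure.integral_comp_div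
    (fun v : ℝ => Complex.exp (↑(-2 * Real.pi * v * (L * ζ)) * Complex.I) • f v) L
  have e : ∀ v : ℝ, Complex.exp (↑(-2 * Real.pi * v * ζ) * Complex.I)
      • (((L⁻¹ : ℝ) : ℂ) * f (v / L))
      = ((L⁻¹ : ℝ) : ℂ) * (Complex.exp (↑(-2 * Real.pi * (v / L) * (L * ζ)) * Complex.I)
        • f (v / L)) := by
    intro v
    have : -2 * Real.pi * (v / L) * (L * ζ) = -2 * Real.pi * v * ζ := by field_simp
    rw [this]
    simp only [smul_eq_mul]
    ring
  simp only [e]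
  rw [integral_const_mul, h, abs_of_pos hL, Complex.real_smul, ← mul_assoc, ← Complex.ofReal_mul,
    inv_mul_cancel₀ hL.ne', Complex.ofReal_one, one_mul]

/-- Compactly supported approximations of a cut-off function. -/
theorem exists_compact_cutoff {R : ℝ} (hR : 0 < R) {φ : ℝ → ℝ} (h : IsCutoff R φ) {p : ℝ}
    (hp : 0 < p) :
    ∃ K N : ℝ, ∀ L : ℝ, R + 1 ≤ L → ∃ (f : ℝ → ℝ) (A : SchwartzMap ℝ ℂ),
      ContDiff ℝ ∞ f ∧ HasCompactSupport f ∧ SchwartzProfile A f ∧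
      (∀ x, 0 ≤ f x ∧ f x ≤ 2 + 2 * R) ∧ (∀ x, |deriv f x - deriv φ x| ≤ K / L) ∧
      ∫ ζ, |2 * Real.pi * ζ| ^ (1 + 2 * p) * ‖A ζ‖ ≤ N := by
  let θ : ContDiffBump (0 : ℝ) := ⟨1, 2, one_pos, one_lt_two⟩
  have hθs : ContDiff ℝ ∞ θ := θ.contDiff
  have hθd : ContDiff ℝ ∞ (deriv θ) := ((contDiff_infty_iff_deriv (𝕜 := ℝ)).1 hθs).2
  have hθ1 : ∀ y : ℝ, |y| ≤ 1 → θ y = 1 := fun y hy =>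
    θ.one_of_mem_closedBall (by simpa using hy)
  have hθ' : ∀ y : ℝ, |y| < 1 → deriv θ y = 0 := by
    intro y hy
    have : (θ : ℝ → ℝ) =ᶠ[nhds y] fun _ => 1 := by
      filter_upwards [(isOpen_lt continuous_abs continuous_const).mem_nhds hy] with z hz
      exact hθ1 z (le_of_lt hz)
    rw [this.deriv_eq, deriv_const]
  -- Where `θ'(x/L) ≠ 0` one has `|x| ≥ L ≥ R + 1`, so `φ(x) = φ((R+1)x/L)`. Thus the derivative of
  -- `φ(x) θ(x/L)` differs from `φ_x` by exactly `L⁻¹ ρ(x/L)`, a dilation of one function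
  -- independent of `L`.
  set ρ : ℝ → ℝ := fun y => φ ((R + 1) * y) * deriv θ y with hρ
  have hφs := h.smooth
  have hρs : ContDiff ℝ ∞ ρ := by
    have : ContDiff ℝ ∞ fun y : ℝ => φ ((R + 1) * y) := hφs.comp (by fun_prop)
    exact this.mul hθd
  have hρc : HasCompactSupport ρ := θ.hasCompactSupport.deriv.mul_left
  obtain ⟨K, hK⟩ := hρc.exists_bound_of_continuous hρs.continuous
  obtain ⟨Aψ, -, hψe⟩ := exists_schwartzProfile h.contDiff_deriv h.hasCompactSupport_deriv
  obtain ⟨Aρ, -, hρe⟩ := exists_schwartzProfile hρs hρc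
  have iψ := SchwartzProfile.integrable_weight Aψ (t := 2 * p) (by linarith)
  have iρ := SchwartzProfile.integrable_weight Aρ (t := 2 * p) (by linarith)
  refine ⟨K, (∫ ζ, |2 * Real.pi * ζ| ^ (2 * p) * ‖Aψ ζ‖)
    + ∫ ζ, |2 * Real.pi * ζ| ^ (2 * p) * ‖Aρ ζ‖, fun L hL => ?_⟩
  have hL0 : 0 < L := by linarith
  set f : ℝ → ℝ := fun x => φ x * θ (x / L) with hf
  have hfs : ContDiff ℝ ∞ f := hφs.mul (hθs.comp (by fun_prop))
  have hfc : HasCompactSupport f := by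
    refine HasCompactSupport.intro (isCompact_closedBall (0 : ℝ) (2 * L)) fun x hx => ?_
    simp only [Metric.mem_closedBall, dist_zero_right, Real.norm_eq_abs, not_le] at hx
    have : θ (x / L) = 0 := by
      refine θ.zero_of_le_dist ?_
      change 2 ≤ _
      rw [dist_zero_right, Real.norm_eq_abs, abs_div, abs_of_pos hL0, le_div_iff₀ hL0]
      exact hx.le
    simp [hf, this]
  have hfd : ∀ x, deriv f x = deriv φ x + L⁻¹ * ρ (x / L) := by
    intro x
    have d1 := (h.differentiable x).hasDerivAt
    have d2 : HasDerivAt (fun x => θ (x / L)) (deriv θ (x / L) * (1 / L)) x :=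
      HasDerivAt.comp (h₂ := (θ : ℝ → ℝ)) x
        (hθs.differentiable (by simp) (x / L)).hasDerivAt ((hasDerivAt_id x).div_const L)
    have d3 : HasDerivAt f (deriv φ x * θ (x / L) + φ x * (deriv θ (x / L) * (1 / L))) x :=
      d1.mul d2
    rw [d3.deriv]
    congr 1
    · by_cases hx : R + 1 ≤ |x|
      · rw [h.deriv_eq_zero x hx, zero_mul]
      · rw [hθ1, mul_one]
        rw [abs_div, abs_of_pos hL0, div_le_one hL0]
        linarith
    · simp only [hρ]
      by_cases hx : |x / L| < 1
      · rw [hθ' _ hx]; ring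
      · have hx' : 1 ≤ |x / L| := not_lt.1 hx
        have : φ x = φ ((R + 1) * (x / L)) := by
          rcases le_abs.1 hx' with h1 | h1
          · refine h.eq_of_le ?_ (by nlinarith)
            rw [le_div_iff₀ hL0] at h1; linarith
          · refine h.eq_of_le_neg ?_ (by nlinarith)
            rw [← neg_div, le_div_iff₀ hL0] at h1; linarith
        rw [this]; ring
  obtain ⟨A, hA, hAe⟩ := exists_schwartzProfile hfs hfc
  refine ⟨f, A, hfs, hfc, hA, fun x => ⟨?_, ?_⟩, fun x => ?_, ?_⟩
  · exact mul_nonneg (by linarith [h.one_le x]) θ.nonneg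
  · calc φ x * θ (x / L) ≤ φ x * 1 :=
        mul_le_mul_of_nonneg_left θ.le_one (by linarith [h.one_le x])
      _ ≤ _ := by rw [mul_one]; exact h.le x
  · rw [hfd, add_sub_cancel_left, abs_mul, abs_of_pos (inv_pos.2 hL0), div_eq_inv_mul K]
    exact mul_le_mul_of_nonneg_left (hK _) (inv_pos.2 hL0).le
  · have hAd : ∀ ζ, derivMul A ζ = Aψ ζ + Aρ (L * ζ) := by
      intro ζ
      have hfd' : ∀ x, HasDerivAt (fun y => (f y : ℂ))
          (((deriv φ x : ℝ) : ℂ) + ((L⁻¹ : ℝ) : ℂ) * (ρ (x / L) : ℂ)) x := by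
        intro x
        have := ((hfs.differentiable (by simp) x).hasDerivAt).ofReal_comp
        rw [hfd] at this
        push_cast at this
        push_cast
        exact this
      have hde : deriv (fun y => (f y : ℂ))
          = fun x => ((deriv φ x : ℝ) : ℂ) + ((L⁻¹ : ℝ) : ℂ) * (ρ (x / L) : ℂ) := by
        ext x; exact (hfd' x).deriv
      have i1 : Integrable fun x => ((deriv φ x : ℝ) : ℂ) :=
        (h.contDiff_deriv.continuous.integrable_of_hasCompactSupport
          h.hasCompactSupport_deriv).ofReal
      have i2 : Integrable fun x => ((ρ x : ℝ) : ℂ) :=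
        (hρs.continuous.integrable_of_hasCompactSupport hρc).ofReal
      have i3 : Integrable fun x => ((L⁻¹ : ℝ) : ℂ) * ((ρ (x / L) : ℝ) : ℂ) :=
        (i2.comp_div hL0.ne').const_mul _
      have h1 := congrFun (Real.fourier_deriv (f := fun y => (f y : ℂ))
        (hfs.continuous.integrable_of_hasCompactSupport hfc).ofReal
        (fun x => (hfd' x).differentiableAt) (by rw [hde]; exact i1.add i3)) ζ
      rw [derivMul, hAe, ← smul_eq_mul, ← h1, hde, hψe, hρe,
        ← fourier_comp_div (fun x => (ρ x : ℂ)) hL0]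
      simp only [Real.fourier_eq, smul_add]
      exact integral_add ((Real.fourierIntegral_convergent_iff ζ).2 i1)
        ((Real.fourierIntegral_convergent_iff ζ).2 i3)
    have iρL : Integrable fun ζ => |2 * Real.pi * (L * ζ)| ^ (2 * p) * ‖Aρ (L * ζ)‖ :=
      iρ.comp_mul_left' hL0.ne'
    -- One power of `ζ` is spent on passing to `f_x`. In the dilated term `|ζ| ≤ |Lζ|`, since `L ≥
    -- 1`, and the change of variables leaves `L⁻¹ ≤ 1`; the bound is uniform in `L`.
    calc ∫ ζ, |2 * Real.pi * ζ| ^ (1 + 2 * p) * ‖A ζ‖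
        ≤ ∫ ζ, (|2 * Real.pi * ζ| ^ (2 * p) * ‖Aψ ζ‖
            + |2 * Real.pi * (L * ζ)| ^ (2 * p) * ‖Aρ (L * ζ)‖) := by
          refine integral_mono (SchwartzProfile.integrable_weight A (by linarith))
            (iψ.add iρL) fun ζ => ?_
          beta_reduce
          rw [Real.rpow_one_add' (abs_nonneg _) (by linarith), mul_comm |_|, mul_assoc,
            ← norm_derivMul, hAd]
          have e : |2 * Real.pi * ζ| ^ (2 * p) ≤ |2 * Real.pi * (L * ζ)| ^ (2 * p) := by
            refine Real.rpow_le_rpow (abs_nonneg _) ?_ (by linarith)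
            rw [mul_left_comm, abs_mul L, abs_of_pos hL0]
            nlinarith [abs_nonneg (2 * Real.pi * ζ)]
          calc |2 * Real.pi * ζ| ^ (2 * p) * ‖Aψ ζ + Aρ (L * ζ)‖
              ≤ |2 * Real.pi * ζ| ^ (2 * p) * (‖Aψ ζ‖ + ‖Aρ (L * ζ)‖) := by
                gcongr; exact norm_add_le _ _
            _ ≤ _ := by rw [mul_add]; gcongr
      _ = (∫ ζ, |2 * Real.pi * ζ| ^ (2 * p) * ‖Aψ ζ‖)
            + L⁻¹ * ∫ ζ, |2 * Real.pi * ζ| ^ (2 * p) * ‖Aρ ζ‖ := by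
          rw [integral_add iψ iρL, Measure.integral_comp_mul_left
            (fun ζ => |2 * Real.pi * ζ| ^ (2 * p) * ‖Aρ ζ‖), abs_of_pos (inv_pos.2 hL0), smul_eq_mul]
      _ ≤ _ := by
          have : 0 ≤ ∫ ζ, |2 * Real.pi * ζ| ^ (2 * p) * ‖Aρ ζ‖ :=
            integral_nonneg fun _ => by positivity
          have h1 : L⁻¹ ≤ 1 := inv_le_one_of_one_le₀ (by linarith)
          nlinarith

end Cutoff

/-! ### L² conservation and the weighted energy inequality of one time step. -/

section Energy

/-- The Fourier transform of a real-valued `L²` function. -/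
noncomputable def fourierFun (f : L2) : ℝ → ℂ :=
  (𝓕 (toComplex f) : Lp ℂ 2 (volume : Measure ℝ))

theorem integral_coeFn_sq (f : L2) : ∫ x, f x ^ 2 = ‖f‖ ^ 2 := by
  rw [← real_inner_self_eq_norm_sq, L2.inner_def]
  refine integral_congr_ae (Filter.Eventually.of_forall fun x => ?_)
  simp [sq]

theorem integral_norm_sq_fourierFun {s : ℝ} (hs : 1 ≤ s) {f : L2} {W : ℝ → ℝ}
    (h : SobolevProfile s (fourierFun f) W) (hf : (f : ℝ → ℝ) =ᵐ[volume] W) :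
    ∫ ξ, ‖fourierFun f ξ‖ ^ 2 = ‖f‖ ^ 2 := by
  rw [← h.integral_sq hs, ← integral_coeFn_sq]
  refine integral_congr_ae ?_
  filter_upwards [hf] with x hx
  rw [hx]

/-- The scheme tested with a regular function, in terms of continuous representatives. -/
theorem cnStep_identity {p τ : ℝ} (hp : 1 / 2 ≤ p) {u₀ u₁ : L2} (hs : IsCNStep (2 * p) τ u₀ u₁)
    {W : ℝ → ℝ} (hW : SobolevProfile (1 + 2 * p) (fourierFun (midpt u₀ u₁)) W)
    (hae : (midpt u₀ u₁ : ℝ → ℝ) =ᵐ[volume] W) {G : ℝ → ℂ} {V : ℝ → ℝ}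
    (hV : SobolevProfile (1 + 2 * p) G V) :
    (∫ x, u₁ x * V x) + τ * (∫ x, W x * deriv W x * V x)
      + τ * (∫ x, (𝓕⁻ (absMul (2 * p) (fourierFun (midpt u₀ u₁))) x).re * deriv V x)
      = ∫ x, u₀ x * V x := by
  have hv := hV.memLp_fun (by linarith)
  have key := hs.2 (hv.toLp V) (hV.memHs_toLp (by linarith))
  have hvae := hv.coeFn_toLp
  have w1 : weakDeriv (fun y => (midpt u₀ u₁) y ^ 2 / 2) =ᵐ[volume] fun x => W x * deriv W x := by
    refine weakDeriv_ae_eq (hasWeakDeriv_of_hasDerivAt (V := fun x => W x ^ 2 / 2) ?_ ?_ ?_)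
    · filter_upwards [hae] with x hx
      rw [hx]
    · intro x
      refine (((hW.hasDerivAt (by linarith) x).pow 2).div_const 2).congr_deriv ?_
      simp only [Nat.cast_ofNat, Nat.add_one_sub_one, pow_one]
      ring
    · exact (hW.continuous (by linarith)).mul (hW.continuous_deriv (by linarith))
  have w2 : weakDeriv (hv.toLp V) =ᵐ[volume] deriv V :=
    weakDeriv_ae_eq (hasWeakDeriv_of_hasDerivAt hvae (hV.hasDerivAt (by linarith))
      (hV.continuous_deriv (by linarith)))
  have w3 := fracD_ae_eq (s := 1 + 2 * p) (t := 2 * p) (by linarith) (by linarith) hW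
  have e1 : ∀ u : L2, ∫ x, u x * (hv.toLp V) x = ∫ x, u x * V x := by
    intro u
    refine integral_congr_ae ?_
    filter_upwards [hvae] with x hx
    rw [hx]
  have e2 : ∫ x, weakDeriv (fun y => (midpt u₀ u₁) y ^ 2 / 2) x * (hv.toLp V) x
      = ∫ x, W x * deriv W x * V x := by
    refine integral_congr_ae ?_
    filter_upwards [hvae, w1] with x hx hy
    rw [hx, hy]
  have e3 : ∫ x, (fracD (2 * p) (midpt u₀ u₁) x).re * weakDeriv (hv.toLp V) x
      = ∫ x, (𝓕⁻ (absMul (2 * p) (fourierFun (midpt u₀ u₁))) x).re * deriv V x := by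
    refine integral_congr_ae ?_
    filter_upwards [w2, w3] with x hx hy
    rw [hx, hy]
    rfl
  rwa [e1, e1, e2, e3] at key

namespace SobolevProfile

variable {p : ℝ} {F : ℝ → ℂ} {W : ℝ → ℝ}

theorem integrable_cube (h : SobolevProfile (1 + 2 * p) F W) (hp : 1 / 2 ≤ p) :
    Integrable fun x => |W x| ^ 3 := by
  simpa using h.integrable_mul_cube hp (k := fun _ => 1) continuous_const (c := 1) (by simp)

theorem integral_convection_self (hp : 1 / 2 ≤ p) (h : SobolevProfile (1 + 2 * p) F W) :
    ∫ x, W x * deriv W x * W x = 0 := by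
  have hc := h.continuous (by linarith)
  have hd := h.continuous_deriv (by linarith)
  have i1 : Integrable fun x => W x * deriv W x * W x := by
    have h1 : Integrable fun x => W x * deriv W x :=
      (h.memLp_fun (by linarith)).integrable_mul (h.memLp_deriv (by linarith))
    exact h1.mul_bdd (c := ∫ ξ, ‖F ξ‖) hc.aestronglyMeasurable
      (Filter.Eventually.of_forall h.bounded)
  have i2 : Integrable fun x => W x ^ 3 := by
    refine (h.integrable_cube hp).mono' (Continuous.aestronglyMeasurable (by fun_prop))
      (Filter.Eventually.of_forall fun x => ?_)
    rw [norm_pow, Real.norm_eq_abs]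
  have := integral_eq_zero_of_hasDerivAt_of_integrable (f := fun x => W x ^ 3)
    (f' := fun x => 3 * (W x * deriv W x * W x)) (fun x => by
      refine ((h.hasDerivAt (by linarith) x).pow 3).congr_deriv ?_
      simp only [Nat.cast_ofNat, Nat.add_one_sub_one]
      ring) (i1.const_mul 3) i2
  rw [integral_const_mul] at this
  linarith

/-- By Plancherel the density is `|2πξ|^{2p} · 2πξ · |F|²` times `-i`, so its real part vanishes
pointwise. -/
theorem integral_dispersion_self (hp : 1 / 2 ≤ p) (h : SobolevProfile (1 + 2 * p) F W) :
    ∫ x, (𝓕⁻ (absMul (2 * p) F) x).re * deriv W x = 0 := by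
  have i1 := h.integrable_absMul (t := 2 * p) (by linarith) (by linarith)
  have i2 := h.memLp_absMul (t := 2 * p) (by linarith) (by linarith)
  have i3 := h.integrable_derivMul (by linarith)
  have i4 := h.memLp_derivMul (by linarith)
  have e1 : ∀ x, (𝓕⁻ (absMul (2 * p) F) x).re * deriv W x
      = Complex.reCLM (𝓕⁻ (absMul (2 * p) F) x * starRingEnd ℂ (𝓕⁻ (derivMul F) x)) := by
    intro x
    rw [← h.deriv_eq (by linarith), Complex.conj_ofReal]
    simp
  have hc : MemLp (fun x => starRingEnd ℂ (𝓕⁻ (derivMul F) x)) 2 volume :=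
    (memLp_fourierInv i3 i4).star
  have hc' : MemLp (fun x => starRingEnd ℂ (derivMul F x)) 2 volume := i4.star
  have j1 : Integrable fun x => 𝓕⁻ (absMul (2 * p) F) x * starRingEnd ℂ (𝓕⁻ (derivMul F) x) :=
    (memLp_fourierInv i1 i2).integrable_mul hc
  have j2 : Integrable fun ξ => absMul (2 * p) F ξ * starRingEnd ℂ (derivMul F ξ) :=
    i2.integrable_mul hc'
  simp only [e1]
  rw [ContinuousLinearMap.integral_comp_comm _ j1, integral_fourierInv_mul_conj i1 i2 i3 i4,
    ← ContinuousLinearMap.integral_comp_comm _ j2]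
  refine integral_eq_zero_of_ae (Filter.Eventually.of_forall fun ξ => ?_)
  have e : absMul (2 * p) F ξ * starRingEnd ℂ (derivMul F ξ)
      = ((-(|2 * Real.pi * ξ| ^ (2 * p) * (2 * Real.pi * ξ) * Complex.normSq (F ξ)) : ℝ) : ℂ)
        * Complex.I := by
    simp only [absMul, derivMul, map_mul, Complex.conj_ofReal, Complex.conj_I, map_ofNat]
    push_cast
    rw [Complex.normSq_eq_conj_mul_self]
    ring
  beta_reduce
  rw [e, Complex.reCLM_apply, Complex.re_ofReal_mul, Complex.I_re, mul_zero]
  rfl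

/-- Integrate `(f W³)_x = f_x W³ + 3 f W² W_x`; compact support of `f` removes the boundary terms.
-/
theorem integral_convection_mul (hp : 1 / 2 ≤ p) (h : SobolevProfile (1 + 2 * p) F W)
    {f : ℝ → ℝ} (hf : ContDiff ℝ ∞ f) (hfc : HasCompactSupport f) :
    ∫ x, W x * deriv W x * (f x * W x) = -(1 / 3) * ∫ x, deriv f x * W x ^ 3 := by
  have hc := h.continuous (by linarith)
  have hd := h.continuous_deriv (by linarith)
  have hfd : Continuous (deriv f) := hf.continuous_deriv (by simp)
  have hfc0 := hf.continuous
  have i1 : Integrable fun x => W x * deriv W x * (f x * W x) :=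
    Continuous.integrable_of_hasCompactSupport (by fun_prop) (hfc.mul_right.mul_left)
  have i2 : Integrable fun x => deriv f x * W x ^ 3 :=
    Continuous.integrable_of_hasCompactSupport (by fun_prop) hfc.deriv.mul_right
  have i3 : Integrable fun x => f x * W x ^ 3 :=
    Continuous.integrable_of_hasCompactSupport (by fun_prop) hfc.mul_right
  have := integral_eq_zero_of_hasDerivAt_of_integrable (f := fun x => f x * W x ^ 3)
    (f' := fun x => deriv f x * W x ^ 3 + 3 * (W x * deriv W x * (f x * W x))) (fun x => by
      refine ((hf.differentiable (by simp) x).hasDerivAt.mul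
        ((h.hasDerivAt (by linarith) x).pow 3)).congr_deriv ?_
      simp only [Nat.cast_ofNat, Nat.add_one_sub_one, Pi.pow_apply]
      ring) (i2.add (i1.const_mul 3)) i3
  rw [integral_add i2 (i1.const_mul 3), integral_const_mul] at this
  linarith

end SobolevProfile

theorem coeFn_midpt (f g : L2) :
    (midpt f g : ℝ → ℝ) =ᵐ[volume] fun x => (1 / 2 : ℝ) * (f x + g x) := by
  filter_upwards [Lp.coeFn_smul (1 / 2 : ℝ) (f + g), Lp.coeFn_add f g] with x h1 h2
  rw [midpt, h1, Pi.smul_apply, h2, Pi.add_apply, smul_eq_mul]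

/-- The scheme conserves the `L²` norm. -/
theorem norm_eq_of_cnStep {p τ : ℝ} (hp : 1 / 2 ≤ p) {u₀ u₁ : L2}
    (hs : IsCNStep (2 * p) τ u₀ u₁) : ‖u₁‖ = ‖u₀‖ := by
  obtain ⟨W, hW, hae⟩ := exists_sobolevProfile (by linarith) hs.1
  -- The midpoint is its own test function: `⟨u₁ - u₀, (u₀ + u₁)/2⟩` is half the difference of the
  -- squared norms.
  have key := cnStep_identity hp hs hW hae hW
  have z1 := hW.integral_convection_self hp
  have z2 := hW.integral_dispersion_self hp
  have e : ∀ u : L2, ∫ x, u x * W x = inner ℝ u (midpt u₀ u₁) := by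
    intro u
    rw [L2.inner_def]
    refine integral_congr_ae ?_
    filter_upwards [hae] with x hx
    rw [hx]
    simp [mul_comm]
  change _ + τ * (∫ x, (𝓕⁻ (absMul (2 * p)
    (𝓕 (toComplex (midpt u₀ u₁)) : Lp ℂ 2 (volume : Measure ℝ))) x).re * deriv W x) = _ at key
  rw [z1, z2, e, e, midpt, real_inner_smul_right, real_inner_smul_right, inner_add_right,
    inner_add_right, real_inner_self_eq_norm_sq, real_inner_self_eq_norm_sq,
    real_inner_comm u₀ u₁] at key
  have h2 : ‖u₁‖ ^ 2 = ‖u₀‖ ^ 2 := by linarith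
  exact (sq_eq_sq₀ (norm_nonneg _) (norm_nonneg _)).1 h2

theorem norm_midpt_le (f g : L2) : ‖midpt f g‖ ≤ (‖f‖ + ‖g‖) / 2 := by
  rw [midpt, norm_smul]
  have := norm_add_le f g
  norm_num
  linarith

theorem integrable_bdd_mul_mul {f : ℝ → ℝ} (hf : Continuous f) {c : ℝ} (hfb : ∀ x, ‖f x‖ ≤ c)
    (u v : L2) : Integrable fun x => f x * (u x * v x) :=
  ((Lp.memLp u).integrable_mul (Lp.memLp v)).bdd_mul (c := c) hf.aestronglyMeasurable
    (Filter.Eventually.of_forall hfb)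

/-- The energy inequality of one step, tested with a compactly supported cut-off `f` which is
close to the cut-off `φ`. -/
theorem cnStep_energy_le {p τ R : ℝ} (hp : 1 / 2 ≤ p) (hp1 : p < 1) (hτ : 0 < τ) {u₀ u₁ : L2}
    (hs : IsCNStep (2 * p) τ u₀ u₁) {φ : ℝ → ℝ} (hφ : IsCutoff R φ) {B : SchwartzMap ℝ ℂ}
    (hB : SchwartzProfile B fun x => Real.sqrt (deriv φ x)) {f : ℝ → ℝ} {A : SchwartzMap ℝ ℂ}
    (hf : ContDiff ℝ ∞ f) (hfc : HasCompactSupport f) (hA : SchwartzProfile A f) {ε N M : ℝ}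
    (hfφ : ∀ x, |deriv f x - deriv φ x| ≤ ε)
    (hN : ∫ ζ, |2 * Real.pi * ζ| ^ (1 + 2 * p) * ‖A ζ‖ ≤ N) (hM : ‖u₀‖ ≤ M) :
    τ * (∫ x, deriv φ x * ‖fracD p (midpt u₀ u₁) x‖ ^ 2)
      ≤ (∫ x, f x * u₀ x ^ 2) - (∫ x, f x * u₁ x ^ 2)
        + τ * (128 * N * M ^ 2 + 2 * M * (1 + M)
          * (M ^ 2 + 2 * (∫ ζ, |2 * Real.pi * ζ| ^ p * ‖B ζ‖) ^ 2 * M ^ 2))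
        + ε * (τ * (3 * (∫ x, ‖fracD p (midpt u₀ u₁) x‖ ^ 2) + ∫ x, |midpt u₀ u₁ x| ^ 3)) := by
  obtain ⟨W, hW', hae⟩ := exists_sobolevProfile (by linarith) hs.1
  have hW : SobolevProfile (1 + 2 * p) (fourierFun (midpt u₀ u₁)) W := hW'
  set w := midpt u₀ u₁ with hw
  set F := fourierFun w with hF
  have hM0 : 0 ≤ M := (norm_nonneg _).trans hM
  have hε : 0 ≤ ε := (abs_nonneg _).trans (hfφ 0)
  have hwM : ‖w‖ ≤ M := by
    refine (norm_midpt_le u₀ u₁).trans ?_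
    rw [norm_eq_of_cnStep hp hs]; linarith
  have hFM : ∫ ξ, ‖F ξ‖ ^ 2 ≤ M ^ 2 := by
    rw [integral_norm_sq_fourierFun (by linarith) hW hae]
    gcongr
  have hV := hW.mul (by linarith) A hA.inv
  have key := cnStep_identity hp hs hW hae hV
  rw [hW.integral_convection_mul hp hf hfc] at key
  have hdiff : Differentiable ℝ f := hf.differentiable (by simp)
  have kato := hW.abs_dispersion_sub_smoothing_le hp hp1 hA hdiff
  set J := ∫ x, (𝓕⁻ (absMul (2 * p) F) x).re * deriv (fun y => f y * W y) x with hJ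
  set d := 𝓕⁻ (absMul p F) with hd
  have hdae : (fracD p w : ℝ → ℂ) =ᵐ[volume] d := fracD_ae_eq (by linarith) (by linarith) hW'
  have e1 : ∫ x, deriv φ x * ‖fracD p w x‖ ^ 2 = ∫ x, deriv φ x * ‖d x‖ ^ 2 := by
    refine integral_congr_ae ?_
    filter_upwards [hdae] with x hx
    rw [hx]
  have e2 : ∫ x, ‖fracD p w x‖ ^ 2 = ∫ x, ‖d x‖ ^ 2 := by
    refine integral_congr_ae ?_
    filter_upwards [hdae] with x hx
    rw [hx]
  have e3 : ∫ x, |w x| ^ 3 = ∫ x, |W x| ^ 3 := by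
    refine integral_congr_ae ?_
    filter_upwards [hae] with x hx
    rw [hx]
  rw [e1, e2, e3]
  have ld : MemLp d 2 volume := memLp_fourierInv
    (hW.integrable_absMul (by linarith) (by linarith))
    (hW.memLp_absMul (by linarith) (by linarith))
  have sd := (memLp_two_iff_integrable_sq_norm ld.1).1 ld
  have hψc : Continuous (deriv φ) := hφ.contDiff_deriv.continuous
  have hfdc : Continuous (deriv f) := hf.continuous_deriv (by simp)
  have hψb : ∀ x, ‖deriv φ x‖ ≤ 1 := fun x => by
    rw [Real.norm_eq_abs, abs_of_nonneg (hφ.deriv_nonneg x)]; exact hφ.deriv_le_one x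
  have hfdb : ∀ x, ‖deriv f x‖ ≤ 1 + ε := fun x => by
    have h1 := hfφ x
    have h2 := hψb x
    rw [Real.norm_eq_abs] at h2 ⊢
    rw [abs_le] at *
    constructor <;> linarith [h1.1, h1.2, h2.1, h2.2]
  have iψd : Integrable fun x => deriv φ x * ‖d x‖ ^ 2 :=
    sd.bdd_mul (c := 1) hψc.aestronglyMeasurable (Filter.Eventually.of_forall hψb)
  have ifd : Integrable fun x => deriv f x * ‖d x‖ ^ 2 :=
    sd.bdd_mul (c := 1 + ε) hfdc.aestronglyMeasurable (Filter.Eventually.of_forall hfdb)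
  have iψW : Integrable fun x => deriv φ x * |W x| ^ 3 := hW.integrable_mul_cube hp hψc hψb
  have iW3 := hW.integrable_cube hp
  have hWc := hW.continuous (by linarith)
  have ifW : Integrable fun x => deriv f x * W x ^ 3 :=
    Continuous.integrable_of_hasCompactSupport (by fun_prop) hfc.deriv.mul_right
  have b1 : (∫ x, deriv φ x * ‖d x‖ ^ 2) - ε * (∫ x, ‖d x‖ ^ 2)
      ≤ ∫ x, deriv f x * ‖d x‖ ^ 2 := by
    rw [← integral_const_mul, ← integral_sub iψd (sd.const_mul ε)]
    refine integral_mono (iψd.sub (sd.const_mul ε)) ifd fun x => ?_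
    have := (abs_le.1 (hfφ x)).1
    beta_reduce
    rw [← sub_mul]
    gcongr
    linarith
  have b2 : ∫ x, deriv f x * W x ^ 3
      ≤ (∫ x, deriv φ x * |W x| ^ 3) + ε * ∫ x, |W x| ^ 3 := by
    rw [← integral_const_mul, ← integral_add iψW (iW3.const_mul ε)]
    refine integral_mono ifW (iψW.add (iW3.const_mul ε)) fun x => ?_
    beta_reduce
    rw [← add_mul]
    have h1 := (abs_le.1 (hfφ x)).2
    have h3 : |deriv f x| ≤ deriv φ x + ε := by
      rw [abs_le]
      constructor
      · linarith [(abs_le.1 (hfφ x)).1, hφ.deriv_nonneg x]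
      · linarith
    calc deriv f x * W x ^ 3 ≤ |deriv f x * W x ^ 3| := le_abs_self _
      _ = |deriv f x| * |W x| ^ 3 := by rw [abs_mul, abs_pow]
      _ ≤ _ := by gcongr
  have cubic := hW.integral_sq_mul_cube_le hp hp1.le hB hφ.sqrt_smooth.continuous (fun x => by
    rw [abs_of_nonneg (Real.sqrt_nonneg _), Real.sqrt_le_one]
    exact hφ.deriv_le_one x) hM0 hFM
  simp only [Real.sq_sqrt (hφ.deriv_nonneg _)] at cubic
  set X := ∫ x, deriv φ x * ‖d x‖ ^ 2 with hX
  have hX0 : 0 ≤ X := integral_nonneg fun x => mul_nonneg (hφ.deriv_nonneg x) (sq_nonneg _)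
  have hD0 : 0 ≤ ∫ x, ‖d x‖ ^ 2 := integral_nonneg fun _ => by positivity
  have hfb := hfc.exists_bound_of_continuous hf.continuous
  obtain ⟨c, hc⟩ := hfb
  -- Taken at `u₁` and `u₀` and subtracted, the mixed products cancel and leave `(1/2)(∫ f u₁² - ∫ f
  -- u₀²)`.
  have mass : ∀ u : L2, ∫ x, u x * (f x * W x)
      = (1 / 2) * (∫ x, f x * (u x * u₀ x)) + (1 / 2) * ∫ x, f x * (u x * u₁ x) := by
    intro u
    rw [← integral_const_mul, ← integral_const_mul, ← integral_add
      ((integrable_bdd_mul_mul hf.continuous hc u u₀).const_mul _)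
      ((integrable_bdd_mul_mul hf.continuous hc u u₁).const_mul _)]
    refine integral_congr_ae ?_
    filter_upwards [hae, coeFn_midpt u₀ u₁] with x hx hy
    rw [← hx, hw, hy]
    ring
  have sym : ∫ x, f x * (u₁ x * u₀ x) = ∫ x, f x * (u₀ x * u₁ x) :=
    integral_congr_ae (Filter.Eventually.of_forall fun x => by simp only [mul_comm (u₁ x)])
  rw [mass, mass, sym] at key
  simp only [← sq] at key
  have hNM : 64 * (∫ ζ, |2 * Real.pi * ζ| ^ (1 + 2 * p) * ‖A ζ‖) * ∫ ξ, ‖F ξ‖ ^ 2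
      ≤ 64 * N * M ^ 2 := by
    have n1 : 0 ≤ ∫ ζ, |2 * Real.pi * ζ| ^ (1 + 2 * p) * ‖A ζ‖ :=
      integral_nonneg fun _ => by positivity
    have n2 : 0 ≤ ∫ ξ, ‖F ξ‖ ^ 2 := integral_nonneg fun _ => by positivity
    have : 0 ≤ N := n1.trans hN
    gcongr
  have k1 := (abs_le.1 (kato.trans hNM)).1
  -- The factor `(1+2p)/2` is at least 1, used for the good term, and at most `3/2`, used for the
  -- error.
  have b3 : X - 3 / 2 * ε * (∫ x, ‖d x‖ ^ 2)
      ≤ (1 + 2 * p) / 2 * ∫ x, deriv f x * ‖d x‖ ^ 2 := by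
    have h1 : (1 + 2 * p) / 2 * (X - ε * ∫ x, ‖d x‖ ^ 2)
        ≤ (1 + 2 * p) / 2 * ∫ x, deriv f x * ‖d x‖ ^ 2 :=
      mul_le_mul_of_nonneg_left b1 (by linarith)
    have h2 : 1 * X ≤ (1 + 2 * p) / 2 * X := mul_le_mul_of_nonneg_right (by linarith) hX0
    have h3 : (1 + 2 * p) / 2 * (ε * ∫ x, ‖d x‖ ^ 2) ≤ 3 / 2 * (ε * ∫ x, ‖d x‖ ^ 2) :=
      mul_le_mul_of_nonneg_right (by linarith) (by positivity)
    linarith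
  -- Convection contributes at most `(1/3)(3/2) X = X/2` to the right-hand side; that half has been
  -- moved to the left.
  have main : X / 2 ≤ J - 1 / 3 * (∫ x, deriv f x * W x ^ 3) + 64 * N * M ^ 2
      + M * (1 + M) * (M ^ 2 + 2 * (∫ ζ, |2 * Real.pi * ζ| ^ p * ‖B ζ‖) ^ 2 * M ^ 2)
      + 3 / 2 * ε * (∫ x, ‖d x‖ ^ 2) + 1 / 3 * ε * ∫ x, |W x| ^ 3 := by
    linarith
  have hW30 : 0 ≤ ∫ x, |W x| ^ 3 := integral_nonneg fun _ => by positivity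
  have h4 : 0 ≤ ε * ∫ x, |W x| ^ 3 := mul_nonneg hε hW30
  have main2 : X ≤ 2 * (J - 1 / 3 * (∫ x, deriv f x * W x ^ 3)) + (128 * N * M ^ 2 + 2 * M * (1 + M)
          * (M ^ 2 + 2 * (∫ ζ, |2 * Real.pi * ζ| ^ p * ‖B ζ‖) ^ 2 * M ^ 2))
        + ε * (3 * (∫ x, ‖d x‖ ^ 2) + ∫ x, |W x| ^ 3) := by
    linarith
  have main3 := mul_le_mul_of_nonneg_left main2 hτ.le
  linarith

end Energy

/-! ### The Gagliardo seminorm in terms of the fractional derivative. -/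

section Gagliardo

/-- Near the origin the integrand is `|t|^{1-2p}`, integrable as `p < 1`; at infinity it is a
multiple of `|t|^{-1-2p}`, integrable as `p > 0`. The negative half-line follows by evenness. -/
theorem integrable_min_mul_rpow {p : ℝ} (hp : 0 < p) (hp1 : p < 1) :
    Integrable fun t : ℝ => min 4 (t ^ 2) * |t| ^ (-(1 + 2 * p)) := by
  set m : ℝ → ℝ := fun t => min 4 (t ^ 2) * |t| ^ (-(1 + 2 * p)) with hm
  have hmm : Measurable m := by fun_prop
  have h1 : IntegrableOn m (Set.Ioc 0 1) := by
    have hi : IntegrableOn (fun t : ℝ => t ^ (1 - 2 * p)) (Set.Ioc 0 1) :=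
      (intervalIntegrable_iff_integrableOn_Ioc_of_le zero_le_one).1
        (intervalIntegral.intervalIntegrable_rpow' (by linarith))
    refine hi.mono' hmm.aestronglyMeasurable ((ae_restrict_iff' measurableSet_Ioc).2
      (Filter.Eventually.of_forall fun t ht => ?_))
    have ht0 : 0 < t := ht.1
    have e : t ^ (1 - 2 * p) = t ^ 2 * t ^ (-(1 + 2 * p)) := by
      rw [← Real.rpow_natCast, ← Real.rpow_add ht0]; congr 1; push_cast; ring
    rw [Real.norm_eq_abs, abs_of_nonneg (by simp only [hm]; positivity), e]
    simp only [hm, abs_of_pos ht0]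
    gcongr
    exact min_le_right _ _
  have h2 : IntegrableOn m (Set.Ioi 1) := by
    have hi := (integrableOn_Ioi_rpow_of_lt (a := -(1 + 2 * p)) (by linarith) one_pos).const_mul 4
    refine hi.mono' hmm.aestronglyMeasurable ((ae_restrict_iff' measurableSet_Ioi).2
      (Filter.Eventually.of_forall fun t ht => ?_))
    have ht0 : 0 < t := lt_trans one_pos ht
    rw [Real.norm_eq_abs, abs_of_nonneg (by simp only [hm]; positivity)]
    simp only [hm, abs_of_pos ht0]
    gcongr
    exact min_le_left _ _
  have h3 : IntegrableOn m (Set.Ioi 0) := by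
    rw [← Set.Ioc_union_Ioi_eq_Ioi zero_le_one]
    exact h1.union h2
  have h4 : IntegrableOn m (Set.Iio 0) := by
    have h5 := (Measure.measurePreserving_neg (volume : Measure ℝ)).integrableOn_comp_preimage
      (Homeomorph.neg ℝ).measurableEmbedding (f := m) (s := Set.Ioi 0)
    have e1 : m ∘ Neg.neg = m := by ext t; simp [hm]
    have e2 : (Neg.neg ⁻¹' Set.Ioi 0 : Set ℝ) = Set.Iio 0 := by ext t; simp
    rw [e1, e2] at h5
    exact h5.2 h3
  have h6 : IntegrableOn m (Set.Iio 0 ∪ Set.Ioi 0) := h4.union h3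
  rw [Set.Iio_union_Ioi] at h6
  rwa [← integrableOn_univ, integrableOn_congr_set_ae (t := {0}ᶜ)]
  exact (ae_eq_univ.2 (by simp)).symm

theorem lintegral_min_mul_rpow_scale {p a : ℝ} (hp : 0 < p) (hp1 : p < 1) (ha : 0 ≤ a) :
    ∫⁻ h : ℝ, ENNReal.ofReal (min 4 ((a * h) ^ 2) * |h| ^ (-(1 + 2 * p)))
      ≤ ENNReal.ofReal ((∫ t : ℝ, min 4 (t ^ 2) * |t| ^ (-(1 + 2 * p))) * a ^ (2 * p)) := by
  rcases eq_or_lt_of_le ha with rfl | ha0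
  · simp
  set m : ℝ → ℝ := fun t => min 4 (t ^ 2) * |t| ^ (-(1 + 2 * p)) with hm
  have hi : Integrable m := integrable_min_mul_rpow hp hp1
  have e : ∀ h : ℝ, min 4 ((a * h) ^ 2) * |h| ^ (-(1 + 2 * p)) = a ^ (1 + 2 * p) * m (a * h) := by
    intro h
    simp only [hm]
    rw [abs_mul, abs_of_pos ha0, Real.mul_rpow ha (abs_nonneg _), Real.rpow_neg ha]
    have := (Real.rpow_pos_of_pos ha0 (1 + 2 * p)).ne'
    field_simp
  simp only [e]
  have hi2 : Integrable fun h => a ^ (1 + 2 * p) * m (a * h) :=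
    (hi.comp_mul_left' ha0.ne').const_mul _
  rw [← ofReal_integral_eq_lintegral_ofReal hi2
    (Filter.Eventually.of_forall fun h => by simp only [hm]; positivity), integral_const_mul,
    Measure.integral_comp_mul_left m a, abs_of_pos (inv_pos.2 ha0), smul_eq_mul]
  refine ENNReal.ofReal_le_ofReal (le_of_eq ?_)
  rw [Real.rpow_add ha0, Real.rpow_one]
  field_simp

theorem norm_one_sub_fourierChar_sq_le (y : ℝ) :
    ‖1 - (Real.fourierChar y : ℂ)‖ ^ 2 ≤ min 4 ((|2 * Real.pi * y|) ^ 2) := by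
  refine le_min ?_ ?_
  · have : ‖1 - (Real.fourierChar y : ℂ)‖ ≤ 2 := by
      refine (norm_sub_le _ _).trans ?_
      rw [norm_one, Circle.norm_coe]; norm_num
    nlinarith [norm_nonneg (1 - (Real.fourierChar y : ℂ))]
  · gcongr
    rw [norm_sub_rev, Real.fourierChar_apply, mul_comm _ Complex.I]
    exact Real.norm_exp_I_mul_ofReal_sub_one_le

/-- The Gagliardo seminorm is bounded by the `L²` norm of the fractional derivative. -/
theorem lintegral_gagliardo_le {p : ℝ} (hp : 1 / 2 ≤ p) (hp1 : p < 1) {G : ℝ → ℂ} {g : ℝ → ℝ}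
    (h : SobolevProfile (1 + 2 * p) G g) :
    ∫⁻ x, ∫⁻ y, ‖g x - g y‖ₑ ^ 2 / ENNReal.ofReal (|x - y| ^ (1 + 2 * p))
      ≤ ENNReal.ofReal ((∫ t : ℝ, min 4 (t ^ 2) * |t| ^ (-(1 + 2 * p)))
        * ∫ ξ, ‖absMul p G ξ‖ ^ 2) := by
  have hgc := h.continuous (by linarith)
  have hgm : Measurable g := hgc.measurable
  have hGm := h.meas
  have i1 := h.integrable (by linarith)
  have i2 := h.memLp_two (by linarith)
  have hem : Measurable fun y : ℝ => (Real.fourierChar y : ℂ) :=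
    (Continuous.comp continuous_subtype_val Real.continuous_fourierChar).measurable
  set k : ℝ → ℝ≥0∞ := fun t => (ENNReal.ofReal (|t| ^ (1 + 2 * p)))⁻¹ with hk
  have hkm : Measurable k := by fun_prop
  set c := ∫ t : ℝ, min 4 (t ^ 2) * |t| ^ (-(1 + 2 * p)) with hc
  have hc0 : 0 ≤ c := integral_nonneg fun t => by positivity
  -- Plancherel for a finite difference, which is the multiplier `1 - e^{2πiξt}`.
  have tr : ∀ t, ∫⁻ x, ‖g x - g (x + t)‖ₑ ^ 2
      = ∫⁻ ξ, ‖(1 - (Real.fourierChar (ξ * t) : ℂ)) * G ξ‖ₑ ^ 2 := by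
    intro t
    have hb : ∀ ξ, ‖1 - (Real.fourierChar (ξ * t) : ℂ)‖ ≤ 2 := fun ξ => by
      refine (norm_sub_le _ _).trans ?_
      rw [norm_one, Circle.norm_coe]; norm_num
    have hm : Measurable fun ξ => 1 - (Real.fourierChar (ξ * t) : ℂ) := by fun_prop
    have j1 : Integrable fun ξ => (1 - (Real.fourierChar (ξ * t) : ℂ)) * G ξ :=
      i1.bdd_mul (c := 2) hm.aestronglyMeasurable (Filter.Eventually.of_forall hb)
    have j2 : MemLp (fun ξ => (1 - (Real.fourierChar (ξ * t) : ℂ)) * G ξ) 2 volume := by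
      refine MemLp.of_le_mul (c := 2) i2 (hm.mul hGm).aestronglyMeasurable
        (Filter.Eventually.of_forall fun ξ => ?_)
      rw [norm_mul]
      gcongr
      exact hb ξ
    rw [lintegral_enorm_sq_eq j2, ← integral_norm_sq_fourierInv j1 j2,
      ← lintegral_enorm_sq_eq (memLp_fourierInv j1 j2)]
    refine lintegral_congr fun x => ?_
    have e : 𝓕⁻ (fun ξ => (1 - (Real.fourierChar (ξ * t) : ℂ)) * G ξ) x
        = ((g x - g (x + t) : ℝ) : ℂ) := by
      push_cast
      rw [h.inv, h.inv, Real.fourierInv_eq, Real.fourierInv_eq, Real.fourierInv_eq,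
        ← integral_sub]
      · refine integral_congr_ae (Filter.Eventually.of_forall fun ξ => ?_)
        simp only [Circle.smul_def, smul_eq_mul, inner_add_right, AddChar.map_add_eq_mul,
          Circle.coe_mul]
        have : inner ℝ ξ t = ξ * t := by simp [mul_comm]
        rw [this]
        ring
      · have := (Real.fourierIntegral_convergent_iff (-x)).2 i1
        simpa using this
      · have := (Real.fourierIntegral_convergent_iff (-(x + t))).2 i1
        simpa only [inner_neg_right, neg_neg] using this
    rw [e, ← ofReal_norm, ← ofReal_norm, Complex.norm_real]
  calc ∫⁻ x, ∫⁻ y, ‖g x - g y‖ₑ ^ 2 / ENNReal.ofReal (|x - y| ^ (1 + 2 * p))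
      = ∫⁻ x, ∫⁻ t, ‖g x - g (x + t)‖ₑ ^ 2 * k t := by
        refine lintegral_congr fun x => ?_
        rw [← lintegral_add_left_eq_self _ x]
        refine lintegral_congr fun t => ?_
        rw [sub_add_cancel_left, abs_neg, div_eq_mul_inv]
    _ = ∫⁻ t, ∫⁻ x, ‖g x - g (x + t)‖ₑ ^ 2 * k t :=
        lintegral_lintegral_swap (Measurable.aemeasurable (by fun_prop))
    _ = ∫⁻ t, ∫⁻ ξ, ‖(1 - (Real.fourierChar (ξ * t) : ℂ)) * G ξ‖ₑ ^ 2 * k t := by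
        refine lintegral_congr fun t => ?_
        rw [lintegral_mul_const _ (by fun_prop), lintegral_mul_const _ (by fun_prop), tr]
    _ = ∫⁻ ξ, ∫⁻ t, ‖(1 - (Real.fourierChar (ξ * t) : ℂ)) * G ξ‖ₑ ^ 2 * k t :=
        lintegral_lintegral_swap (Measurable.aemeasurable (by fun_prop))
    _ ≤ ∫⁻ ξ, ENNReal.ofReal (c * ‖absMul p G ξ‖ ^ 2) := by
        refine lintegral_mono fun ξ => ?_
        -- The point `t = 0`, where `k` is infinite, is excluded as a null set.
        have hpt : ∀ᵐ t : ℝ, ‖(1 - (Real.fourierChar (ξ * t) : ℂ)) * G ξ‖ₑ ^ 2 * k t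
            ≤ ‖G ξ‖ₑ ^ 2 * ENNReal.ofReal (min 4 ((|2 * Real.pi * ξ| * t) ^ 2)
              * |t| ^ (-(1 + 2 * p))) := by
          filter_upwards [Measure.ae_ne volume (0 : ℝ)] with t ht
          have ht0 : 0 < |t| ^ (1 + 2 * p) := Real.rpow_pos_of_pos (abs_pos.2 ht) _
          rw [enorm_mul, mul_pow, mul_comm (_ ^ 2) (‖G ξ‖ₑ ^ 2), mul_assoc]
          gcongr
          simp only [hk]
          rw [← ENNReal.ofReal_inv_of_pos ht0, ← ofReal_norm, ← ENNReal.ofReal_pow (norm_nonneg _),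
            ← ENNReal.ofReal_mul (by positivity), Real.rpow_neg (abs_nonneg _)]
          refine ENNReal.ofReal_le_ofReal ?_
          gcongr
          refine (norm_one_sub_fourierChar_sq_le (ξ * t)).trans_eq ?_
          rw [mul_pow |_| t, ← sq_abs t, ← mul_pow, ← abs_mul, mul_assoc _ ξ t]
        refine (lintegral_mono_ae hpt).trans ?_
        rw [lintegral_const_mul _ (by fun_prop)]
        calc _ ≤ ‖G ξ‖ₑ ^ 2 * ENNReal.ofReal (c * |2 * Real.pi * ξ| ^ (2 * p)) := by
              gcongr
              exact lintegral_min_mul_rpow_scale (by linarith) hp1 (abs_nonneg _)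
          _ = _ := by
              rw [← ofReal_norm, ← ENNReal.ofReal_pow (norm_nonneg _),
                ← ENNReal.ofReal_mul (by positivity), norm_absMul, mul_pow,
                ← Real.rpow_natCast (_ ^ p), ← Real.rpow_mul (abs_nonneg _), mul_comm p]
              congr 1
              push_cast
              ring
    _ = _ := by
        have l := h.memLp_absMul (t := p) (by linarith) (by linarith)
        have s := (memLp_two_iff_integrable_sq_norm l.1).1 l
        rw [← integral_const_mul, ofReal_integral_eq_lintegral_ofReal (s.const_mul c)
          (Filter.Eventually.of_forall fun ξ => by positivity)]

end Gagliardo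

/-- Take `φ = 1 + ∫_{-∞}^x b²` for a bump `b` equal to 1 on `[-R, R]` and vanishing for `|x| ≥ R +
1/2`. Squaring makes `√φ_x = b` smooth, and `∫ b² ≤ 2R + 1` gives the upper bound. -/
theorem exists_isCutoff {R : ℝ} (hR : 0 < R) : ∃ φ : ℝ → ℝ, IsCutoff R φ := by
  let b : ContDiffBump (0 : ℝ) := ⟨R, R + 1 / 2, hR, by linarith⟩
  have hbs : ContDiff ℝ ∞ b := b.contDiff
  have hb2c : Continuous fun t => b t ^ 2 := hbs.continuous.pow 2
  have hb2k : HasCompactSupport fun t => b t ^ 2 := by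
    have := b.hasCompactSupport.comp_left (g := fun y : ℝ => y ^ 2) (by simp)
    exact this
  have hi : Integrable fun t => b t ^ 2 := hb2c.integrable_of_hasCompactSupport hb2k
  have hb0 : ∀ t : ℝ, R + 1 / 2 ≤ |t| → b t = 0 := fun t ht =>
    b.zero_of_le_dist (by change R + 1 / 2 ≤ _; simpa using ht)
  have hb1 : ∀ t : ℝ, b t ^ 2 ≤ 1 := fun t => pow_le_one₀ b.nonneg b.le_one
  set φ : ℝ → ℝ := fun x => 1 + ∫ t in Set.Iic x, b t ^ 2 with hφ
  have hd : ∀ x, HasDerivAt φ (b x ^ 2) x := by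
    intro x
    have e : φ = fun x => (1 + ∫ t in Set.Iic 0, b t ^ 2) + ∫ t in (0 : ℝ)..x, b t ^ 2 := by
      ext y
      rw [← intervalIntegral.integral_Iic_sub_Iic hi.integrableOn hi.integrableOn]
      simp only [hφ]; ring
    rw [e]
    exact (hb2c.integral_hasStrictDerivAt 0 x).hasDerivAt.const_add _
  have hde : deriv φ = fun x => b x ^ 2 := by ext x; exact (hd x).deriv
  have hsq : (fun x => Real.sqrt (deriv φ x)) = b := by
    ext x; rw [hde]; exact Real.sqrt_sq b.nonneg
  refine ⟨φ, ?_, fun x => ?_, fun x => ?_, fun x hx => ?_, fun x hx => ?_, fun x => ?_,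
    fun x => ?_, ?_, ?_⟩
  · rw [contDiff_infty_iff_deriv, hde]
    exact ⟨fun x => (hd x).differentiableAt, hbs.pow 2⟩
  · simp only [hφ, le_add_iff_nonneg_right]
    exact integral_nonneg fun t => sq_nonneg _
  · have h1 : ∫ t in Set.Iic x, b t ^ 2 ≤ ∫ t, b t ^ 2 :=
      setIntegral_le_integral hi (Filter.Eventually.of_forall fun t => sq_nonneg _)
    have h2 : ∫ t, b t ^ 2 ≤ 2 * R + 1 := by
      rw [← setIntegral_eq_integral_of_forall_compl_eq_zero
        (s := Set.Icc (-(R + 1 / 2)) (R + 1 / 2))]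
      · calc ∫ t in Set.Icc (-(R + 1 / 2)) (R + 1 / 2), b t ^ 2
            ≤ ∫ t in Set.Icc (-(R + 1 / 2)) (R + 1 / 2), (1 : ℝ) :=
              setIntegral_mono hi.integrableOn (by simp) hb1
          _ = 2 * R + 1 := by
              rw [setIntegral_const, smul_eq_mul, mul_one, Real.volume_real_Icc_of_le (by linarith)]
              ring
      · intro t ht
        rw [hb0 t, zero_pow two_ne_zero]
        rw [Set.mem_Icc, ← abs_le, not_le] at ht
        exact ht.le
    simp only [hφ]
    linarith
  · rw [hde]
    beta_reduce
    rw [b.one_of_mem_closedBall (by change x ∈ Metric.closedBall 0 R; simpa using hx.le), one_pow]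
  · rw [hde]
    beta_reduce
    rw [hb0 x (by linarith), zero_pow two_ne_zero]
  · rw [hde]; exact sq_nonneg _
  · rw [hde]; exact hb1 x
  · rw [hsq]; exact hbs
  · rw [hsq]; exact b.hasCompactSupport

/-! ### Summation over the time steps and the local Sobolev norm. -/

section Summation

theorem norm_eq_of_cnSolution {p τ : ℝ} (hp : 1 / 2 ≤ p) {N : ℕ} {u : ℕ → L2}
    (hu : IsCNSolution (2 * p) τ N u) : ∀ n ≤ N, ‖u n‖ = ‖u 0‖
  | 0, _ => rfl
  | n + 1, hn => by
    rw [norm_eq_of_cnStep hp (hu n hn), norm_eq_of_cnSolution hp hu n (by omega)]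

/-- The local smoothing estimate. -/
theorem exists_smoothing_bound {p R : ℝ} (hp : 1 / 2 ≤ p) (hp1 : p < 1) (hR : 0 < R) {φ : ℝ → ℝ}
    (hφ : IsCutoff R φ) :
    ∃ C : ℝ → ℝ, (∀ M, 0 ≤ M → 0 ≤ C M) ∧ ∀ τ : ℝ, 0 < τ → ∀ (N : ℕ) (u : ℕ → L2),
      IsCNSolution (2 * p) τ N u → ∀ m ≤ N,
        τ * ∑ n ∈ Finset.range m, ∫ x, deriv φ x * ‖fracD p (midpt (u n) (u (n + 1))) x‖ ^ 2
          ≤ C ‖u 0‖ * (1 + m * τ) := by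
  obtain ⟨K, N₀, hcut⟩ := exists_compact_cutoff hR hφ (p := p) (by linarith)
  obtain ⟨B, hB, -⟩ := exists_schwartzProfile hφ.sqrt_smooth hφ.sqrt_compact
  have hN₀ : 0 ≤ N₀ := by
    obtain ⟨_, A, -, -, -, -, -, h⟩ := hcut (R + 1) le_rfl
    exact le_trans (integral_nonneg fun _ => by positivity) h
  set Q := ∫ ζ, |2 * Real.pi * ζ| ^ p * ‖B ζ‖ with hQ
  set C' : ℝ → ℝ := fun M => 128 * N₀ * M ^ 2 + 2 * M * (1 + M) * (M ^ 2 + 2 * Q ^ 2 * M ^ 2)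
    with hC'
  have hC'0 : ∀ M, 0 ≤ M → 0 ≤ C' M := fun M hM => by simp only [hC']; positivity
  refine ⟨fun M => (2 + 2 * R) * M ^ 2 + C' M, fun M hM => ?_, fun τ hτ N u hu m hm => ?_⟩
  · have := hC'0 M hM
    positivity
  set M := ‖u 0‖ with hM
  have hM0 : 0 ≤ M := norm_nonneg _
  set X : ℕ → ℝ := fun n => ∫ x, deriv φ x * ‖fracD p (midpt (u n) (u (n + 1))) x‖ ^ 2 with hX
  -- These global quantities are not bounded in terms of `‖u 0‖` here. For a fixed solution they do
  -- not depend on `L`, so the prefactor `K/L` removes them in the limit.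
  set S : ℝ := ∑ n ∈ Finset.range m, τ * (3 * (∫ x, ‖fracD p (midpt (u n) (u (n + 1))) x‖ ^ 2)
    + ∫ x, |midpt (u n) (u (n + 1)) x| ^ 3) with hS
  have step : ∀ L, R + 1 ≤ L → τ * ∑ n ∈ Finset.range m, X n
      ≤ (2 + 2 * R) * M ^ 2 + m * (τ * C' M) + K * S * L⁻¹ := by
    intro L hL
    obtain ⟨f, A, hf, hfc, hA, hf01, hfφ, hAN⟩ := hcut L hL
    have h1 : ∀ n ∈ Finset.range m, τ * X n ≤ ((∫ x, f x * u n x ^ 2)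
        - ∫ x, f x * u (n + 1) x ^ 2) + τ * C' M
        + K / L * (τ * (3 * (∫ x, ‖fracD p (midpt (u n) (u (n + 1))) x‖ ^ 2)
          + ∫ x, |midpt (u n) (u (n + 1)) x| ^ 3)) := by
      intro n hn
      rw [Finset.mem_range] at hn
      exact cnStep_energy_le hp hp1 hτ (hu n (by omega)) hφ hB hf hfc hA hfφ hAN
        (norm_eq_of_cnSolution hp hu n (by omega)).le
    have h2 := Finset.sum_le_sum h1
    rw [← Finset.mul_sum, Finset.sum_add_distrib, Finset.sum_add_distrib,
      Finset.sum_range_sub' (fun n => ∫ x, f x * u n x ^ 2), Finset.sum_const, Finset.card_range,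
      nsmul_eq_mul, ← Finset.mul_sum] at h2
    -- After telescoping, the terminal mass has a favourable sign and is dropped.
    have h3 : 0 ≤ ∫ x, f x * u m x ^ 2 :=
      integral_nonneg fun x => mul_nonneg (hf01 x).1 (sq_nonneg _)
    have h4 : ∫ x, f x * u 0 x ^ 2 ≤ (2 + 2 * R) * M ^ 2 := by
      rw [hM, ← integral_coeFn_sq, ← integral_const_mul]
      have hi := (Lp.memLp (u 0)).integrable_sq
      refine integral_mono (hi.bdd_mul (c := 2 + 2 * R) hf.continuous.aestronglyMeasurable
        (Filter.Eventually.of_forall fun x => ?_)) (hi.const_mul _) fun x => ?_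
      · rw [Real.norm_eq_abs, abs_of_nonneg (hf01 x).1]; exact (hf01 x).2
      · exact mul_le_mul_of_nonneg_right (hf01 x).2 (sq_nonneg _)
    have h5 : K / L * S = K * S * L⁻¹ := by ring
    rw [← hS, h5] at h2
    linarith
  have lim : Filter.Tendsto (fun L : ℝ => (2 + 2 * R) * M ^ 2 + m * (τ * C' M) + K * S * L⁻¹)
      Filter.atTop (nhds ((2 + 2 * R) * M ^ 2 + m * (τ * C' M) + K * S * 0)) :=
    tendsto_const_nhds.add (tendsto_const_nhds.mul tendsto_inv_atTop_zero)
  have fin := ge_of_tendsto lim (Filter.eventually_atTop.2 ⟨R + 1, step⟩)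
  have h6 := hC'0 M hM0
  have h7 : 0 ≤ (m : ℝ) * τ := by positivity
  have h8 : 0 ≤ (2 + 2 * R) * M ^ 2 * (m * τ) := by positivity
  beta_reduce
  linarith

theorem integrable_bdd_mul_norm_sq {k : ℝ → ℝ} (hk : Continuous k) {c : ℝ}
    (hkb : ∀ x, ‖k x‖ ≤ c) (d : Lp ℂ 2 (volume : Measure ℝ)) :
    Integrable fun x => k x * ‖d x‖ ^ 2 :=
  ((memLp_two_iff_integrable_sq_norm (Lp.memLp d).1).1 (Lp.memLp d)).bdd_mul (c := c)
    hk.aestronglyMeasurable (Filter.Eventually.of_forall hkb)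

theorem lintegral_smoothing_eq {R : ℝ} {φ : ℝ → ℝ} (hφ : IsCutoff R φ)
    (d : Lp ℂ 2 (volume : Measure ℝ)) :
    ∫⁻ x, ENNReal.ofReal (deriv φ x) * ‖d x‖ₑ ^ 2
      = ENNReal.ofReal (∫ x, deriv φ x * ‖d x‖ ^ 2) := by
  rw [ofReal_integral_eq_lintegral_ofReal
    (integrable_bdd_mul_norm_sq hφ.contDiff_deriv.continuous (c := 1) (fun x => by
      rw [Real.norm_eq_abs, abs_of_nonneg (hφ.deriv_nonneg x)]; exact hφ.deriv_le_one x) d)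
    (Filter.Eventually.of_forall fun x => mul_nonneg (hφ.deriv_nonneg x) (sq_nonneg _))]
  refine lintegral_congr fun x => ?_
  rw [ENNReal.ofReal_mul (hφ.deriv_nonneg x), ENNReal.ofReal_pow (norm_nonneg _), ofReal_norm]

/-- The local Sobolev norm is bounded by the localized fractional derivative. -/
theorem exists_hsNormSqOn_le {p R : ℝ} (hp : 1 / 2 ≤ p) (hp1 : p < 1) {φ : ℝ → ℝ}
    (hφ : IsCutoff R φ) :
    ∃ c₁ c₂ : ℝ, 0 ≤ c₁ ∧ 0 ≤ c₂ ∧ ∀ w : L2, MemHs (1 + 2 * p) w →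
      hsNormSqOn p (Set.Icc (-R) R) w
        ≤ ENNReal.ofReal (c₁ * ‖w‖ ^ 2 + c₂ * ∫ x, deriv φ x * ‖fracD p w x‖ ^ 2) := by
  obtain ⟨B, hB, -⟩ := exists_schwartzProfile hφ.sqrt_smooth hφ.sqrt_compact
  set Q := ∫ ζ, |2 * Real.pi * ζ| ^ p * ‖B ζ‖ with hQ
  set c := ∫ t : ℝ, min 4 (t ^ 2) * |t| ^ (-(1 + 2 * p)) with hc
  have hc0 : 0 ≤ c := integral_nonneg fun t => by positivity
  refine ⟨1 + c * (2 * Q ^ 2), c * 2, by positivity, by positivity, fun w hw => ?_⟩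
  obtain ⟨W, hW', hae⟩ := exists_sobolevProfile (by linarith) hw
  have hW : SobolevProfile (1 + 2 * p) (fourierFun w) W := hW'
  have hV := hW.mul (by linarith) B hB.inv
  have hd : (fracD p w : ℝ → ℂ) =ᵐ[volume] 𝓕⁻ (absMul p (fourierFun w)) :=
    fracD_ae_eq (by linarith) (by linarith) hW'
  have hX : ∫ x, deriv φ x * ‖fracD p w x‖ ^ 2
      = ∫ x, Real.sqrt (deriv φ x) ^ 2 * ‖𝓕⁻ (absMul p (fourierFun w)) x‖ ^ 2 := by
    refine integral_congr_ae ?_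
    filter_upwards [hd] with x hx
    rw [hx, Real.sq_sqrt (hφ.deriv_nonneg x)]
  have h1 := lintegral_gagliardo_le hp hp1 hV
  have h2 := hW.integral_absMul_cv_le hp hp1.le hB
  rw [← hX, integral_norm_sq_fourierFun (by linarith) hW hae] at h2
  -- Only `|x| < R` guarantees `φ_x = 1`; the endpoints are null.
  have hS : ∀ᵐ x ∂(volume.restrict (Set.Icc (-R) R)),
      w x = Real.sqrt (deriv φ x) * W x := by
    rw [← restrict_Ioo_eq_restrict_Icc, ae_restrict_iff' measurableSet_Ioo]
    filter_upwards [hae] with x hx hxR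
    rw [hφ.deriv_eq_one x (abs_lt.2 hxR), Real.sqrt_one, one_mul, hx]
  have h3 : ∫⁻ x in Set.Icc (-R) R, ‖w x‖ₑ ^ 2 ≤ ENNReal.ofReal (‖w‖ ^ 2) := by
    refine (setLIntegral_le_lintegral _ _).trans (le_of_eq ?_)
    rw [← integral_coeFn_sq, ofReal_integral_eq_lintegral_ofReal (Lp.memLp w).integrable_sq
      (Filter.Eventually.of_forall fun _ => sq_nonneg _)]
    refine lintegral_congr fun x => ?_
    rw [← ofReal_norm, ← ENNReal.ofReal_pow (norm_nonneg _), Real.norm_eq_abs, sq_abs]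
  have h4 : ∫⁻ x in Set.Icc (-R) R, ∫⁻ y in Set.Icc (-R) R,
      ‖w x - w y‖ₑ ^ 2 / ENNReal.ofReal (|x - y| ^ (1 + 2 * p))
      ≤ ENNReal.ofReal (c * ∫ ξ, ‖absMul p (cv B (fourierFun w)) ξ‖ ^ 2) := by
    -- On the square, `w` may be replaced by `χW`; enlarging the domain to the whole plane then
    -- makes the Fourier bound available.
    refine le_trans ?_ h1
    calc _ = ∫⁻ x in Set.Icc (-R) R, ∫⁻ y in Set.Icc (-R) R,
          ‖Real.sqrt (deriv φ x) * W x - Real.sqrt (deriv φ y) * W y‖ₑ ^ 2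
            / ENNReal.ofReal (|x - y| ^ (1 + 2 * p)) := by
          refine lintegral_congr_ae ?_
          filter_upwards [hS] with x hx
          refine lintegral_congr_ae ?_
          filter_upwards [hS] with y hy
          rw [hx, hy]
      _ ≤ ∫⁻ x in Set.Icc (-R) R, ∫⁻ y,
          ‖Real.sqrt (deriv φ x) * W x - Real.sqrt (deriv φ y) * W y‖ₑ ^ 2
            / ENNReal.ofReal (|x - y| ^ (1 + 2 * p)) :=
          lintegral_mono fun x => setLIntegral_le_lintegral _ _
      _ ≤ _ := setLIntegral_le_lintegral _ _
  rw [hsNormSqOn]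
  have n2 : 0 ≤ ∫ ξ, ‖absMul p (cv B (fourierFun w)) ξ‖ ^ 2 :=
    integral_nonneg fun _ => by positivity
  refine (add_le_add h3 h4).trans ?_
  rw [← ENNReal.ofReal_add (by positivity) (by positivity)]
  refine ENNReal.ofReal_le_ofReal ?_
  have h5 := mul_le_mul_of_nonneg_left h2 hc0
  linarith

end Summation

/-! ### The two estimates of the theorem. -/

theorem mainTheorem5 (α : ℝ) (hα : 1 ≤ α) (hα' : α < 2) (R : ℝ) (hR : 0 < R) :
    (∃ C : ℝ → ℝ, ∀ (τ : ℝ), 0 < τ → ∀ (N : ℕ) (u : ℕ → L2), IsCNSolution α τ N u →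
      ∀ m ≤ N,
        (∀ n < m, MemHsOn (α / 2) (Set.Icc (-R) R) (midpt (u n) (u (n + 1)))) ∧
        ENNReal.ofReal τ * ∑ n ∈ Finset.range m,
            hsNormSqOn (α / 2) (Set.Icc (-R) R) (midpt (u n) (u (n + 1)))
          ≤ ENNReal.ofReal (C ‖u 0‖ * (1 + m * τ))) ∧
    (∀ φ : ℝ → ℝ, IsCutoff R φ →
      ∃ C : ℝ → ℝ, ∀ (τ : ℝ), 0 < τ → ∀ (N : ℕ) (u : ℕ → L2), IsCNSolution α τ N u →
        ∀ m ≤ N,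
          ENNReal.ofReal τ * ∑ n ∈ Finset.range m,
              ∫⁻ x, ENNReal.ofReal (deriv φ x)
                * ‖fracD (α / 2) (midpt (u n) (u (n + 1))) x‖ₑ ^ 2
            ≤ ENNReal.ofReal (C ‖u 0‖ * (1 + m * τ))) := by
  obtain ⟨p, rfl⟩ : ∃ p, α = 2 * p := ⟨α / 2, by ring⟩
  have hp : 1 / 2 ≤ p := by linarith
  have hp1 : p < 1 := by linarith
  have e : 2 * p / 2 = p := by ring
  rw [e]
  constructor
  -- The local norm does not involve a cut-off. Fixing one before the time step and the solution
  -- keeps the constant dependent only on `α`, `R` and `‖u 0‖`.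
  · obtain ⟨φ, hφ⟩ := exists_isCutoff hR
    obtain ⟨C, hC0, hC⟩ := exists_smoothing_bound hp hp1 hR hφ
    obtain ⟨c₁, c₂, hc₁, hc₂, hs⟩ := exists_hsNormSqOn_le hp hp1 hφ
    refine ⟨fun M => c₁ * M ^ 2 + c₂ * C M, fun τ hτ N u hu m hm => ⟨fun n hn => ?_, ?_⟩⟩
    · exact ⟨(Lp.memLp _).1.restrict,
        (hs _ (hu n (by omega)).1).trans_lt ENNReal.ofReal_lt_top⟩
    · set X : ℕ → ℝ := fun n => ∫ x, deriv φ x * ‖fracD p (midpt (u n) (u (n + 1))) x‖ ^ 2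
        with hX
      have hX0 : ∀ n, 0 ≤ X n := fun n =>
        integral_nonneg fun x => mul_nonneg (hφ.deriv_nonneg x) (sq_nonneg _)
      have h1 : ∀ n ∈ Finset.range m,
          hsNormSqOn p (Set.Icc (-R) R) (midpt (u n) (u (n + 1)))
            ≤ ENNReal.ofReal (c₁ * ‖u 0‖ ^ 2 + c₂ * X n) := by
        intro n hn
        rw [Finset.mem_range] at hn
        refine (hs _ (hu n (by omega)).1).trans (ENNReal.ofReal_le_ofReal ?_)
        have h2 : ‖midpt (u n) (u (n + 1))‖ ≤ ‖u 0‖ := by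
          refine (norm_midpt_le _ _).trans ?_
          rw [norm_eq_of_cnSolution hp hu n (by omega),
            norm_eq_of_cnSolution hp hu (n + 1) (by omega)]
          linarith
        gcongr
      calc _ ≤ ENNReal.ofReal τ
            * ∑ n ∈ Finset.range m, ENNReal.ofReal (c₁ * ‖u 0‖ ^ 2 + c₂ * X n) := by
            gcongr with n hn
            exact h1 n hn
        _ = ENNReal.ofReal (τ * ∑ n ∈ Finset.range m, (c₁ * ‖u 0‖ ^ 2 + c₂ * X n)) := by
            rw [ENNReal.ofReal_mul hτ.le, ENNReal.ofReal_sum_of_nonneg]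
            intro n _
            have := hX0 n
            positivity
        _ ≤ _ := by
            refine ENNReal.ofReal_le_ofReal ?_
            rw [Finset.sum_add_distrib, Finset.sum_const, Finset.card_range, nsmul_eq_mul,
              ← Finset.mul_sum]
            have h3 := mul_le_mul_of_nonneg_left (hC τ hτ N u hu m hm) hc₂
            have h4 : 0 ≤ c₁ * ‖u 0‖ ^ 2 := by positivity
            linarith
  · intro φ hφ
    obtain ⟨C, -, hC⟩ := exists_smoothing_bound hp hp1 hR hφ
    refine ⟨C, fun τ hτ N u hu m hm => ?_⟩
    simp only [lintegral_smoothing_eq hφ]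
    rw [← ENNReal.ofReal_sum_of_nonneg, ← ENNReal.ofReal_mul hτ.le]
    · exact ENNReal.ofReal_le_ofReal (hC τ hτ N u hu m hm)
    · exact fun n _ => integral_nonneg fun x => mul_nonneg (hφ.deriv_nonneg x) (sq_nonneg _)
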